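/- **Setting.** Let $(G;A,B)$ be a double Lie group: a (smooth, Hausdorff, second countable) Lie group $G$ with closed Lie subgroups $A,B$ such that $A\cap B=\{e\}$ and $G=AB$. Write $g=a_L(g)b_R(g)=b_L(g)a_R(g)$ with $a_L(g),a_R(g)\in A$, $b_L(g),b_R(g)\in B$, and let $\mathfrak g=\mathfrak a\oplus\mathfrak b$ be the Lie algebras. $G_A$ is the groupoid on $G$ with units $A$, projections $e_L=a_L$, $e_R=a_R$, product $(b_1a)(ab_2)=b_1ab_2$ and inverse $s(g)=a_R(g)b_R(g)^{-1}$. Its left and right fibres through $g$ are $F_l(g)=gB$ and $F_r(g)=Bg$, with tangent spaces $T^l_g=g\mathfrak b$, $T^r_g=\mathfrak bg$. $G_A\times G_A$ is the groupoid of $(G\times G;A\times A,B\times B)$. A bidensity is a section $\omega=\lambda\otimes\rho$ of $\Omega^{1/2}(T^l)\otimes\Omega^{1/2}(T^r)$ (complex half-densities); $\mathcal A(\Gamma)$ is the space of smooth compactly supported bidensities of the groupoid $\Gamma$. Put $\omega^*(g)(v\otimes w)=\overline{\omega(s(g))(s(w)\otimes s(v))}$. Integrals of 1-densities $d$ on cosets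 $cB$ are $\int_B d(cb)(cbe)\,d\mu(b)$, with a fixed basis $e$ of $\mathfrak b$ and a fixed left Haar measure $\mu$ on $B$ (this is the usual integral of a density if $\mu$ comes from the left-invariant density equal to $1$ on $e$; any other normalization is allowed as well). On $B\times B$ one uses $\mu\times\mu$ and the basis $(e,0),(0,e)$. *Action of morphisms.* Let $h$ be a groupoid morphism $\Gamma\to\Gamma'$ in the sense of Zakrzewski (a relation); only $h=\mathrm{id}$ and $h=\delta$ below are needed. For a unit $a'$ of $\Gamma'$ let $f_h(a')$ be the unit of $\Gamma$ related to $a'$, and for $x\in F_l(f_h(a'))$ (resp. $x\in F_r(f_h(a'))$) let $h^L_{a'}(x)$ (resp. $h^R_{a'}(x)$) be the element of $F_l(a')$ (resp. $F_r(a')$) related to $x$. For $e_R(x)=f_h(e'_L(y))$ put $m_h(x,y)=h^R_{e'_L(y)}(x)\,y$ and $t_h(x,y)=(x,m_h(x,y))$, a diffeomorphism of $\Gamma\times_hF_r(y)=\{e_R(x)=f_h(e_L'(\cdot))\}$ onto $\Gamma*_hF_r(y)=\{e_L(x)=f_h(e_L'(\cdot))\}$. With $z=m_h(x,y)$ the fibrations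 of these manifolds over $F_r(y)$ give isomorphisms $i_1$ of $\Omega^{1/2}T^r_x\otimes\Omega^{1/2}T^r_y$ and $i_2$ of $\Omega^{1/2}T^l_x\otimes\Omega^{1/2}T^r_z$ with the half-densities on the respective tangent spaces. For $\omega=\lambda\otimes\rho$ and $\omega'=\lambda'\otimes\rho'$ set $$(\hat h(\omega)\omega')(z)=\int_{F_l(f_h(e'_L(z)))}[\lambda(x)\tilde\lambda_x]\otimes\tilde\lambda'_z\otimes\tilde\rho_z,\qquad \tilde\lambda_x\otimes\tilde\rho_z=i_2^{-1}t_hi_1(\rho(x)\otimes\rho'(y)),$$ where $y=s'(h^L_{e_L'(z)}(x))z$ and $\tilde\lambda'_z$ is the image of $\lambda'(y)$ under $F_l(y)\ni u\mapsto h^R_{e'_L(y)}(x)u\in F_l(z)$. The product of $\mathcal A(\Gamma)$ is $\omega\omega'=\widehat{\mathrm{id}}(\omega)\omega'$. The comultiplication is $\hat\delta$, for $\delta:G_A\to G_A\times G_A$ the relation which relates $a_1ba_2$ to $(a_1b,ba_2)$ ($a_1,a_2\in A$, $b\in B$). *Products with $\hat\delta(\omega)$.* For $\omega,\omega_1\in\mathcal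 A(G_A)$, $\hat\delta(\omega)(I\otimes\omega_1)$ denotes the element $K\in\mathcal A(G_A\times G_A)$ with $K\eta=\hat\delta(\omega)\big((I\otimes\omega_1)\eta\big)$ for all $\eta\in\mathcal A(G_A\times G_A)$, and $(\omega_1\otimes I)\hat\delta(\omega)$ the element $K\in\mathcal A(G_A\times G_A)$ with $K\eta=(\omega_1\otimes I)\big(\hat\delta(\omega)\eta\big)$ for all such $\eta$. Here $I\otimes\omega_1$ and $\omega_1\otimes I$ act by left multiplication in the second, respectively first, variable. *Counit and coinverse.* $\epsilon(\omega)=\int_B\omega|_B$, where $\omega|_B=\lambda\otimes\rho$ is viewed as the 1-density $\lambda\rho$ on $B=F_l(e)=F_r(e)$. For $g\in G$ let $g_1:\mathfrak a\to\mathfrak a$ and $g_4:\mathfrak b\to\mathfrak b$ be the diagonal blocks of $\mathrm{Ad}(g)$ in $\mathfrak g=\mathfrak a\oplus\mathfrak b$, and $Q(g)=\det\mathrm{Ad}(g)/(\det g_1\det g_4)$. Put $\tau_z(\omega)=|Q|^{iz}\omega$, $R(\omega)(g)(v\otimes w)=\omega(g^{-1})(w^{-1}\otimes v^{-1})$ (with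 $v^{-1},w^{-1}$ the images under the tangent map of the group inverse) and $\kappa=R\circ\tau_{i/2}$. Finally $\epsilon\otimes\mathrm{id}$, $\mathrm{id}\otimes\epsilon$, $\kappa\otimes\mathrm{id}$, $\mathrm{id}\otimes\kappa$ and $m$ denote the natural extensions to $\mathcal A(G_A\times G_A)$ of these maps and of the multiplication map of $\mathcal A(G_A)$. **Proposition 5.2.** 1. $\epsilon$ is a character on $\mathcal A(G_A)$: it is linear, nonzero, $\epsilon(\omega\omega_1)=\epsilon(\omega)\epsilon(\omega_1)$ and $\epsilon(\omega^*)=\overline{\epsilon(\omega)}$ for all $\omega,\omega_1\in\mathcal A(G_A)$. For all $\omega,\omega_1\in\mathcal A(G_A)$ the products $\hat\delta(\omega)(I\otimes\omega_1)$ and $(\omega_1\otimes I)\hat\delta(\omega)$ exist in $\mathcal A(G_A\times G_A)$ and are unique, and 2. $(\epsilon\otimes\mathrm{id})\big(\hat\delta(\omega)(I\otimes\omega_1)\big)=\omega\omega_1$ and $(\mathrm{id}\otimes\epsilon)\big((\omega_1\otimes I)\hat\delta(\omega)\big)=\omega_1\omega$; 3. $m(\kappa\otimes\mathrm{id})\big(\hat\delta(\omega)(I\otimes\omega_1)\big)=\epsilon(\omega)\omega_1$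 and $m(\mathrm{id}\otimes\kappa)\big((\omega\otimes I)\hat\delta(\omega_1)\big)=\epsilon(\omega_1)\omega$. -/

import Mathlib

open MeasureTheory

/-- A double Lie group `(G; A, B)`: Lie groups `G`, `A`, `B`, where `A` and `B` are closed
(embedded) Lie subgroups of `G`, given by their inclusions, with `A ∩ B = {e}` and `G = AB`.
Note that `TangentSpace IA (1 : A)` is by definition the model space `EA`, so `EA`, `EB`, `E`
stand for the Lie algebras `𝔞`, `𝔟`, `𝔤`. -/
structure DoubleLieGroup
    {E : Type*} [NormedAddCommGroup E] [NormedSpace ℝ E] {H : Type*} [TopologicalSpace H]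
    (I : ModelWithCorners ℝ E H) (G : Type*) [TopologicalSpace G] [ChartedSpace H G] [Group G]
    {EA : Type*} [NormedAddCommGroup EA] [NormedSpace ℝ EA] {HA : Type*} [TopologicalSpace HA]
    (IA : ModelWithCorners ℝ EA HA) (A : Type*) [TopologicalSpace A] [ChartedSpace HA A] [Group A]
    {EB : Type*} [NormedAddCommGroup EB] [NormedSpace ℝ EB] {HB : Type*} [TopologicalSpace HB]
    (IB : ModelWithCorners ℝ EB HB) (B : Type*) [TopologicalSpace B] [ChartedSpace HB B]
    [Group B] where
  /-- the inclusion of `A` -/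
  ιA : A →* G
  /-- the inclusion of `B` -/
  ιB : B →* G
  contMDiff_ιA : ContMDiff IA I (⊤ : ℕ∞) ιA
  contMDiff_ιB : ContMDiff IB I (⊤ : ℕ∞) ιB
  isClosedEmbedding_ιA : Topology.IsClosedEmbedding ιA
  isClosedEmbedding_ιB : Topology.IsClosedEmbedding ιB
  immersion_ιA : ∀ a, Function.Injective (mfderiv IA I ιA a)
  immersion_ιB : ∀ b, Function.Injective (mfderiv IB I ιB b)
  inter_eq : ιA.range ⊓ ιB.range = ⊥
  mul_eq : ∀ g : G, ∃ a b, ιA a * ιB b = g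

namespace DoubleLieGroup

noncomputable section

/-- The adjoint representation of a Lie group. -/
def Ad {E : Type*} [NormedAddCommGroup E] [NormedSpace ℝ E] {H : Type*} [TopologicalSpace H]
    (I : ModelWithCorners ℝ E H) {G : Type*} [TopologicalSpace G] [ChartedSpace H G] [Group G]
    (g : G) : E →L[ℝ] E :=
  mfderiv I I (fun x : G => g * x * g⁻¹) 1

/-- Sections of `Ω^{1/2}(e_L) ⊗ Ω^{1/2}(e_R)`, before any regularity is imposed.

The left fibre of the groupoid `G_A` through `g` is the coset `gB` and the right fibre is `Bg`, so
`T_g^l = g𝔟` and `T_g^r = 𝔟g`. Left and right translations by `g` identify both with `𝔟 = EB`,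
and the number `ω g v w` is `ω(g)(gv ⊗ wg)`, the value of `ω(g)` on the frame
`(g v_i)` of `T_g^l` and the frame `(w_i g)` of `T_g^r`. -/
abbrev Sec (G EB κ : Type*) := G → (κ → EB) → (κ → EB) → ℂ

/-- Sections over `G × G` of the external tensor square of the bundle of bidensities:
`F g₁ g₂ v₁ w₁ v₂ w₂` is the value at `(g₁, g₂)` on `(g₁v₁ ⊗ w₁g₁) ⊗ (g₂v₂ ⊗ w₂g₂)`. -/
abbrev Sec₂ (G EB κ : Type*) :=
  G → G → (κ → EB) → (κ → EB) → (κ → EB) → (κ → EB) → ℂ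

/-- The frame `(v₁, 0), (0, v₂)` of a direct sum. -/
def block {EB κ : Type*} [Zero EB] (v₁ v₂ : κ → EB) : κ ⊕ κ → EB × EB :=
  Sum.elim (fun i => (v₁ i, 0)) (fun i => (0, v₂ i))

/-- The isomorphism `Ω^{1/2}(V₁ ⊕ V₂) ≃ Ω^{1/2}V₁ ⊗ Ω^{1/2}V₂`, applied to left and right
half-densities over `G × G`. -/
def split {G EB κ : Type*} [Zero EB] (K : Sec (G × G) (EB × EB) (κ ⊕ κ)) : Sec₂ G EB κ :=
  fun g₁ g₂ v₁ w₁ v₂ w₂ => K (g₁, g₂) (block v₁ v₂) (block w₁ w₂)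

section One

variable {E : Type*} [NormedAddCommGroup E] [NormedSpace ℝ E] {H : Type*} [TopologicalSpace H]
  {I : ModelWithCorners ℝ E H} {G : Type*} [TopologicalSpace G] [ChartedSpace H G] [Group G]
  {EA : Type*} [NormedAddCommGroup EA] [NormedSpace ℝ EA] {HA : Type*} [TopologicalSpace HA]
  {IA : ModelWithCorners ℝ EA HA} {A : Type*} [TopologicalSpace A] [ChartedSpace HA A] [Group A]
  {EB : Type*} [NormedAddCommGroup EB] [NormedSpace ℝ EB] {HB : Type*} [TopologicalSpace HB]
  {IB : ModelWithCorners ℝ EB HB} {B : Type*} [TopologicalSpace B] [ChartedSpace HB B] [Group B]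
  {κ : Type*}

/-! ### The groupoids of a double Lie group -/

/-- `a_L(g)`, where `g = a_L(g) b_R(g)`. -/
def aL (D : DoubleLieGroup I G IA A IB B) (g : G) : A :=
  (Classical.epsilon fun p : A × B => D.ιA p.1 * D.ιB p.2 = g).1

/-- `b_R(g)`, where `g = a_L(g) b_R(g)`. -/
def bR (D : DoubleLieGroup I G IA A IB B) (g : G) : B :=
  (Classical.epsilon fun p : A × B => D.ιA p.1 * D.ιB p.2 = g).2

/-- `b_L(g)`, where `g = b_L(g) a_R(g)`. -/
def bL (D : DoubleLieGroup I G IA A IB B) (g : G) : B :=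
  (Classical.epsilon fun p : B × A => D.ιB p.1 * D.ιA p.2 = g).1

/-- `a_R(g)`, where `g = b_L(g) a_R(g)`. -/
def aR (D : DoubleLieGroup I G IA A IB B) (g : G) : A :=
  (Classical.epsilon fun p : B × A => D.ιB p.1 * D.ιA p.2 = g).2

theorem aL_mul_bR (D : DoubleLieGroup I G IA A IB B) (g : G) :
    D.ιA (D.aL g) * D.ιB (D.bR g) = g := by
  obtain ⟨a, b, h⟩ := D.mul_eq g
  exact Classical.epsilon_spec (p := fun p : A × B => D.ιA p.1 * D.ιB p.2 = g) ⟨(a, b), h⟩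

theorem bL_mul_aR (D : DoubleLieGroup I G IA A IB B) (g : G) :
    D.ιB (D.bL g) * D.ιA (D.aR g) = g := by
  obtain ⟨a, b, h⟩ := D.mul_eq g⁻¹
  refine Classical.epsilon_spec (p := fun p : B × A => D.ιB p.1 * D.ιA p.2 = g) ⟨(b⁻¹, a⁻¹), ?_⟩
  simp only [map_inv]
  rw [← mul_inv_rev, h, inv_inv]

/-- The left projection `e_L` of the groupoid `G_A`, with values in the set of units `A ⊆ G`. -/
def eL (D : DoubleLieGroup I G IA A IB B) (g : G) : G := D.ιA (D.aL g)

/-- The right projection `e_R` of the groupoid `G_A`. -/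
def eR (D : DoubleLieGroup I G IA A IB B) (g : G) : G := D.ιA (D.aR g)

/-- The inverse of the groupoid `G_A`. -/
def sA (D : DoubleLieGroup I G IA A IB B) (g : G) : G := D.ιA (D.aR g) * (D.ιB (D.bR g))⁻¹

/-- The multiplication of the groupoid `G_A`, for composable elements `g₁ = b₁a`, `g₂ = ab₂`:
the product is `b₁ab₂`. -/
def mA (D : DoubleLieGroup I G IA A IB B) (g₁ g₂ : G) : G := g₁ * (D.eL g₂)⁻¹ * g₂

/-- The transpose `δ = m_B^T` of the multiplication of the groupoid `G_B`, as a relation from `G`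
to `G × G`: `g` is related to `(g₁, g₂)` if `g₁ = a₁b`, `g₂ = ba₂`, `g = a₁ba₂`. -/
def δ (D : DoubleLieGroup I G IA A IB B) (g : G) (p : G × G) : Prop :=
  ∃ (a₁ a₂ : A) (b : B), p.1 = D.ιA a₁ * D.ιB b ∧ p.2 = D.ιB b * D.ιA a₂ ∧
    g = D.ιA a₁ * D.ιB b * D.ιA a₂

/-! ### Bidensities -/

/-- The space `𝒜(G_A)` of smooth compactly supported bidensities: sections which are half-densities
in each of the two frames, and whose coefficients in the smooth frames `g ↦ gv`, `g ↦ wg` are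
smooth and compactly supported. -/
def 𝒜 (D : DoubleLieGroup I G IA A IB B) (κ : Type*) : Submodule ℂ (Sec G EB κ) where
  carrier := {ω |
    (∀ g (L : EB →ₗ[ℝ] EB) v w,
      ω g (fun i => L (v i)) w = ((|LinearMap.det L| ^ (1 / 2 : ℝ) : ℝ) : ℂ) * ω g v w) ∧
    (∀ g (L : EB →ₗ[ℝ] EB) v w,
      ω g v (fun i => L (w i)) = ((|LinearMap.det L| ^ (1 / 2 : ℝ) : ℝ) : ℂ) * ω g v w) ∧
    (∀ v w, ContMDiff I (modelWithCornersSelf ℝ ℂ) (⊤ : ℕ∞) fun g => ω g v w) ∧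
    (∀ v w, HasCompactSupport fun g => ω g v w)}
  zero_mem' := ⟨by simp, by simp, fun _ _ => contMDiff_const, fun _ _ => HasCompactSupport.zero⟩
  add_mem' := by
    rintro ω η ⟨h1, h2, h3, h4⟩ ⟨k1, k2, k3, k4⟩
    refine ⟨fun g L v w => ?_, fun g L v w => ?_, fun v w => (h3 v w).add (k3 v w),
      fun v w => (h4 v w).add (k4 v w)⟩
    · simp only [Pi.add_apply, h1, k1, mul_add]
    · simp only [Pi.add_apply, h2, k2, mul_add]
  smul_mem' := by
    rintro c ω ⟨h1, h2, h3, h4⟩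
    refine ⟨fun g L v w => ?_, fun g L v w => ?_, fun v w => ?_, fun v w => ?_⟩
    · simp only [Pi.smul_apply, h1, smul_eq_mul]; ring
    · simp only [Pi.smul_apply, h2, smul_eq_mul]; ring
    · exact (contDiff_const_smul (𝕜 := ℝ) c).contMDiff.comp (h3 v w)
    · exact (h4 v w).smul_left (f := fun _ => c)

/-- The tangent map of `s_A`, as a map `T_g^l → T_{s(g)}^r`, in the trivializations
`T_g^l = g𝔟` and `T_{s(g)}^r = 𝔟s(g)`. -/
def tangentLR (D : DoubleLieGroup I G IA A IB B) (g : G) : EB →L[ℝ] EB :=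
  mfderiv IB IB (fun β : B => D.bL (D.sA (g * D.ιB β) * (D.sA g)⁻¹)) 1

/-- The tangent map of `s_A`, as a map `T_g^r → T_{s(g)}^l`, in the trivializations
`T_g^r = 𝔟g` and `T_{s(g)}^l = s(g)𝔟`. -/
def tangentRL (D : DoubleLieGroup I G IA A IB B) (g : G) : EB →L[ℝ] EB :=
  mfderiv IB IB (fun β : B => D.bR ((D.sA g)⁻¹ * D.sA (D.ιB β * g))) 1

/-- The star operation `ω*(g)(v ⊗ w) = conj (ω(s(g))(s(w) ⊗ s(v)))`. -/
def star (D : DoubleLieGroup I G IA A IB B) (ω : Sec G EB κ) : Sec G EB κ := fun g v w =>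
  starRingEnd ℂ (ω (D.sA g) (fun i => D.tangentRL g (w i)) (fun i => D.tangentLR g (v i)))

/-- The isomorphism `𝔞 ⊕ 𝔟 → 𝔤`. -/
def sumMap (D : DoubleLieGroup I G IA A IB B) : (EA × EB) →L[ℝ] E :=
  ContinuousLinearMap.coprod (mfderiv IA I D.ιA 1 : EA →L[ℝ] E) (mfderiv IB I D.ιB 1 : EB →L[ℝ] E)

/-- The operator `Ad(g)`, written with respect to `𝔤 = 𝔞 ⊕ 𝔟`. -/
def AdMatrix (D : DoubleLieGroup I G IA A IB B) (g : G) : (EA × EB) →L[ℝ] (EA × EB) :=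
  D.sumMap.inverse ∘L Ad I g ∘L D.sumMap

/-- `Q(g) = det(Ad(g)) / (det(g₁) det(g₄))`, where `g₁ : 𝔞 → 𝔞` and `g₄ : 𝔟 → 𝔟` are the
diagonal blocks of `Ad(g)`. -/
def Q (D : DoubleLieGroup I G IA A IB B) (g : G) : ℝ :=
  (Ad I g).det /
    ((ContinuousLinearMap.fst ℝ EA EB ∘L D.AdMatrix g ∘L ContinuousLinearMap.inl ℝ EA EB).det *
     (ContinuousLinearMap.snd ℝ EA EB ∘L D.AdMatrix g ∘L ContinuousLinearMap.inr ℝ EA EB).det)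

/-- `τ_z(ω) = |Q|^{iz} ω`. -/
def τ (D : DoubleLieGroup I G IA A IB B) (z : ℂ) (ω : Sec G EB κ) : Sec G EB κ := fun g v w =>
  ((|D.Q g| : ℝ) : ℂ) ^ (Complex.I * z) * ω g v w

/-- `R(ω)(g)(v ⊗ w) = ω(g⁻¹)(w⁻¹ ⊗ v⁻¹)`, where `v⁻¹`, `w⁻¹` are the images under the tangent map
of the group inverse, which sends `gX` to `-Xg⁻¹` and `Xg` to `-g⁻¹X`. -/
def R (ω : Sec G EB κ) : Sec G EB κ := fun g v w => ω g⁻¹ (fun i => -w i) (fun i => -v i)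

/-- The coinverse `κ = R ∘ τ_{i/2}`. -/
def coinv (D : DoubleLieGroup I G IA A IB B) (ω : Sec G EB κ) : Sec G EB κ :=
  R (D.τ (Complex.I / 2) ω)

/-- The extension `κ ⊗ id`. -/
def coinvTensorId (D : DoubleLieGroup I G IA A IB B) (F : Sec₂ G EB κ) : Sec₂ G EB κ :=
  fun g₁ g₂ v₁ w₁ v₂ w₂ => D.coinv (fun g v w => F g g₂ v w v₂ w₂) g₁ v₁ w₁

/-- The extension `id ⊗ κ`. -/
def idTensorCoinv (D : DoubleLieGroup I G IA A IB B) (F : Sec₂ G EB κ) : Sec₂ G EB κ :=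
  fun g₁ g₂ v₁ w₁ v₂ w₂ => D.coinv (fun g v w => F g₁ g v₁ w₁ v w) g₂ v₂ w₂

section Counit

variable [MeasurableSpace B]

/-- The counit: the integral over `B` of the 1-density `λρ` on `B`, where `ω|_B = λ ⊗ ρ`.

The integral of a 1-density `d` on a coset `cB` is `∫_B d(cb)(cbe) dμ(b)`, where `e` is a fixed
basis of `𝔟` and `μ` a fixed left Haar measure of `B`; this is the usual integral of a density
if `μ` is the measure given by the left-invariant density with value `1` on `e`, and a constant
multiple of it in general. Here `c = 1` and `d(b)(be) = ω(b)(be ⊗ be)`, with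
`be = (Ad(b)e)b`. -/
def counit (D : DoubleLieGroup I G IA A IB B) (e : Module.Basis κ ℝ EB) (μ : Measure B)
    (ω : Sec G EB κ) : ℂ :=
  ∫ b, ω (D.ιB b) e (fun i => Ad IB b (e i)) ∂μ

/-- The extension `ε ⊗ id`. -/
def counitTensorId (D : DoubleLieGroup I G IA A IB B) (e : Module.Basis κ ℝ EB) (μ : Measure B)
    (F : Sec₂ G EB κ) : Sec G EB κ :=
  fun g v w => D.counit e μ fun g₁ v₁ w₁ => F g₁ g v₁ w₁ v w

/-- The extension `id ⊗ ε`. -/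
def idTensorCounit (D : DoubleLieGroup I G IA A IB B) (e : Module.Basis κ ℝ EB) (μ : Measure B)
    (F : Sec₂ G EB κ) : Sec G EB κ :=
  fun g v w => D.counit e μ fun g₂ v₂ w₂ => F g g₂ v w v₂ w₂

end Counit

end One

section Morphism

/-! ### The action of groupoid morphisms on bidensities

`D` and `D'` are double Lie groups, and `h` is a relation from `Γ = G_A` to `Γ' = G'_{A'}`. -/

variable {E : Type*} [NormedAddCommGroup E] [NormedSpace ℝ E] {H : Type*} [TopologicalSpace H]
  {I : ModelWithCorners ℝ E H} {G : Type*} [TopologicalSpace G] [ChartedSpace H G] [Group G]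
  {EA : Type*} [NormedAddCommGroup EA] [NormedSpace ℝ EA] {HA : Type*} [TopologicalSpace HA]
  {IA : ModelWithCorners ℝ EA HA} {A : Type*} [TopologicalSpace A] [ChartedSpace HA A] [Group A]
  {EB : Type*} [NormedAddCommGroup EB] [NormedSpace ℝ EB] {HB : Type*} [TopologicalSpace HB]
  {IB : ModelWithCorners ℝ EB HB} {B : Type*} [TopologicalSpace B] [ChartedSpace HB B] [Group B]
  {E' : Type*} [NormedAddCommGroup E'] [NormedSpace ℝ E'] {H' : Type*} [TopologicalSpace H']
  {I' : ModelWithCorners ℝ E' H'} {G' : Type*} [TopologicalSpace G'] [ChartedSpace H' G']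
  [Group G']
  {EA' : Type*} [NormedAddCommGroup EA'] [NormedSpace ℝ EA'] {HA' : Type*} [TopologicalSpace HA']
  {IA' : ModelWithCorners ℝ EA' HA'} {A' : Type*} [TopologicalSpace A'] [ChartedSpace HA' A']
  [Group A']
  {EB' : Type*} [NormedAddCommGroup EB'] [NormedSpace ℝ EB'] {HB' : Type*} [TopologicalSpace HB']
  {IB' : ModelWithCorners ℝ EB' HB'} {B' : Type*} [TopologicalSpace B'] [ChartedSpace HB' B']
  [Group B'] {κ κ' : Type*}

/-- The base map `f_h : E' → E`: `f_h(a')` is the unit of `Γ` related to the unit `a'`. -/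
def baseMap (D : DoubleLieGroup I G IA A IB B) (h : G → G' → Prop) (a' : G') : G :=
  Classical.epsilon fun a => a ∈ D.ιA.range ∧ h a a'

/-- `h_{a'}^L(x)`: the element of the left fibre over `a'` related to `x`. -/
def hL (D' : DoubleLieGroup I' G' IA' A' IB' B') (h : G → G' → Prop) (x : G) (a' : G') : G' :=
  Classical.epsilon fun y => D'.eL y = a' ∧ h x y

/-- `h_{a'}^R(x)`: the element of the right fibre over `a'` related to `x`. -/
def hR (D' : DoubleLieGroup I' G' IA' A' IB' B') (h : G → G' → Prop) (x : G) (a' : G') : G' :=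
  Classical.epsilon fun y => D'.eR y = a' ∧ h x y

/-- `m_h(x, y) = h^R(x, e_L'(y)) y`, for `(x, y) ∈ Γ ×_h Γ'`, i.e. `e_R(x) = f_h(e_L'(y))`. -/
def mh (D' : DoubleLieGroup I' G' IA' A' IB' B') (h : G → G' → Prop) (x : G) (y : G') : G' :=
  D'.mA (D'.hR h x (D'.eL y)) y

/-- The Jacobian of the diffeomorphism `t_h : (x, y) ↦ (x, m_h(x, y))` from `Γ ×_h F_r(y)` onto
`Γ *_h F_r(y) = {(x, z) : e_L(x) = f_h(e_L'(z))}`, at `(x, y)`.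

Put `z = m_h(x, y)`. The domain is parametrized near `(x, y)` by
`(β, β') ↦ (β b_L(x) f_h(e_L'(β'y)), β'y)` and the range is parametrized near `(x, z)` by
`(γ, β'') ↦ (f_h(e_L'(β''z)) b_R(x) γ, β''z)`, with `β, γ ∈ B` and `β', β'' ∈ B'`. The derivatives
of these parametrizations at `(1, 1)` induce precisely the isomorphisms
`i₁ : Ω_R^{1/2}(x) ⊗ Ω_R^{1/2}(y) → Ω^{1/2} T_{(x, y)}(Γ ×_h F_r(y))` and
`i₂ : Ω_L^{1/2}(x) ⊗ Ω_R^{1/2}(z) → Ω^{1/2} T_{(x, z)}(Γ *_h F_r(y))` (given by the fibrations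
over `F_r(y)`), when `T_x^r = 𝔟x`, `T_y^r = 𝔟'y`, `T_x^l = x𝔟`, `T_z^r = 𝔟'z` are identified with
`𝔟` and `𝔟'`. So `i₂⁻¹ t_h i₁ (ρ ⊗ ρ')`, on frames `(xv, wz)`, is `|J|^{-1/2} ρ(vx) ρ'(wy)`, where
`J` is the determinant of the derivative at `(1, 1)` of `t_h`, written in these parameters. -/
def jac (D : DoubleLieGroup I G IA A IB B) (D' : DoubleLieGroup I' G' IA' A' IB' B')
    (h : G → G' → Prop) (x : G) (y : G') : ℝ :=
  ContinuousLinearMap.det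
    (mfderiv (IB.prod IB') (IB.prod IB')
      (fun p : B × B' =>
        ((D.bR x)⁻¹ *
            D.bR (D.ιB p.1 * D.ιB (D.bL x) * D.baseMap h (D'.eL (D'.ιB p.2 * y))),
          D'.bL (D'.mh h (D.ιB p.1 * D.ιB (D.bL x) * D.baseMap h (D'.eL (D'.ιB p.2 * y)))
              (D'.ιB p.2 * y) * (D'.mh h x y)⁻¹)))
      (1, 1) : (EB × EB') →L[ℝ] (EB × EB'))

variable [MeasurableSpace B]

/-- The fibre integral in the definition of `ĥ`. For a given `z`, the variable
`x = f_h(e_L'(z)) b` runs over `F_l(f_h(e_L'(z)))`, `y = s'(h^L(x)) z` is determined by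
`m_h(x, y) = z`, and `Φ x v w y` stands for the value at `x`, on the frames `(xv, wx)`, of the left
factor times the value at `y` of the right factor. -/
def fibreIntegral (D : DoubleLieGroup I G IA A IB B) (D' : DoubleLieGroup I' G' IA' A' IB' B')
    (e : Module.Basis κ ℝ EB) (μ : Measure B) (h : G → G' → Prop)
    (Φ : G → (κ → EB) → (κ → EB) → G' → ℂ) (z : G') : ℂ :=
  ∫ b : B,
    (let x : G := D.baseMap h (D'.eL z) * D.ιB b
     let y : G' := D'.mA (D'.sA (D'.hL h x (D'.eL z))) z
     ((|jac D D' h x y| ^ (-(1 / 2) : ℝ) : ℝ) : ℂ) * Φ x e e y) ∂μ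

/-- The action `ĥ(ω)ω'`. The value at `z` on the frames `(zv, wz)` is the integral over
`F_l(f_h(e_L'(z)))` of `[λ λ̃_x] ⊗ λ̃'_z ⊗ ρ̃_z`, where `ω = λ ⊗ ρ`, `ω' = λ' ⊗ ρ'`,
`λ̃_x ⊗ ρ̃_z = i₂⁻¹ t_h i₁ (ρ(x) ⊗ ρ'(y))`, and `λ̃'_z` is the image of `λ'(y)` under
`F_l(y) ∋ u ↦ h^R(x) u ∈ F_l(z)`. The latter map is the left translation of `G'` by `z y⁻¹`, so
that `λ̃'_z(zv) = λ'(y)(yv)`. -/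
def hat (D : DoubleLieGroup I G IA A IB B) (D' : DoubleLieGroup I' G' IA' A' IB' B')
    (e : Module.Basis κ ℝ EB) (μ : Measure B) (h : G → G' → Prop)
    (ω : Sec G EB κ) (ω' : Sec G' EB' κ') : Sec G' EB' κ' :=
  fun z v w => fibreIntegral D D' e μ h (fun x v₁ w₁ y => ω x v₁ w₁ * ω' y v w) z

end Morphism

section Algebra

variable {E : Type*} [NormedAddCommGroup E] [NormedSpace ℝ E] {H : Type*} [TopologicalSpace H]
  {I : ModelWithCorners ℝ E H} {G : Type*} [TopologicalSpace G] [ChartedSpace H G] [Group G]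
  {EA : Type*} [NormedAddCommGroup EA] [NormedSpace ℝ EA] {HA : Type*} [TopologicalSpace HA]
  {IA : ModelWithCorners ℝ EA HA} {A : Type*} [TopologicalSpace A] [ChartedSpace HA A] [Group A]
  {EB : Type*} [NormedAddCommGroup EB] [NormedSpace ℝ EB] {HB : Type*} [TopologicalSpace HB]
  {IB : ModelWithCorners ℝ EB HB} {B : Type*} [TopologicalSpace B] [ChartedSpace HB B] [Group B]
  {κ : Type*}

/-- The product `(G × G; A × A, B × B)`, whose groupoid is `G_A × G_A`. -/
def square (D : DoubleLieGroup I G IA A IB B) :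
    DoubleLieGroup (I.prod I) (G × G) (IA.prod IA) (A × A) (IB.prod IB) (B × B) where
  ιA := D.ιA.prodMap D.ιA
  ιB := D.ιB.prodMap D.ιB
  contMDiff_ιA := D.contMDiff_ιA.prodMap D.contMDiff_ιA
  contMDiff_ιB := D.contMDiff_ιB.prodMap D.contMDiff_ιB
  isClosedEmbedding_ιA := D.isClosedEmbedding_ιA.prodMap D.isClosedEmbedding_ιA
  isClosedEmbedding_ιB := D.isClosedEmbedding_ιB.prodMap D.isClosedEmbedding_ιB
  immersion_ιA := by
    intro a
    have h := mfderiv_prodMap (p := a)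
      (D.contMDiff_ιA.mdifferentiable (by simp) a.1) (D.contMDiff_ιA.mdifferentiable (by simp) a.2)
    change Function.Injective (mfderiv (IA.prod IA) (I.prod I) (Prod.map D.ιA D.ιA) a)
    rw [h]
    exact (D.immersion_ιA a.1).prodMap (D.immersion_ιA a.2)
  immersion_ιB := by
    intro a
    have h := mfderiv_prodMap (p := a)
      (D.contMDiff_ιB.mdifferentiable (by simp) a.1) (D.contMDiff_ιB.mdifferentiable (by simp) a.2)
    change Function.Injective (mfderiv (IB.prod IB) (I.prod I) (Prod.map D.ιB D.ιB) a)
    rw [h]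
    exact (D.immersion_ιB a.1).prodMap (D.immersion_ιB a.2)
  inter_eq := by
    rw [eq_bot_iff]
    rintro x ⟨⟨a, ha⟩, ⟨b, hb⟩⟩
    have key : ∀ (a : A) (b : B), D.ιA a = D.ιB b → D.ιA a = 1 := by
      intro a b hab
      have : D.ιA a ∈ D.ιA.range ⊓ D.ιB.range := ⟨⟨a, rfl⟩, ⟨b, hab.symm⟩⟩
      rw [D.inter_eq] at this
      exact Subgroup.mem_bot.mp this
    have hab := ha.trans hb.symm
    rw [Subgroup.mem_bot, ← ha]
    exact Prod.ext (key a.1 b.1 (congrArg Prod.fst hab)) (key a.2 b.2 (congrArg Prod.snd hab))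
  mul_eq := by
    rintro ⟨g₁, g₂⟩
    obtain ⟨a₁, b₁, h₁⟩ := D.mul_eq g₁
    obtain ⟨a₂, b₂, h₂⟩ := D.mul_eq g₂
    exact ⟨(a₁, a₂), (b₁, b₂), Prod.ext h₁ h₂⟩

variable [MeasurableSpace B]

/-- The product of `𝒜(G_A)`: the action `ĥ` for the identity morphism. -/
def mul (D : DoubleLieGroup I G IA A IB B) (e : Module.Basis κ ℝ EB) (μ : Measure B)
    (ω₁ ω₂ : Sec G EB κ) : Sec G EB κ :=
  hat D D e μ (fun x y => x = y) ω₁ ω₂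

/-- The product of `𝒜(G_A × G_A)`. -/
def mulSquare (D : DoubleLieGroup I G IA A IB B) (e : Module.Basis κ ℝ EB) (μ : Measure B)
    (K η : Sec (G × G) (EB × EB) (κ ⊕ κ)) : Sec (G × G) (EB × EB) (κ ⊕ κ) :=
  D.square.mul (e.prod e) (μ.prod μ) K η

/-- The extension `m` of the multiplication `ω₁ ⊗ ω₂ ↦ ω₁ω₂`. -/
def mulExt (D : DoubleLieGroup I G IA A IB B) (e : Module.Basis κ ℝ EB) (μ : Measure B)
    (F : Sec₂ G EB κ) : Sec G EB κ :=
  fun z v w => fibreIntegral D D e μ (fun x y => x = y) (fun x v₁ w₁ y => F x y v₁ w₁ v w) z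

/-- `(ω ⊗ I)η`, i.e. multiplication by `ω` from the left in the first variable. -/
def leftFst (D : DoubleLieGroup I G IA A IB B) (e : Module.Basis κ ℝ EB) (μ : Measure B)
    (ω : Sec G EB κ) (η : Sec (G × G) (EB × EB) (κ ⊕ κ)) : Sec (G × G) (EB × EB) (κ ⊕ κ) :=
  fun z v w => fibreIntegral D D e μ (fun x y => x = y)
    (fun x v₁ w₁ y => ω x v₁ w₁ * η (y, z.2) v w) z.1

/-- `(I ⊗ ω)η`, i.e. multiplication by `ω` from the left in the second variable. -/
def leftSnd (D : DoubleLieGroup I G IA A IB B) (e : Module.Basis κ ℝ EB) (μ : Measure B)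
    (ω : Sec G EB κ) (η : Sec (G × G) (EB × EB) (κ ⊕ κ)) : Sec (G × G) (EB × EB) (κ ⊕ κ) :=
  fun z v w => fibreIntegral D D e μ (fun x y => x = y)
    (fun x v₁ w₁ y => ω x v₁ w₁ * η (z.1, y) v w) z.2

/-- `δ̂(ω)η`, for `ω ∈ 𝒜(G_A)` and `η ∈ 𝒜(G_A × G_A)`. -/
def δhat (D : DoubleLieGroup I G IA A IB B) (e : Module.Basis κ ℝ EB) (μ : Measure B)
    (ω : Sec G EB κ) (η : Sec (G × G) (EB × EB) (κ ⊕ κ)) : Sec (G × G) (EB × EB) (κ ⊕ κ) :=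
  hat D D.square e μ D.δ ω η

/-- `K ∈ 𝒜(G_A × G_A)` is the product `δ̂(ω)(I ⊗ ω₁)`: both are the same (left) multiplier. -/
def IsDeltaMulRight (D : DoubleLieGroup I G IA A IB B) (e : Module.Basis κ ℝ EB) (μ : Measure B)
    (ω ω₁ : Sec G EB κ) (K : Sec (G × G) (EB × EB) (κ ⊕ κ)) : Prop :=
  K ∈ D.square.𝒜 (κ ⊕ κ) ∧
    ∀ η ∈ D.square.𝒜 (κ ⊕ κ), D.mulSquare e μ K η = D.δhat e μ ω (D.leftSnd e μ ω₁ η)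

/-- `K ∈ 𝒜(G_A × G_A)` is the product `(ω₁ ⊗ I)δ̂(ω)`: both are the same (left) multiplier. -/
def IsMulDeltaLeft (D : DoubleLieGroup I G IA A IB B) (e : Module.Basis κ ℝ EB) (μ : Measure B)
    (ω₁ ω : Sec G EB κ) (K : Sec (G × G) (EB × EB) (κ ⊕ κ)) : Prop :=
  K ∈ D.square.𝒜 (κ ⊕ κ) ∧
    ∀ η ∈ D.square.𝒜 (κ ⊕ κ), D.mulSquare e μ K η = D.leftFst e μ ω₁ (D.δhat e μ ω η)

end Algebra

end

end DoubleLieGroup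

set_option linter.unusedSectionVars false

/-! In the fixed frame `e` a bidensity is a scalar function f on G (`eq_ofFun`), and every
half-density twist in the definitions becomes a power of one of two positive characters: w =
`weight` on A, that is |det Ad_A(a)| / |det Ad_G(a)|, and the modulus |det Ad_B(b)| on B. Their
square roots are `rootWeight` and `rootMod`. The Jacobians of t_id and t_δ are products of such
terms (`jac_id`, `jac_δ`, `abs_det_derNu`), since in suitable parameters the derivatives are
triangular; |Q| is a quotient of such terms (`abs_Q`). Hence the product is a weighted convolution
(`fibreIntegral_id`), (f f₁)(z) = ∫ w(a_R(x))^{-1/2} f(x) f₁(b_L(x)⁻¹z) dμ(b) with x = a_L(z)b, and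
δ̂ has a formula of the same kind (`δhat_apply`).

The multiplier δ̂(ω)(I ⊗ ω₁) is left convolution by an explicit function `kernelR`: a positive
factor times f ⊗ f₁ composed with a homeomorphism of G × G, hence smooth with compact support.
`kernelL` does the same for (ω₁ ⊗ I)δ̂(ω). The identities behind this, `integral_kernelR` and
`integral_kernelL`, are Fubini together with changes of variable on B. Testing against bump
functions shows that a kernel is determined by its convolution operator (`eq_of_mul_eq`).

The counit and antipode identities follow by inserting the kernels. On B the weights from A are 1,
products restrict to convolution on B, and ε integrates against |det Ad|^{1/2} dμ, a measure
invariant under inversion. The coinverse inverts the argument and multiplies by |Q(g⁻¹)|^{-1/2}. In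
each antipode identity the inversion makes one argument of the kernel equal to z while the other
runs over B, and the power of Q leaves exactly the density of a change of variable on B.

Two analytic inputs remain. The factor maps are smooth: 𝔞 and 𝔟 meet trivially by uniqueness of
integral curves, A × B → G is open, a Hausdorff dimension count gives 𝔤 = 𝔞 + 𝔟, and the inverse
function theorem applies. The second input is the change of variables formula for Haar measure,
`integral_abs_det_smul_comp`, used for right translations, inversion and the action of A on B. -/

namespace DoubleLieGroup

/-! ### Factorizations in a double Lie group; the relations id and δ made explicit. -/

section Decomposition

variable {E : Type*} [NormedAddCommGroup E] [NormedSpace ℝ E] {H : Type*} [TopologicalSpace H]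
  {I : ModelWithCorners ℝ E H} {G : Type*} [TopologicalSpace G] [ChartedSpace H G] [Group G]
  {EA : Type*} [NormedAddCommGroup EA] [NormedSpace ℝ EA] {HA : Type*} [TopologicalSpace HA]
  {IA : ModelWithCorners ℝ EA HA} {A : Type*} [TopologicalSpace A] [ChartedSpace HA A] [Group A]
  {EB : Type*} [NormedAddCommGroup EB] [NormedSpace ℝ EB] {HB : Type*} [TopologicalSpace HB]
  {IB : ModelWithCorners ℝ EB HB} {B : Type*} [TopologicalSpace B] [ChartedSpace HB B] [Group B]
variable (D : DoubleLieGroup I G IA A IB B)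

theorem ιA_injective : Function.Injective D.ιA := D.isClosedEmbedding_ιA.injective

theorem ιB_injective : Function.Injective D.ιB := D.isClosedEmbedding_ιB.injective

theorem eq_one_of_ιA_eq_ιB {a : A} {b : B} (h : D.ιA a = D.ιB b) : a = 1 ∧ b = 1 := by
  have h1 : D.ιA a ∈ D.ιA.range ⊓ D.ιB.range := ⟨⟨a, rfl⟩, ⟨b, h.symm⟩⟩
  rw [D.inter_eq, Subgroup.mem_bot] at h1
  refine ⟨D.ιA_injective (by rw [h1, map_one]), D.ιB_injective (by rw [← h, h1, map_one])⟩

theorem mul_unique {a a' : A} {b b' : B} (h : D.ιA a * D.ιB b = D.ιA a' * D.ιB b') :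
    a = a' ∧ b = b' := by
  have h1 : D.ιA (a'⁻¹ * a) = D.ιB (b' * b⁻¹) := by
    rw [map_mul, map_mul, map_inv, map_inv, inv_mul_eq_iff_eq_mul, ← mul_assoc, ← h,
      mul_inv_cancel_right]
  obtain ⟨h2, h3⟩ := D.eq_one_of_ιA_eq_ιB h1
  exact ⟨(inv_mul_eq_one.mp h2).symm, (mul_inv_eq_one.mp h3).symm⟩

theorem mul_unique' {a a' : A} {b b' : B} (h : D.ιB b * D.ιA a = D.ιB b' * D.ιA a') :
    a = a' ∧ b = b' := by
  have h1 : D.ιA (a * a'⁻¹) = D.ιB (b⁻¹ * b') := by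
    rw [map_mul, map_mul, map_inv, map_inv, mul_inv_eq_iff_eq_mul, mul_assoc, ← h,
      inv_mul_cancel_left]
  obtain ⟨h2, h3⟩ := D.eq_one_of_ιA_eq_ιB h1
  exact ⟨mul_inv_eq_one.mp h2, inv_mul_eq_one.mp h3⟩

theorem aL_eq {a : A} {b : B} {g : G} (h : D.ιA a * D.ιB b = g) : D.aL g = a :=
  (D.mul_unique ((D.aL_mul_bR g).trans h.symm)).1

theorem bR_eq {a : A} {b : B} {g : G} (h : D.ιA a * D.ιB b = g) : D.bR g = b :=
  (D.mul_unique ((D.aL_mul_bR g).trans h.symm)).2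

theorem aR_eq {a : A} {b : B} {g : G} (h : D.ιB b * D.ιA a = g) : D.aR g = a :=
  (D.mul_unique' ((D.bL_mul_aR g).trans h.symm)).1

theorem bL_eq {a : A} {b : B} {g : G} (h : D.ιB b * D.ιA a = g) : D.bL g = b :=
  (D.mul_unique' ((D.bL_mul_aR g).trans h.symm)).2

@[simp] theorem aL_ιA_mul (a : A) (g : G) : D.aL (D.ιA a * g) = a * D.aL g :=
  D.aL_eq (b := D.bR g) (by rw [map_mul, mul_assoc, aL_mul_bR])

@[simp] theorem bR_ιA_mul (a : A) (g : G) : D.bR (D.ιA a * g) = D.bR g :=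
  D.bR_eq (a := a * D.aL g) (by rw [map_mul, mul_assoc, aL_mul_bR])

@[simp] theorem aL_mul_ιB (g : G) (b : B) : D.aL (g * D.ιB b) = D.aL g :=
  D.aL_eq (b := D.bR g * b) (by rw [map_mul, ← mul_assoc, aL_mul_bR])

@[simp] theorem bR_mul_ιB (g : G) (b : B) : D.bR (g * D.ιB b) = D.bR g * b :=
  D.bR_eq (a := D.aL g) (by rw [map_mul, ← mul_assoc, aL_mul_bR])

@[simp] theorem bL_ιB_mul (b : B) (g : G) : D.bL (D.ιB b * g) = b * D.bL g :=
  D.bL_eq (a := D.aR g) (by rw [map_mul, mul_assoc, bL_mul_aR])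

@[simp] theorem aR_ιB_mul (b : B) (g : G) : D.aR (D.ιB b * g) = D.aR g :=
  D.aR_eq (b := b * D.bL g) (by rw [map_mul, mul_assoc, bL_mul_aR])

@[simp] theorem bL_mul_ιA (g : G) (a : A) : D.bL (g * D.ιA a) = D.bL g :=
  D.bL_eq (a := D.aR g * a) (by rw [map_mul, ← mul_assoc, bL_mul_aR])

@[simp] theorem aR_mul_ιA (g : G) (a : A) : D.aR (g * D.ιA a) = D.aR g * a :=
  D.aR_eq (b := D.bL g) (by rw [map_mul, ← mul_assoc, bL_mul_aR])

@[simp] theorem aL_ιA (a : A) : D.aL (D.ιA a) = a := D.aL_eq (b := 1) (by simp)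
@[simp] theorem bR_ιA (a : A) : D.bR (D.ιA a) = 1 := D.bR_eq (a := a) (by simp)
@[simp] theorem aR_ιA (a : A) : D.aR (D.ιA a) = a := D.aR_eq (b := 1) (by simp)
@[simp] theorem bL_ιA (a : A) : D.bL (D.ιA a) = 1 := D.bL_eq (a := a) (by simp)
@[simp] theorem aL_ιB (b : B) : D.aL (D.ιB b) = 1 := D.aL_eq (b := b) (by simp)
@[simp] theorem bR_ιB (b : B) : D.bR (D.ιB b) = b := D.bR_eq (a := 1) (by simp)
@[simp] theorem aR_ιB (b : B) : D.aR (D.ιB b) = 1 := D.aR_eq (b := b) (by simp)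
@[simp] theorem bL_ιB (b : B) : D.bL (D.ιB b) = b := D.bL_eq (a := 1) (by simp)

@[simp] theorem aL_inv (g : G) : D.aL g⁻¹ = (D.aR g)⁻¹ :=
  D.aL_eq (b := (D.bL g)⁻¹) (by rw [map_inv, map_inv, ← mul_inv_rev, bL_mul_aR])

@[simp] theorem aR_inv (g : G) : D.aR g⁻¹ = (D.aL g)⁻¹ :=
  D.aR_eq (b := (D.bR g)⁻¹) (by rw [map_inv, map_inv, ← mul_inv_rev, aL_mul_bR])

@[simp] theorem bL_inv (g : G) : D.bL g⁻¹ = (D.bR g)⁻¹ :=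
  D.bL_eq (a := (D.aL g)⁻¹) (by rw [map_inv, map_inv, ← mul_inv_rev, aL_mul_bR])

@[simp] theorem bR_inv (g : G) : D.bR g⁻¹ = (D.bL g)⁻¹ :=
  D.bR_eq (a := (D.aR g)⁻¹) (by rw [map_inv, map_inv, ← mul_inv_rev, bL_mul_aR])

theorem ιB_bL (g : G) : D.ιB (D.bL g) = g * (D.ιA (D.aR g))⁻¹ :=
  eq_mul_inv_of_mul_eq (D.bL_mul_aR g)

theorem ιB_bR (g : G) : D.ιB (D.bR g) = (D.ιA (D.aL g))⁻¹ * g :=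
  eq_inv_mul_of_mul_eq (D.aL_mul_bR g)

theorem sA_eq (g : G) : D.sA g = (D.ιB (D.bL g))⁻¹ * D.ιA (D.aL g) := by
  rw [sA, ιB_bL, ιB_bR]; group

/-- Combined with `mA_eq`, this turns the groupoid quotient s(g)z into the group translate
b_L(g)⁻¹z, the form in which it enters every integral. -/
theorem sA_mul_ιB_bR (g z : G) (h : D.aL g = D.aL z) :
    D.sA g * D.ιB (D.bR z) = (D.ιB (D.bL g))⁻¹ * z := by
  rw [sA_eq, h, mul_assoc, aL_mul_bR]

theorem mA_eq (g z : G) : D.mA g z = g * D.ιB (D.bR z) := by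
  rw [mA, eL, ιB_bR]; group

theorem aL_inv_bL_mul (g : G) : D.aL ((D.ιB (D.bL g))⁻¹ * D.ιA (D.aL g)) = D.aR g := by
  rw [← sA_eq, sA, ← map_inv, aL_mul_ιB, aL_ιA]

/-- The left unit of s(g)z is the right unit of g. This identifies the argument of the weight
produced by the Jacobian. -/
theorem aL_inv_bL_mul' {g z : G} (h : D.aL g = D.aL z) :
    D.aL ((D.ιB (D.bL g))⁻¹ * z) = D.aR g := by
  rw [← aL_mul_bR D z, ← h, ← mul_assoc, aL_mul_ιB, aL_inv_bL_mul]

/-! ### The relations `id` and `δ` -/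

theorem baseMap_id (a : A) : D.baseMap (fun x y => x = y) (D.ιA a) = D.ιA a :=
  (Classical.epsilon_spec (p := fun x : G => x ∈ D.ιA.range ∧ x = D.ιA a)
    ⟨D.ιA a, ⟨a, rfl⟩, rfl⟩).2

theorem hL_id (x : G) : D.hL (fun x y => x = y) x (D.eL x) = x :=
  (Classical.epsilon_spec (p := fun y : G => D.eL y = D.eL x ∧ x = y) ⟨x, rfl, rfl⟩).2.symm

theorem hR_id (x : G) : D.hR (fun x y => x = y) x (D.eR x) = x :=
  (Classical.epsilon_spec (p := fun y : G => D.eR y = D.eR x ∧ x = y) ⟨x, rfl, rfl⟩).2.symm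

@[simp] theorem square_ιA (p : A × A) : D.square.ιA p = (D.ιA p.1, D.ιA p.2) := rfl

@[simp] theorem square_ιB (p : B × B) : D.square.ιB p = (D.ιB p.1, D.ιB p.2) := rfl

@[simp] theorem square_aL (z : G × G) : D.square.aL z = (D.aL z.1, D.aL z.2) :=
  D.square.aL_eq (b := (D.bR z.1, D.bR z.2)) (by simp [aL_mul_bR])

@[simp] theorem square_bR (z : G × G) : D.square.bR z = (D.bR z.1, D.bR z.2) :=
  D.square.bR_eq (a := (D.aL z.1, D.aL z.2)) (by simp [aL_mul_bR])

@[simp] theorem square_aR (z : G × G) : D.square.aR z = (D.aR z.1, D.aR z.2) :=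
  D.square.aR_eq (b := (D.bL z.1, D.bL z.2)) (by simp [bL_mul_aR])

@[simp] theorem square_bL (z : G × G) : D.square.bL z = (D.bL z.1, D.bL z.2) :=
  D.square.bL_eq (a := (D.aR z.1, D.aR z.2)) (by simp [bL_mul_aR])

theorem square_eL (z : G × G) : D.square.eL z = (D.eL z.1, D.eL z.2) := by simp [eL]

theorem square_eR (z : G × G) : D.square.eR z = (D.eR z.1, D.eR z.2) := by simp [eR]

/-- In a δ-decomposition of a pair of units the common factor b is forced to be 1, because b_R is
trivial on A. So the chosen unit is determined. -/
theorem baseMap_δ (a₁ a₂ : A) : D.baseMap D.δ (D.ιA a₁, D.ιA a₂) = D.ιA (a₁ * a₂) := by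
  have h := Classical.epsilon_spec (p := fun x : G => x ∈ D.ιA.range ∧ D.δ x (D.ιA a₁, D.ιA a₂))
    ⟨D.ιA (a₁ * a₂), ⟨_, rfl⟩, a₁, a₂, 1, by simp, by simp, by simp⟩
  obtain ⟨-, a₁', a₂', b, h1, h2, h3⟩ := h
  change D.baseMap D.δ (D.ιA a₁, D.ιA a₂) = _ at h3
  have h4 := D.bR_eq h1.symm
  have h5 := D.aL_eq h1.symm
  simp only [bR_ιA, aL_ιA] at h4 h5
  subst h4 h5
  simp only [map_one, one_mul] at h2
  rw [h3, map_one, mul_one, ← h2, map_mul]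

/-- Prescribing the left unit of the first leg fixes a₁, hence the second leg ba₂ = a₁⁻¹x and the
common factor b. The hypothesis ensures that the second leg has the required left unit. -/
theorem hL_δ {x : G} {a₁ a₂ : A} (h : D.aL x = a₁ * a₂) :
    D.square.hL D.δ x (D.ιA a₁, D.ιA a₂) =
      (D.ιA a₁ * D.ιB (D.bL ((D.ιA a₁)⁻¹ * x)), (D.ιA a₁)⁻¹ * x) := by
  have h' := Classical.epsilon_spec
    (p := fun y : G × G => D.square.eL y = (D.ιA a₁, D.ιA a₂) ∧ D.δ x y)
    ⟨(D.ιA a₁ * D.ιB (D.bL ((D.ιA a₁)⁻¹ * x)), (D.ιA a₁)⁻¹ * x), by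
      rw [square_eL, eL, eL, aL_mul_ιB, aL_ιA, ← map_inv, aL_ιA_mul, h, inv_mul_cancel_left],
      a₁, D.aR ((D.ιA a₁)⁻¹ * x), D.bL ((D.ιA a₁)⁻¹ * x), rfl, (bL_mul_aR ..).symm, by
      rw [mul_assoc, bL_mul_aR, mul_inv_cancel_left]⟩
  change D.square.eL (D.square.hL D.δ x (D.ιA a₁, D.ιA a₂)) = _ ∧
    D.δ x (D.square.hL D.δ x (D.ιA a₁, D.ιA a₂)) at h'
  obtain ⟨h0, a₁', a₂', b, h1, h2, h3⟩ := h'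
  generalize D.square.hL D.δ x (D.ιA a₁, D.ιA a₂) = y at *
  obtain ⟨y₁, y₂⟩ := y
  dsimp only at h1 h2
  subst h1 h2
  rw [square_eL, Prod.mk.injEq, eL, aL_mul_ιB, aL_ιA] at h0
  obtain rfl := D.ιA_injective h0.1
  have h4 : (D.ιA a₁')⁻¹ * x = D.ιB b * D.ιA a₂' := by rw [h3]; group
  rw [h4, bL_mul_ιA, bL_ιB]

theorem hR_δ {x : G} {a₁ a₂ : A} (h : D.aR x = a₁ * a₂) :
    D.square.hR D.δ x (D.ιA a₁, D.ιA a₂) =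
      (x * (D.ιA a₂)⁻¹, D.ιB (D.bR (x * (D.ιA a₂)⁻¹)) * D.ιA a₂) := by
  have h' := Classical.epsilon_spec
    (p := fun y : G × G => D.square.eR y = (D.ιA a₁, D.ιA a₂) ∧ D.δ x y)
    ⟨(x * (D.ιA a₂)⁻¹, D.ιB (D.bR (x * (D.ιA a₂)⁻¹)) * D.ιA a₂), by
      rw [square_eR, eR, eR, aR_ιB_mul, aR_ιA, ← map_inv, aR_mul_ιA, h, mul_inv_cancel_right],
      D.aL (x * (D.ιA a₂)⁻¹), a₂, D.bR (x * (D.ιA a₂)⁻¹), (aL_mul_bR ..).symm, rfl, by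
      rw [aL_mul_bR, inv_mul_cancel_right]⟩
  change D.square.eR (D.square.hR D.δ x (D.ιA a₁, D.ιA a₂)) = _ ∧
    D.δ x (D.square.hR D.δ x (D.ιA a₁, D.ιA a₂)) at h'
  obtain ⟨h0, a₁', a₂', b, h1, h2, h3⟩ := h'
  generalize D.square.hR D.δ x (D.ιA a₁, D.ιA a₂) = y at *
  obtain ⟨y₁, y₂⟩ := y
  dsimp only at h1 h2
  subst h1 h2
  rw [square_eR, Prod.mk.injEq, eR, eR, aR_ιB_mul, aR_ιA] at h0
  obtain rfl := D.ιA_injective h0.2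
  have h4 : x * (D.ιA a₂')⁻¹ = D.ιA a₁' * D.ιB b := by rw [h3]; group
  rw [h4, bR_ιA_mul, bR_ιB]

theorem mh_id {x y : G} (h : D.aR x = D.aL y) :
    D.mh (fun x y => x = y) x y = D.ιB (D.bL x) * y := by
  have h1 : D.eL y = D.eR x := by rw [eL, eR, h]
  rw [mh, h1, hR_id, mA_eq, ιB_bL, ιB_bR, h]
  group

/-- Both legs of δ act by left translation by elements of B: b_L(x) on the first, and on the second
the element that b_L(x) becomes after being moved past a_L(y₁). -/
theorem mh_δ {x : G} {y : G × G} (h : D.aR x = D.aL y.1 * D.aL y.2) :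
    D.square.mh D.δ x y = (D.ιB (D.bL x) * y.1,
      D.ιB (D.bR (D.ιB (D.bL x) * D.ιA (D.aL y.1))) * y.2) := by
  have h1 : x * (D.ιA (D.aL y.2))⁻¹ = D.ιB (D.bL x) * D.ιA (D.aL y.1) := by
    rw [ιB_bL, h, map_mul]; group
  rw [mh, square_eL, eL, eL, hR_δ D h, mA_eq, square_bR, square_ιB, h1, Prod.mk_mul_mk,
    mul_assoc, mul_assoc, aL_mul_bR, aL_mul_bR]

/-- The diffeomorphism `t_id`, in the parameters of `jac`. -/
theorem transfer_id {x y : G} (h : D.aR x = D.aL y) (p : B × B) :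
    ((D.bR x)⁻¹ * D.bR (D.ιB p.1 * D.ιB (D.bL x) *
        D.baseMap (fun x y => x = y) (D.eL (D.ιB p.2 * y))),
      D.bL (D.mh (fun x y => x = y) (D.ιB p.1 * D.ιB (D.bL x) *
        D.baseMap (fun x y => x = y) (D.eL (D.ιB p.2 * y))) (D.ιB p.2 * y) *
          (D.mh (fun x y => x = y) x y)⁻¹)) =
    ((D.bR x)⁻¹ * D.bR (D.ιB (p.1 * (D.bL x * p.2 * (D.bL x)⁻¹)) * x) *
        (D.bR (D.ιB p.2 * D.ιA (D.aL y)))⁻¹,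
      p.1 * (D.bL x * p.2 * (D.bL x)⁻¹)) := by
  have h1 : D.bL (D.ιB p.1 * D.ιB (D.bL x) * D.ιA (D.aL (D.ιB p.2 * y))) = p.1 * D.bL x := by
    rw [← map_mul, bL_mul_ιA, bL_ιB]
  -- With γ = β·cβ'c⁻¹ and c = b_L(x), this point is γx times an element of B depending only on β'.
  -- The separation of γ from β' makes the derivative triangular.
  have h2 : D.ιB p.1 * D.ιB (D.bL x) * D.ιA (D.aL (D.ιB p.2 * y)) =
      D.ιB (p.1 * (D.bL x * p.2 * (D.bL x)⁻¹)) * x *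
        D.ιB ((D.bR (D.ιB p.2 * D.ιA (D.aL y)))⁻¹) := by
    have h3 : D.aL (D.ιB p.2 * y) = D.aL (D.ιB p.2 * D.ιA (D.aL y)) := by
      conv_lhs => rw [← aL_mul_bR D y, ← mul_assoc, aL_mul_ιB]
    rw [h3]
    conv_rhs => rw [← D.bL_mul_aR x]
    rw [map_inv, ιB_bR, map_mul, map_mul, map_mul, map_inv, h, bL_mul_ιA, bL_ιB]
    group
  rw [eL, baseMap_id, mh_id D h, mh_id, h1, h2]
  · refine Prod.ext ?_ ?_
    · simp only [bR_mul_ιB]; group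
    · have : D.ιB (p.1 * D.bL x) * (D.ιB p.2 * y) * (D.ιB (D.bL x) * y)⁻¹ =
          D.ιB (p.1 * (D.bL x * p.2 * (D.bL x)⁻¹)) := by
        simp only [map_mul, map_inv]; group
      simp only [this, bL_ιB]
  · rw [← map_mul, aR_ιB_mul, aR_ιA]

/-- The diffeomorphism `t_δ`, in the parameters of `jac`. -/
theorem transfer_δ {x : G} {y : G × G} (h : D.aR x = D.aL y.1 * D.aL y.2) {q : B}
    (hq : q = D.bR (D.ιB (D.bL x) * D.ιA (D.aL y.1))) (p : B × (B × B)) :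
    ((D.bR x)⁻¹ * D.bR (D.ιB p.1 * D.ιB (D.bL x) *
        D.baseMap D.δ (D.square.eL (D.square.ιB p.2 * y))),
      D.square.bL (D.square.mh D.δ (D.ιB p.1 * D.ιB (D.bL x) *
        D.baseMap D.δ (D.square.eL (D.square.ιB p.2 * y))) (D.square.ιB p.2 * y) *
          (D.square.mh D.δ x y)⁻¹)) =
    ((D.bR x)⁻¹ * D.bR (D.ιB (D.bR (D.ιB (p.1 * (D.bL x * p.2.1 * (D.bL x)⁻¹)) *
          (D.ιB (D.bL x) * D.ιA (D.aL y.1))) * q⁻¹ *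
            (q * ((D.bR (D.ιB p.2.1 * D.ιA (D.aL y.1)))⁻¹ * p.2.2) * q⁻¹)) *
              (D.ιB q * D.ιA (D.aL y.2))) *
        (D.bR (D.ιB p.2.2 * D.ιA (D.aL y.2)))⁻¹,
      (p.1 * (D.bL x * p.2.1 * (D.bL x)⁻¹),
        D.bR (D.ιB (p.1 * (D.bL x * p.2.1 * (D.bL x)⁻¹)) *
          (D.ιB (D.bL x) * D.ιA (D.aL y.1))) * q⁻¹ *
            (q * ((D.bR (D.ιB p.2.1 * D.ιA (D.aL y.1)))⁻¹ * p.2.2) * q⁻¹))) := by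
  obtain ⟨β, β₁, β₂⟩ := p
  obtain ⟨y₁, y₂⟩ := y
  dsimp only at h hq ⊢
  have haL : ∀ (b : B) (z : G), D.aL (D.ιB b * z) = D.aL (D.ιB b * D.ιA (D.aL z)) := by
    intro b z
    conv_lhs => rw [← aL_mul_bR D z, ← mul_assoc, aL_mul_ιB]
  set c := D.bL x
  have h1 : D.ιB β * D.ιB c * D.ιA (D.aL (D.ιB β₁ * y₁)) =
      D.ιB (β * (c * β₁ * c⁻¹)) * (D.ιB c * D.ιA (D.aL y₁)) *
        D.ιB ((D.bR (D.ιB β₁ * D.ιA (D.aL y₁)))⁻¹) := by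
    rw [haL, map_inv, ιB_bR, map_mul, map_mul, map_mul, map_inv]; group
  have h2 : D.bR (D.ιB β * D.ιB c * D.ιA (D.aL (D.ιB β₁ * y₁))) =
      D.bR (D.ιB (β * (c * β₁ * c⁻¹)) * (D.ιB c * D.ιA (D.aL y₁))) *
        (D.bR (D.ιB β₁ * D.ιA (D.aL y₁)))⁻¹ := by rw [h1, bR_mul_ιB]
  have hbase : D.baseMap D.δ (D.square.eL (D.square.ιB (β₁, β₂) * (y₁, y₂))) =
      D.ιA (D.aL (D.ιB β₁ * y₁)) * D.ιA (D.aL (D.ιB β₂ * y₂)) := by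
    rw [square_eL, eL, eL, baseMap_δ, map_mul]; rfl
  -- γ₂ is the parameter of the second leg, written as a function of γ times a q-conjugate of a
  -- function of (β₁, β₂). Both factors are 1 at the base point, so their derivatives will simply
  -- add.
  set γ₂ := D.bR (D.ιB (β * (c * β₁ * c⁻¹)) * (D.ιB c * D.ιA (D.aL y₁))) * q⁻¹ *
            (q * ((D.bR (D.ιB β₁ * D.ιA (D.aL y₁)))⁻¹ * β₂) * q⁻¹) with hγ₂
  have h3 : D.bR (D.ιB β * D.ιB c * D.ιA (D.aL (D.ιB β₁ * y₁))) = γ₂ * q * β₂⁻¹ := by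
    rw [h2, hγ₂]; group
  have hbL : D.bL (D.ιB β * D.ιB c *
      (D.ιA (D.aL (D.ιB β₁ * y₁)) * D.ιA (D.aL (D.ιB β₂ * y₂)))) = β * c := by
    rw [← map_mul, ← map_mul, bL_mul_ιA, bL_ιB]
  rw [hbase, mh_δ, mh_δ D h]
  · refine Prod.ext ?_ (Prod.ext ?_ ?_)
    · dsimp only
      rw [← mul_assoc, ← D.aL_mul_bR (D.ιB β * D.ιB c * D.ιA (D.aL (D.ιB β₁ * y₁))), h3,
        mul_assoc (D.ιA _), bR_ιA_mul, mul_assoc (D.bR x)⁻¹ _ (_⁻¹), ← bR_mul_ιB]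
      congr 2
      rw [haL β₂, map_inv, ιB_bR]
      simp only [map_mul, map_inv]
      group
    · rw [hbL, square_bL]
      change D.bL (D.ιB (β * c) * (D.ιB β₁ * y₁) * (D.ιB c * y₁)⁻¹) = _
      have : D.ιB (β * c) * (D.ιB β₁ * y₁) * (D.ιB c * y₁)⁻¹ = D.ιB (β * (c * β₁ * c⁻¹)) := by
        simp only [map_mul, map_inv]; group
      rw [this, bL_ιB]
    · rw [hbL, square_bL]
      change D.bL (D.ιB (D.bR (D.ιB (β * c) * D.ιA (D.aL (D.ιB β₁ * y₁)))) * (D.ιB β₂ * y₂) *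
        (D.ιB (D.bR (D.ιB c * D.ιA (D.aL y₁))) * y₂)⁻¹) = γ₂
      rw [map_mul D.ιB β c, h3, ← hq]
      have : D.ιB (γ₂ * q * β₂⁻¹) * (D.ιB β₂ * y₂) * (D.ιB q * y₂)⁻¹ = D.ιB γ₂ := by
        simp only [map_mul, map_inv]; group
      rw [this, bL_ιB]
  · rw [← map_mul, ← map_mul, aR_mul_ιA, aR_ιB, one_mul]
    rfl

end Decomposition

end DoubleLieGroup

/-! ### Manifold derivatives as linear maps between model spaces. -/

section HasDerAt

open scoped Manifold ContDiff

variable {E : Type*} [NormedAddCommGroup E] [NormedSpace ℝ E] {H : Type*} [TopologicalSpace H]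
  {I : ModelWithCorners ℝ E H} {M : Type*} [TopologicalSpace M] [ChartedSpace H M]
  {F : Type*} [NormedAddCommGroup F] [NormedSpace ℝ F] {HF : Type*} [TopologicalSpace HF]
  {J : ModelWithCorners ℝ F HF} {N : Type*} [TopologicalSpace N] [ChartedSpace HF N]
  {F' : Type*} [NormedAddCommGroup F'] [NormedSpace ℝ F'] {HF' : Type*} [TopologicalSpace HF']
  {J' : ModelWithCorners ℝ F' HF'} {N₂ : Type*} [TopologicalSpace N₂] [ChartedSpace HF' N₂]

/-- `f` has derivative `f'` at `p`, the tangent spaces being identified with the model spaces. -/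
def HasDerAt (I : ModelWithCorners ℝ E H) (J : ModelWithCorners ℝ F HF) (f : M → N) (p : M)
    (f' : E →L[ℝ] F) : Prop :=
  HasMFDerivAt I J f p f'

theorem HasDerAt.mfderiv_eq {f : M → N} {p : M} {f' : E →L[ℝ] F} (h : HasDerAt I J f p f') :
    (mfderiv I J f p : E →L[ℝ] F) = f' :=
  HasMFDerivAt.mfderiv h

theorem HasDerAt.unique {f : M → N} {p : M} {f' f'' : E →L[ℝ] F} (h : HasDerAt I J f p f')
    (h' : HasDerAt I J f p f'') : f' = f'' :=
  hasMFDerivAt_unique h h'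

theorem MDifferentiableAt.hasDerAt {f : M → N} {p : M} (h : MDifferentiableAt I J f p) :
    HasDerAt I J f p (mfderiv I J f p) :=
  h.hasMFDerivAt

theorem ContMDiff.hasDerAt {f : M → N} (h : ContMDiff I J ∞ f) (p : M) :
    HasDerAt I J f p (mfderiv I J f p) :=
  ((h p).mdifferentiableAt (by simp)).hasDerAt

/-- The base point q is kept apart from f p so that a point such as c * 1 * c⁻¹ can be treated as 1
without transporting tangent spaces. -/
theorem HasDerAt.comp {g : N → N₂} {f : M → N} {p : M} {q : N} {f' : E →L[ℝ] F}
    {g' : F →L[ℝ] F'} (hg : HasDerAt J J' g q g') (hf : HasDerAt I J f p f') (hq : f p = q) :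
    HasDerAt I J' (fun x => g (f x)) p (g'.comp f') := by
  subst hq
  exact HasMFDerivAt.comp p hg hf

theorem HasDerAt.prodMk {f : M → N} {g : M → N₂} {p : M} {f' : E →L[ℝ] F} {g' : E →L[ℝ] F'}
    (hf : HasDerAt I J f p f') (hg : HasDerAt I J' g p g') :
    HasDerAt I (J.prod J') (fun x => (f x, g x)) p (f'.prod g') :=
  HasMFDerivAt.prodMk hf hg

theorem hasDerAt_id (p : M) : HasDerAt I I (fun x : M => x) p (ContinuousLinearMap.id ℝ E) :=
  hasMFDerivAt_id p

theorem hasDerAt_const (c : N) (p : M) : HasDerAt I J (fun _ : M => c) p (0 : E →L[ℝ] F) :=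
  hasMFDerivAt_const c p

theorem hasDerAt_fst (p : M × N) :
    HasDerAt (I.prod J) I (fun x : M × N => x.1) p (ContinuousLinearMap.fst ℝ E F) :=
  hasMFDerivAt_fst p

theorem hasDerAt_snd (p : M × N) :
    HasDerAt (I.prod J) J (fun x : M × N => x.2) p (ContinuousLinearMap.snd ℝ E F) :=
  hasMFDerivAt_snd p

theorem HasDerAt.congr_of_eventuallyEq {f g : M → N} {p : M} {f' : E →L[ℝ] F}
    (h : HasDerAt I J f p f') (hg : g =ᶠ[nhds p] f) : HasDerAt I J g p f' :=
  HasMFDerivAt.congr_of_eventuallyEq h hg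

end HasDerAt

/-! ### Calculus at the identity of a Lie group and the determinant of Ad. -/

section LieGroupCalculus

open scoped Manifold ContDiff

variable {E : Type*} [NormedAddCommGroup E] [NormedSpace ℝ E] {H : Type*} [TopologicalSpace H]
  {I : ModelWithCorners ℝ E H} {M : Type*} [TopologicalSpace M] [ChartedSpace H M]
  {F : Type*} [NormedAddCommGroup F] [NormedSpace ℝ F] {HF : Type*} [TopologicalSpace HF]
  {J : ModelWithCorners ℝ F HF} {N : Type*} [TopologicalSpace N] [ChartedSpace HF N]
  [Group N] [LieGroup J ∞ N]

/-- Multiplication restricts to the identity map on each of the two axes through (1, 1), and these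
restrictions determine a linear map on the product. -/
theorem hasDerAt_mul_one :
    HasDerAt (J.prod J) J (fun x : N × N => x.1 * x.2) (1, 1)
      ((ContinuousLinearMap.id ℝ F).coprod (ContinuousLinearMap.id ℝ F)) := by
  have h := (contMDiff_mul J ∞ (G := N)).hasDerAt ((1 : N), (1 : N))
  set L : F × F →L[ℝ] F := mfderiv (J.prod J) J (fun x : N × N => x.1 * x.2) (1, 1)
  have h1 := (h.comp ((hasDerAt_id (I := J) (1 : N)).prodMk (hasDerAt_const (J := J) (1 : N) 1))
    rfl).unique (f'' := ContinuousLinearMap.id ℝ F) (by simpa using hasDerAt_id (I := J) (1 : N))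
  have h2 := (h.comp ((hasDerAt_const (J := J) (1 : N) 1).prodMk (hasDerAt_id (I := J) (1 : N)))
    rfl).unique (f'' := ContinuousLinearMap.id ℝ F) (by simpa using hasDerAt_id (I := J) (1 : N))
  convert h using 1
  ext x
  · simpa using (DFunLike.congr_fun h1 x).symm
  · simpa using (DFunLike.congr_fun h2 x).symm

theorem HasDerAt.mul {f g : M → N} {p : M} {f' g' : E →L[ℝ] F} (hf : HasDerAt I J f p f')
    (hg : HasDerAt I J g p g') (hf1 : f p = 1) (hg1 : g p = 1) :
    HasDerAt I J (fun x => f x * g x) p (f' + g') := by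
  have h := hasDerAt_mul_one.comp (hf.prodMk hg) (by rw [hf1, hg1])
  convert h using 1
  ext x
  simp

/-- Differentiate x·x⁻¹ = 1 at the identity. -/
theorem hasDerAt_inv_one :
    HasDerAt J J (fun x : N => x⁻¹) 1 (-ContinuousLinearMap.id ℝ F) := by
  have h := (contMDiff_inv J ∞ (G := N)).hasDerAt (1 : N)
  have h1 := ((hasDerAt_id (I := J) (1 : N)).mul h rfl inv_one).unique
    (f'' := 0) (by simpa using hasDerAt_const (I := J) (J := J) (1 : N) (1 : N))
  rwa [eq_neg_of_add_eq_zero_right h1] at h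

theorem HasDerAt.inv {f : M → N} {p : M} {f' : E →L[ℝ] F} (hf : HasDerAt I J f p f')
    (hf1 : f p = 1) : HasDerAt I J (fun x => (f x)⁻¹) p (-f') :=
  hasDerAt_inv_one.comp hf hf1

theorem contMDiff_conj (c : N) : ContMDiff J J ∞ (fun x : N => c * x * c⁻¹) :=
  (contMDiff_const.mul contMDiff_id).mul contMDiff_const

theorem hasDerAt_conj (c : N) :
    HasDerAt J J (fun x : N => c * x * c⁻¹) 1 (DoubleLieGroup.Ad J c) :=
  (contMDiff_conj c).hasDerAt 1

theorem HasDerAt.conj {f : M → N} {p : M} {f' : E →L[ℝ] F} (c : N) (hf : HasDerAt I J f p f')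
    (hf1 : f p = 1) :
    HasDerAt I J (fun x => c * f x * c⁻¹) p ((DoubleLieGroup.Ad J c).comp f') :=
  (hasDerAt_conj c).comp hf hf1

theorem Ad_one : DoubleLieGroup.Ad J (1 : N) = ContinuousLinearMap.id ℝ F :=
  (hasDerAt_conj (J := J) (1 : N)).unique (by simpa using hasDerAt_id (I := J) (1 : N))

theorem Ad_mul (c d : N) :
    DoubleLieGroup.Ad J (c * d) = (DoubleLieGroup.Ad J c).comp (DoubleLieGroup.Ad J d) :=
  (hasDerAt_conj (J := J) (c * d)).unique (by
    have h := (hasDerAt_conj (J := J) d).conj c (by simp)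
    simpa [mul_assoc] using h)

/-- The absolute value of the determinant of the adjoint representation. -/
noncomputable def adDet (J : ModelWithCorners ℝ F HF) {N : Type*} [TopologicalSpace N]
    [ChartedSpace HF N] [Group N] (c : N) : ℝ := |(DoubleLieGroup.Ad J c).det|

theorem ContinuousLinearMap.det_comp' {V : Type*} [NormedAddCommGroup V] [NormedSpace ℝ V]
    (f g : V →L[ℝ] V) : (f.comp g).det = f.det * g.det :=
  LinearMap.det_comp _ _

theorem adDet_one : adDet J (1 : N) = 1 := by
  rw [adDet, Ad_one, ContinuousLinearMap.det, ContinuousLinearMap.coe_id, LinearMap.det_id, abs_one]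

theorem adDet_mul (c d : N) : adDet J (c * d) = adDet J c * adDet J d := by
  rw [adDet, Ad_mul, ContinuousLinearMap.det_comp', abs_mul]; rfl

theorem adDet_pos (c : N) : 0 < adDet J c := by
  refine lt_of_le_of_ne (abs_nonneg _) fun h => ?_
  have h1 := adDet_mul (J := J) c c⁻¹
  rw [mul_inv_cancel, adDet_one, show adDet J c = 0 from h.symm, zero_mul] at h1
  exact one_ne_zero h1

theorem adDet_inv (c : N) : adDet J c⁻¹ = (adDet J c)⁻¹ :=
  eq_inv_of_mul_eq_one_left (by rw [← adDet_mul, inv_mul_cancel, adDet_one])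

/-- Ad is a partial derivative of the smooth map (c, x) ↦ cxc⁻¹ at x = 1. Every conjugation fixes 1,
so the chart at 1 serves for source and target and all coordinate changes in the tangent bundle are
identities. -/
theorem contMDiff_Ad : ContMDiff J 𝓘(ℝ, F →L[ℝ] F) ∞ (fun c : N => DoubleLieGroup.Ad J c) := by
  intro c
  have h : ContMDiff (J.prod J) J ∞ (Function.uncurry fun (c x : N) => c * x * c⁻¹) :=
    (contMDiff_fst.mul contMDiff_snd).mul contMDiff_fst.inv
  have h1 := ContMDiffAt.mfderiv (x₀ := c) (fun (c x : N) => c * x * c⁻¹) (fun _ => 1)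
    (h (c, 1)) contMDiffAt_const (m := ∞) (by simp)
  refine h1.congr_of_eventuallyEq (Filter.Eventually.of_forall fun d => ?_)
  have e : ∀ x : N, x * 1 * x⁻¹ = 1 := fun x => by simp
  refine Eq.trans ?_ (inTangentCoordinates_eq (I := J) (I' := J) (fun _ : N => (1 : N))
    (fun x : N => x * 1 * x⁻¹) (fun x => mfderiv J J (fun y : N => x * y * x⁻¹) 1)
    (mem_chart_source _ _) (by simp)).symm
  change DoubleLieGroup.Ad J d = (((tangentBundleCore J N).coordChange (achart HF (d * 1 * d⁻¹))
    (achart HF (c * 1 * c⁻¹)) (d * 1 * d⁻¹) : F →L[ℝ] F).comp ((DoubleLieGroup.Ad J d).comp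
      ((tangentBundleCore J N).coordChange (achart HF (1 : N)) (achart HF (1 : N)) 1 : F →L[ℝ] F)))
  rw [e, e]
  ext v
  have h2 : ∀ w : F, (tangentBundleCore J N).coordChange (achart HF (1 : N)) (achart HF (1 : N)) 1 w
      = w := fun w => (tangentBundleCore J N).coordChange_self _ _ (mem_chart_source _ _) w
  change _ = (tangentBundleCore J N).coordChange (achart HF (1 : N)) (achart HF (1 : N)) 1
    (DoubleLieGroup.Ad J d
      ((tangentBundleCore J N).coordChange (achart HF (1 : N)) (achart HF (1 : N)) 1 v))
  rw [h2, h2]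

variable [FiniteDimensional ℝ F]

/-- The determinant is polynomial in matrix entries, and the absolute value is smooth at its values
here, which are nonzero. -/
theorem contMDiff_adDet : ContMDiff J 𝓘(ℝ, ℝ) ∞ (adDet J : N → ℝ) := by
  have h1 : ContDiff ℝ ∞ (fun f : F →L[ℝ] F => f.det) := by
    let b := Module.finBasis ℝ F
    have : (fun f : F →L[ℝ] F => f.det) =
        fun f : F →L[ℝ] F => (LinearMap.toMatrix b b f).det := by
      ext f; exact (LinearMap.det_toMatrix b _).symm
    rw [this]
    simp only [Matrix.det_apply]
    refine ContDiff.sum fun σ _ => ?_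
    refine ContDiff.const_smul _ ?_
    refine contDiff_prod fun i _ => ?_
    simp only [LinearMap.toMatrix_apply]
    have h2 : (fun f : F →L[ℝ] F => b.repr (f (b i)) (σ i)) =
      fun f : F →L[ℝ] F => (LinearMap.toContinuousLinearMap (b.coord (σ i))) (f (b i)) := rfl
    exact ((LinearMap.toContinuousLinearMap (b.coord (σ i))).contDiff).comp
      (contDiff_id.clm_apply contDiff_const)
  have h3 : ContMDiff J 𝓘(ℝ, ℝ) ∞ (fun c : N => (DoubleLieGroup.Ad J c).det) :=
    h1.contMDiff.comp contMDiff_Ad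
  intro c
  have h4 : (DoubleLieGroup.Ad J c).det ≠ 0 := abs_pos.mp (adDet_pos (J := J) c)
  exact (contDiffAt_abs h4).contMDiffAt.comp c (h3 c)

end LieGroupCalculus

/-! ### Integral curves of left-invariant fields and intersections of Lie algebras. -/

section OneParameterSubgroups

open scoped Manifold ContDiff Topology

variable {E : Type*} [NormedAddCommGroup E] [NormedSpace ℝ E] [FiniteDimensional ℝ E]
  {H : Type*} [TopologicalSpace H] {I : ModelWithCorners ℝ E H} [I.Boundaryless]
  {G : Type*} [TopologicalSpace G] [ChartedSpace H G] [Group G] [LieGroup I ∞ G]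
  {F : Type*} [NormedAddCommGroup F] [NormedSpace ℝ F] [FiniteDimensional ℝ F]
  {HF : Type*} [TopologicalSpace HF] {J : ModelWithCorners ℝ F HF} [J.Boundaryless]
  {N : Type*} [TopologicalSpace N] [ChartedSpace HF N] [Group N] [LieGroup J ∞ N]
  {F' : Type*} [NormedAddCommGroup F'] [NormedSpace ℝ F'] [FiniteDimensional ℝ F']
  {HF' : Type*} [TopologicalSpace HF'] {J' : ModelWithCorners ℝ F' HF'} [J'.Boundaryless]
  {N₂ : Type*} [TopologicalSpace N₂] [ChartedSpace HF' N₂] [Group N₂] [LieGroup J' ∞ N₂]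

theorem LieGroup.minSmoothness_three : LieGroup J (minSmoothness ℝ 3) N :=
  LieGroup.of_le (n := ∞) (by
    rw [minSmoothness_of_isRCLikeNormedField]; exact WithTop.coe_le_coe.2 le_top)

theorem contMDiff_one_mulInvariantVectorField (X : F) :
    ContMDiff J J.tangent 1
      (fun g : N => (mulInvariantVectorField (I := J) (G := N) X g : TangentBundle J N)) := by
  have : LieGroup J (minSmoothness ℝ 3) N := LieGroup.minSmoothness_three
  refine (contMDiff_mulInvariantVectorField (I := J) (G := N) X).of_le ?_
  rw [minSmoothness_of_isRCLikeNormedField]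
  norm_num

theorem exists_integralCurve (X : F) : ∃ γ : ℝ → N, γ 0 = 1 ∧
    IsMIntegralCurveAt γ (mulInvariantVectorField (I := J) (G := N) X) 0 :=
  exists_isMIntegralCurveAt_of_contMDiffAt_boundaryless 0
    ((contMDiff_one_mulInvariantVectorField X) 1)

/-- Differentiate φ(ax) = φ(a)φ(x) at x = 1. -/
theorem mulInvariantVectorField_map (φ : N →* G) (hφ : ContMDiff J I ∞ φ) (X : F) (a : N) :
    (mfderiv J I φ a : F →L[ℝ] E) (mulInvariantVectorField (I := J) (G := N) X a) =
      mulInvariantVectorField (I := I) (G := G) ((mfderiv J I φ 1 : F →L[ℝ] E) X) (φ a) := by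
  have h1 := (hφ.hasDerAt a).comp (p := (1 : N))
    ((contMDiff_mul_left (I := J) (n := ∞) (a := a)).hasDerAt 1) (mul_one a)
  have h2 := ((contMDiff_mul_left (I := I) (n := ∞) (a := φ a)).hasDerAt 1).comp
    (p := (1 : N)) (hφ.hasDerAt 1) (map_one φ)
  exact DFunLike.congr_fun (h1.unique (by simpa using h2)) X

theorem IsMIntegralCurveAt.map_hom {φ : N →* G} (hφ : ContMDiff J I ∞ φ) {X : F} {γ : ℝ → N}
    (hγ : IsMIntegralCurveAt γ (mulInvariantVectorField (I := J) (G := N) X) 0) :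
    IsMIntegralCurveAt (fun t => φ (γ t))
      (mulInvariantVectorField (I := I) (G := G) ((mfderiv J I φ 1 : F →L[ℝ] E) X)) 0 := by
  filter_upwards [hγ] with t ht
  have h1 := HasDerAt.comp (I := 𝓘(ℝ, ℝ)) (p := t) (hφ.hasDerAt (γ t)) ht rfl
  refine HasMFDerivAt.congr_mfderiv h1 ?_
  refine ContinuousLinearMap.ext fun s => ?_
  change (mfderiv J I φ (γ t) : F →L[ℝ] E) (s • (mulInvariantVectorField (I := J) X (γ t) : F)) =
    s • (mulInvariantVectorField (I := I) (G := G) ((mfderiv J I φ 1 : F →L[ℝ] E) X) (φ (γ t)) : E)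
  rw [map_smul]
  congr 1
  exact mulInvariantVectorField_map φ hφ X (γ t)

/-- Closed subgroups which meet trivially have Lie algebras which meet trivially. -/
theorem eq_zero_of_mfderiv_eq {φ : N →* G} (hφ : ContMDiff J I ∞ φ) {ψ : N₂ →* G}
    (hψ : ContMDiff J' I ∞ ψ) (h : ∀ a b, φ a = ψ b → a = 1) {X : F} {Y : F'}
    (hXY : (mfderiv J I φ 1 : F →L[ℝ] E) X = (mfderiv J' I ψ 1 : F' →L[ℝ] E) Y) : X = 0 := by
  obtain ⟨γ, hγ0, hγ⟩ := exists_integralCurve (J := J) (N := N) X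
  obtain ⟨η, hη0, hη⟩ := exists_integralCurve (J := J') (N := N₂) Y
  have h1 := hγ.map_hom hφ
  have h2 := hη.map_hom hψ
  rw [← hXY] at h2
  -- Both image curves start at 1 and are integral curves of one left-invariant field on G, so they
  -- agree near time 0. The hypothesis on φ and ψ then makes γ locally constant, and its velocity X
  -- vanishes.
  have h3 := isMIntegralCurveAt_eventuallyEq_of_contMDiffAt_boundaryless
    ((contMDiff_one_mulInvariantVectorField _) _) h1 h2 (by simp [hγ0, hη0])
  have h4 : γ =ᶠ[𝓝 0] fun _ => 1 := by
    filter_upwards [h3] with t ht using h _ _ ht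
  have h5 : HasDerAt 𝓘(ℝ, ℝ) J γ 0 _ := hγ.hasMFDerivAt
  have h6 := DFunLike.congr_fun (h5.unique
    ((hasDerAt_const (I := 𝓘(ℝ, ℝ)) (J := J) (1 : N) (0 : ℝ)).congr_of_eventuallyEq h4)) 1
  have h7 : (1 : ℝ) • (mulInvariantVectorField (I := J) (G := N) X (γ 0) : F) = 0 := h6
  rw [one_smul, hγ0] at h7
  have h8 : (mfderiv J J (fun x : N => 1 * x) 1 : F →L[ℝ] F) X = 0 := h7
  rw [HasDerAt.mfderiv_eq (f' := ContinuousLinearMap.id ℝ F)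
    (by simpa using hasDerAt_id (I := J) (1 : N))] at h8
  exact h8

end OneParameterSubgroups

/-! ### Smoothness of the factor maps a_L, b_R, b_L, a_R. -/

noncomputable section

namespace DoubleLieGroup

section Smoothness

open scoped Manifold ContDiff Topology

variable {E : Type*} [NormedAddCommGroup E] [NormedSpace ℝ E] [FiniteDimensional ℝ E]
  {H : Type*} [TopologicalSpace H] {I : ModelWithCorners ℝ E H} [I.Boundaryless]
  {G : Type*} [TopologicalSpace G] [ChartedSpace H G] [Group G] [LieGroup I ∞ G]
  [T2Space G] [SecondCountableTopology G]
  {EA : Type*} [NormedAddCommGroup EA] [NormedSpace ℝ EA] [FiniteDimensional ℝ EA]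
  {HA : Type*} [TopologicalSpace HA] {IA : ModelWithCorners ℝ EA HA} [IA.Boundaryless]
  {A : Type*} [TopologicalSpace A] [ChartedSpace HA A] [Group A] [LieGroup IA ∞ A]
  {EB : Type*} [NormedAddCommGroup EB] [NormedSpace ℝ EB] [FiniteDimensional ℝ EB]
  {HB : Type*} [TopologicalSpace HB] {IB : ModelWithCorners ℝ EB HB} [IB.Boundaryless]
  {B : Type*} [TopologicalSpace B] [ChartedSpace HB B] [Group B] [LieGroup IB ∞ B]

theorem t2Space_B (D : DoubleLieGroup I G IA A IB B) : T2Space B :=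
  D.isClosedEmbedding_ιB.isEmbedding.t2Space

theorem secondCountable_A (D : DoubleLieGroup I G IA A IB B) : SecondCountableTopology A :=
  D.isClosedEmbedding_ιA.isEmbedding.secondCountableTopology

theorem secondCountable_B (D : DoubleLieGroup I G IA A IB B) : SecondCountableTopology B :=
  D.isClosedEmbedding_ιB.isEmbedding.secondCountableTopology

/-- The multiplication `A × B → G`. -/
def mulMap (D : DoubleLieGroup I G IA A IB B) (p : A × B) : G := D.ιA p.1 * D.ιB p.2

variable (D : DoubleLieGroup I G IA A IB B)

/-- A × B acts transitively on G by (a, b)g = agb⁻¹. The group is σ-compact and G is locally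
compact, so orbit maps are open by Baire category; composing with inversion on B gives the
multiplication map. -/
theorem isOpenMap_mulMap : IsOpenMap D.mulMap := by
  have := topologicalGroup_of_lieGroup I ∞ (G := G)
  have := topologicalGroup_of_lieGroup IA ∞ (G := A)
  have := topologicalGroup_of_lieGroup IB ∞ (G := B)
  have := D.secondCountable_A
  have := D.secondCountable_B
  have := Manifold.locallyCompact_of_finiteDimensional I (M := G)
  have := Manifold.locallyCompact_of_finiteDimensional IA (M := A)
  have := Manifold.locallyCompact_of_finiteDimensional IB (M := B)
  let : MulAction (A × B) G :=
    { smul := fun p g => D.ιA p.1 * g * (D.ιB p.2)⁻¹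
      one_smul := fun g => by change D.ιA 1 * g * (D.ιB 1)⁻¹ = g; simp
      mul_smul := fun p q g => by
        change D.ιA (p.1 * q.1) * g * (D.ιB (p.2 * q.2))⁻¹ =
          D.ιA p.1 * (D.ιA q.1 * g * (D.ιB q.2)⁻¹) * (D.ιB p.2)⁻¹
        simp only [map_mul]; group }
  have hsmul : ∀ (p : A × B) (g : G), p • g = D.ιA p.1 * g * (D.ιB p.2)⁻¹ := fun _ _ => rfl
  have hA : Continuous D.ιA := D.contMDiff_ιA.continuous
  have hB : Continuous D.ιB := D.contMDiff_ιB.continuous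
  have : ContinuousSMul (A × B) G := ⟨by
    change Continuous fun q : (A × B) × G => D.ιA q.1.1 * q.2 * (D.ιB q.1.2)⁻¹
    fun_prop⟩
  have : MulAction.IsPretransitive (A × B) G := by
    refine ⟨fun g h => ?_⟩
    have key : ∀ g : G, ∃ p : A × B, p • (1 : G) = g := fun g => by
      refine ⟨(D.aL g, (D.bR g)⁻¹), ?_⟩
      rw [hsmul, mul_one, map_inv, inv_inv, aL_mul_bR]
    obtain ⟨p, rfl⟩ := key g
    obtain ⟨q, rfl⟩ := key h
    exact ⟨q * p⁻¹, by rw [mul_smul, inv_smul_smul]⟩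
  have h := isOpenMap_smul_of_sigmaCompact (G := A × B) (1 : G)
  have h2 := h.comp ((Homeomorph.refl A).prodCongr (Homeomorph.inv B)).isOpenMap
  convert h2 using 1
  funext p
  simp [hsmul, mulMap]

theorem contMDiff_mulMap : ContMDiff (IA.prod IB) I ∞ D.mulMap :=
  (D.contMDiff_ιA.comp contMDiff_fst).mul (D.contMDiff_ιB.comp contMDiff_snd)

/-- The inclusion `𝔞 → 𝔤`. -/
def dA (D : DoubleLieGroup I G IA A IB B) : EA →L[ℝ] E := mfderiv IA I D.ιA 1

/-- The inclusion `𝔟 → 𝔤`. -/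
def dB (D : DoubleLieGroup I G IA A IB B) : EB →L[ℝ] E := mfderiv IB I D.ιB 1

theorem sumMap_apply (X : EA) (Y : EB) : D.sumMap (X, Y) = D.dA X + D.dB Y := rfl

theorem hasDerAt_ιA : HasDerAt IA I D.ιA 1 D.dA := D.contMDiff_ιA.hasDerAt 1

theorem hasDerAt_ιB : HasDerAt IB I D.ιB 1 D.dB := D.contMDiff_ιB.hasDerAt 1

theorem hasDerAt_mulMap : HasDerAt (IA.prod IB) I D.mulMap 1 D.sumMap := by
  have h := (D.hasDerAt_ιA.comp (hasDerAt_fst (I := IA) (J := IB) (1 : A × B)) rfl).mul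
    (D.hasDerAt_ιB.comp (hasDerAt_snd (I := IA) (J := IB) (1 : A × B)) rfl)
    (map_one _) (map_one _)
  have e : D.sumMap = D.dA.comp (ContinuousLinearMap.fst ℝ EA EB) +
      D.dB.comp (ContinuousLinearMap.snd ℝ EA EB) :=
    ContinuousLinearMap.ext fun x : EA × EB => D.sumMap_apply x.1 x.2
  rw [e]
  exact h

/-- If X + Y = 0 in 𝔤, then X and -Y are one vector in 𝔞 ∩ 𝔟, so `eq_zero_of_mfderiv_eq` kills X;
the immersion property of B kills Y. -/
theorem sumMap_injective : Function.Injective D.sumMap := by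
  rw [injective_iff_map_eq_zero]
  rintro ⟨X, Y⟩ h
  rw [sumMap_apply] at h
  have h1 : X = 0 := by
    refine eq_zero_of_mfderiv_eq D.contMDiff_ιA D.contMDiff_ιB
      (fun a b hab => (D.eq_one_of_ιA_eq_ιB hab).1) (Y := -Y) ?_
    change D.dA X = D.dB (-Y)
    rw [map_neg]
    exact eq_neg_of_add_eq_zero_left h
  subst h1
  rw [map_zero, zero_add] at h
  rw [D.immersion_ιB 1 (a₁ := Y) (a₂ := 0) (h.trans (map_zero _).symm)]
  rfl

/-- The multiplication map near the identity, in charts. -/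
def chartMul (D : DoubleLieGroup I G IA A IB B) (p : EA × EB) : E :=
  extChartAt I (1 : G) (D.mulMap ((extChartAt (IA.prod IB) (1 : A × B)).symm p))

theorem mulMap_one : D.mulMap 1 = 1 := by simp [mulMap]

theorem chartMul_eq : D.chartMul = writtenInExtChartAt (IA.prod IB) I (1 : A × B) D.mulMap := by
  funext p
  rw [writtenInExtChartAt, mulMap_one]
  rfl

theorem contDiffAt_chartMul :
    ContDiffAt ℝ ∞ D.chartMul (extChartAt (IA.prod IB) (1 : A × B) 1) := by
  have h := (contMDiffAt_iff.mp (D.contMDiff_mulMap 1)).2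
  rw [D.mulMap_one, (IA.prod IB).range_eq_univ, contDiffWithinAt_univ] at h
  exact h

theorem hasFDerivAt_chartMul :
    HasFDerivAt D.chartMul D.sumMap (extChartAt (IA.prod IB) (1 : A × B) 1) := by
  have h : HasFDerivWithinAt (writtenInExtChartAt (IA.prod IB) I (1 : A × B) D.mulMap) D.sumMap
    (Set.range (IA.prod IB)) (extChartAt (IA.prod IB) (1 : A × B) 1) := D.hasDerAt_mulMap.2
  rwa [(IA.prod IB).range_eq_univ, hasFDerivWithinAt_univ, ← chartMul_eq] at h

/-- Multiplication in charts is Lipschitz near the base point, so the image of a neighbourhood has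
Hausdorff dimension at most dim A + dim B. Since multiplication is open, that image is a
neighbourhood in 𝔤, of full dimension. -/
theorem finrank_le (D : DoubleLieGroup I G IA A IB B) :
    Module.finrank ℝ E ≤ Module.finrank ℝ (EA × EB) := by
  set p₀ := extChartAt (IA.prod IB) (1 : A × B) 1
  obtain ⟨C, t, ht, hL⟩ := (D.contDiffAt_chartMul.of_le (m := 1) (by norm_num)
    ).exists_lipschitzOnWith
  have hmap : t ∩ (extChartAt (IA.prod IB) (1 : A × B)).target ∈ 𝓝 p₀ :=
    Filter.inter_mem ht (extChartAt_target_mem_nhds _)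
  have h1 : D.chartMul '' (t ∩ (extChartAt (IA.prod IB) (1 : A × B)).target) ∈
      𝓝 (extChartAt I (1 : G) 1) := by
    have e1 : (extChartAt (IA.prod IB) (1 : A × B)).symm ''
        (t ∩ (extChartAt (IA.prod IB) (1 : A × B)).target) ∈ 𝓝 (1 : A × B) := by
      rw [Set.inter_comm, (extChartAt (IA.prod IB) (1 : A × B)).symm_image_target_inter_eq]
      exact Filter.inter_mem (extChartAt_source_mem_nhds _)
        ((continuousAt_extChartAt _).preimage_mem_nhds (by rwa [Set.inter_comm]))
    have e2 := D.isOpenMap_mulMap.image_mem_nhds e1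
    rw [D.mulMap_one] at e2
    have e3 := Filter.inter_mem e2 (extChartAt_source_mem_nhds (I := I) (1 : G))
    have e4 := Filter.image_mem_map (m := extChartAt I (1 : G)) e3
    rw [map_extChartAt_nhds, I.range_eq_univ, nhdsWithin_univ] at e4
    refine Filter.mem_of_superset e4 ?_
    rintro _ ⟨g, ⟨⟨_, ⟨p, hp, rfl⟩, rfl⟩, -⟩, rfl⟩
    exact ⟨p, hp, rfl⟩
  have h2 := Real.dimH_of_mem_nhds h1
  have h3 := (hL.mono Set.inter_subset_left).dimH_image_le
    (s := t ∩ (extChartAt (IA.prod IB) (1 : A × B)).target)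
  rw [h2, Real.dimH_of_mem_nhds hmap] at h3
  exact_mod_cast h3

theorem sumMap_bijective : Function.Bijective D.sumMap := by
  have h1 : Module.finrank ℝ (EA × EB) = Module.finrank ℝ E :=
    le_antisymm (LinearMap.finrank_le_finrank_of_injective (f := D.sumMap.toLinearMap)
      D.sumMap_injective) D.finrank_le
  exact ⟨D.sumMap_injective, (LinearMap.injective_iff_surjective_of_finrank_eq_finrank h1
    (f := D.sumMap.toLinearMap)).mp D.sumMap_injective⟩

/-- `sumMap` as a continuous linear equivalence. -/
def sumEquiv (D : DoubleLieGroup I G IA A IB B) : (EA × EB) ≃L[ℝ] E :=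
  (LinearEquiv.ofBijective D.sumMap.toLinearMap D.sumMap_bijective).toContinuousLinearEquiv

theorem coe_sumEquiv : (D.sumEquiv : (EA × EB) →L[ℝ] E) = D.sumMap := rfl

/-- The inverse function theorem gives a smooth local inverse ψ of multiplication in charts. Near 1
it produces a factorization of g, which is the chosen one because factorizations are unique. -/
theorem contMDiffAt_factors_one :
    ContMDiffAt I (IA.prod IB) ∞ (fun g => (D.aL g, D.bR g)) (1 : G) := by
  have hf := D.contDiffAt_chartMul
  have hf' : HasFDerivAt D.chartMul (D.sumEquiv : (EA × EB) →L[ℝ] E)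
    (extChartAt (IA.prod IB) (1 : A × B) 1) := D.hasFDerivAt_chartMul
  have hn : (∞ : WithTop ℕ∞) ≠ 0 := by simp
  have hinv := hf.to_localInverse hf' hn
  have hval : D.chartMul (extChartAt (IA.prod IB) (1 : A × B) 1) = extChartAt I (1 : G) 1 := by
    rw [chartMul, extChartAt_to_inv, mulMap_one]
  have himg := hf.localInverse_apply_image hf' hn
  rw [hval] at hinv himg
  set ψ := hf.localInverse hf' hn
  have h1 : ContMDiffAt I (IA.prod IB) ∞
      (fun g => (extChartAt (IA.prod IB) (1 : A × B)).symm (ψ (extChartAt I (1 : G) g))) 1 := by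
    have a1 : ContMDiffAt I 𝓘(ℝ, E) ∞ (extChartAt I (1 : G)) 1 := contMDiffAt_extChartAt
    have a2 := (hinv.contMDiffAt).comp (1 : G) a1
    have a3 : ContMDiffAt 𝓘(ℝ, EA × EB) (IA.prod IB) ∞
        (extChartAt (IA.prod IB) (1 : A × B)).symm (ψ (extChartAt I (1 : G) 1)) := by
      rw [himg]
      exact ((contMDiffOn_extChartAt_symm (1 : A × B)) _ (mem_extChartAt_target _)).contMDiffAt
        (extChartAt_target_mem_nhds _)
    exact a3.comp (1 : G) a2
  refine h1.congr_of_eventuallyEq ?_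
  have hcont : Filter.Tendsto (fun g => ψ (extChartAt I (1 : G) g)) (𝓝 1)
      (𝓝 (extChartAt (IA.prod IB) (1 : A × B) 1)) := by
    have := hinv.continuousAt.tendsto.comp (continuousAt_extChartAt (I := I) (1 : G)).tendsto
    rwa [himg] at this
  have hright : ∀ᶠ y in 𝓝 (extChartAt I (1 : G) 1), D.chartMul (ψ y) = y := by
    have := (hf.hasStrictFDerivAt' hf' hn).eventually_right_inverse
    rwa [hval] at this
  -- The inverse property of ψ is an equality of chart images; to cancel the chart, both points must
  -- lie in its source.
  have hsrc : ∀ᶠ g in 𝓝 (1 : G), D.mulMap ((extChartAt (IA.prod IB) (1 : A × B)).symm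
      (ψ (extChartAt I (1 : G) g))) ∈ (extChartAt I (1 : G)).source := by
    have c1 : Filter.Tendsto (fun p => D.mulMap ((extChartAt (IA.prod IB) (1 : A × B)).symm p))
        (𝓝 (extChartAt (IA.prod IB) (1 : A × B) 1)) (𝓝 1) := by
      have c2 := (continuousAt_extChartAt_symm (I := IA.prod IB) (1 : A × B)).tendsto
      rw [extChartAt_to_inv] at c2
      have c3 := (D.contMDiff_mulMap.continuous.tendsto 1).comp c2
      rwa [mulMap_one] at c3
    exact (c1.comp hcont).eventually (extChartAt_source_mem_nhds (I := I) (1 : G))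
  filter_upwards [(continuousAt_extChartAt (I := I) (1 : G)).tendsto.eventually hright, hsrc,
    extChartAt_source_mem_nhds (I := I) (1 : G)] with g hg1 hg2 hg3
  have h5 := (extChartAt I (1 : G)).injOn hg2 hg3 hg1
  exact Prod.ext (D.aL_eq h5) (D.bR_eq h5)

/-- Translating by a_L(g)⁻¹ on the left and b_R(g)⁻¹ on the right carries g to 1, and b_R is
equivariant for these translations, so smoothness at 1 spreads to every g. -/
theorem contMDiff_bR : ContMDiff I IB ∞ D.bR := by
  intro g
  have h0 : ContMDiffAt I IB ∞ D.bR 1 := contMDiffAt_snd.comp (1 : G) D.contMDiffAt_factors_one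
  have h1 : ContMDiff I I ∞ fun x : G => (D.ιA (D.aL g))⁻¹ * x * (D.ιB (D.bR g))⁻¹ :=
    (contMDiff_const.mul contMDiff_id).mul contMDiff_const
  have h2 : (D.ιA (D.aL g))⁻¹ * g * (D.ιB (D.bR g))⁻¹ = 1 := by
    rw [ιB_bR]; group
  rw [← h2] at h0
  have h3 := ((contMDiff_mul_right (I := IB) (n := ∞) (a := D.bR g)) _).comp g (h0.comp g (h1 g))
  convert! h3 using 1
  funext x
  simp only [Function.comp_apply, ← map_inv, bR_mul_ιB, bR_ιA_mul, inv_mul_cancel_right]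

theorem contMDiff_aL : ContMDiff I IA ∞ D.aL := by
  intro g
  have h0 : ContMDiffAt I IA ∞ D.aL 1 := contMDiffAt_fst.comp (1 : G) D.contMDiffAt_factors_one
  have h1 : ContMDiff I I ∞ fun x : G => (D.ιA (D.aL g))⁻¹ * x * (D.ιB (D.bR g))⁻¹ :=
    (contMDiff_const.mul contMDiff_id).mul contMDiff_const
  have h2 : (D.ιA (D.aL g))⁻¹ * g * (D.ιB (D.bR g))⁻¹ = 1 := by
    rw [ιB_bR]; group
  rw [← h2] at h0
  have h3 := ((contMDiff_mul_left (I := IA) (n := ∞) (a := D.aL g)) _).comp g (h0.comp g (h1 g))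
  convert! h3 using 1
  funext x
  simp only [Function.comp_apply, ← map_inv, aL_mul_ιB, aL_ιA_mul, mul_inv_cancel_left]

theorem contMDiff_bL : ContMDiff I IB ∞ D.bL := by
  have h := (D.contMDiff_bR.comp (contMDiff_inv I ∞ (G := G))).inv
  convert! h using 1
  funext x
  simp

theorem contMDiff_aR : ContMDiff I IA ∞ D.aR := by
  have h := (D.contMDiff_aL.comp (contMDiff_inv I ∞ (G := G))).inv
  convert! h using 1
  funext x
  simp

end Smoothness

end DoubleLieGroup

end

/-! ### Determinants of the linear maps behind the transfer diffeomorphisms. -/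

section BlockDeterminants

open Module

variable {V W : Type*} [AddCommGroup V] [Module ℝ V] [FiniteDimensional ℝ V]
  [AddCommGroup W] [Module ℝ W] [FiniteDimensional ℝ W]

theorem toMatrix_prod_eq_fromBlocks {ι κ : Type*} [Fintype ι] [Fintype κ] [DecidableEq ι]
    [DecidableEq κ] (b : Basis ι ℝ V) (c : Basis κ ℝ W) (L : V × W →ₗ[ℝ] V × W) :
    LinearMap.toMatrix (b.prod c) (b.prod c) L = Matrix.fromBlocks
      (LinearMap.toMatrix b b (LinearMap.fst ℝ V W ∘ₗ L ∘ₗ LinearMap.inl ℝ V W))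
      (LinearMap.toMatrix c b (LinearMap.fst ℝ V W ∘ₗ L ∘ₗ LinearMap.inr ℝ V W))
      (LinearMap.toMatrix b c (LinearMap.snd ℝ V W ∘ₗ L ∘ₗ LinearMap.inl ℝ V W))
      (LinearMap.toMatrix c c (LinearMap.snd ℝ V W ∘ₗ L ∘ₗ LinearMap.inr ℝ V W)) := by
  ext i j
  rcases i with i | i <;> rcases j with j | j <;> simp [LinearMap.toMatrix_apply]

theorem LinearMap.det_of_upper (L : V × W →ₗ[ℝ] V × W) (h : ∀ v, (L (v, 0)).2 = 0) :
    LinearMap.det L = LinearMap.det (LinearMap.fst ℝ V W ∘ₗ L ∘ₗ LinearMap.inl ℝ V W) *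
      LinearMap.det (LinearMap.snd ℝ V W ∘ₗ L ∘ₗ LinearMap.inr ℝ V W) := by
  classical
  have h0 : LinearMap.snd ℝ V W ∘ₗ L ∘ₗ LinearMap.inl ℝ V W = 0 := LinearMap.ext h
  rw [← LinearMap.det_toMatrix ((finBasis ℝ V).prod (finBasis ℝ W)), toMatrix_prod_eq_fromBlocks,
    h0, map_zero, Matrix.det_fromBlocks_zero₂₁, LinearMap.det_toMatrix, LinearMap.det_toMatrix]

theorem LinearMap.det_of_lower (L : V × W →ₗ[ℝ] V × W) (h : ∀ w, (L (0, w)).1 = 0) :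
    LinearMap.det L = LinearMap.det (LinearMap.fst ℝ V W ∘ₗ L ∘ₗ LinearMap.inl ℝ V W) *
      LinearMap.det (LinearMap.snd ℝ V W ∘ₗ L ∘ₗ LinearMap.inr ℝ V W) := by
  classical
  have h0 : LinearMap.fst ℝ V W ∘ₗ L ∘ₗ LinearMap.inr ℝ V W = 0 := LinearMap.ext h
  rw [← LinearMap.det_toMatrix ((finBasis ℝ V).prod (finBasis ℝ W)), toMatrix_prod_eq_fromBlocks,
    h0, map_zero, Matrix.det_fromBlocks_zero₁₂, LinearMap.det_toMatrix, LinearMap.det_toMatrix]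

theorem LinearMap.abs_det_of_involutive (L : V →ₗ[ℝ] V) (h : L ∘ₗ L = LinearMap.id) :
    |LinearMap.det L| = 1 := by
  have h1 : LinearMap.det L * LinearMap.det L = 1 := by
    rw [← LinearMap.det_comp, h, LinearMap.det_id]
  have h2 : |LinearMap.det L| * |LinearMap.det L| = 1 := by rw [← abs_mul, h1, abs_one]
  nlinarith [abs_nonneg (LinearMap.det L)]

theorem LinearMap.abs_det_neg (L : V →ₗ[ℝ] V) : |LinearMap.det (-L)| = |LinearMap.det L| := by
  have h : -L = (-LinearMap.id) ∘ₗ L := by ext; simp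
  rw [h, LinearMap.det_comp, abs_mul,
    LinearMap.abs_det_of_involutive (-LinearMap.id) (by ext; simp), one_mul]

/-- The linear map underlying the transfer diffeomorphism of the identity morphism. -/
theorem LinearMap.abs_det_transfer (C P N : V →ₗ[ℝ] V) (M : V × V →ₗ[ℝ] V × V)
    (hM : ∀ X Y, M (X, Y) = (P (X + C Y) - N Y, X + C Y)) :
    |LinearMap.det M| = |LinearMap.det N| := by
  -- T₁ is the substitution X ↦ X + CY, T₂ is triangular with diagonal (1, -N), and S swaps the
  -- factors. Thus C and P do not affect the determinant.
  let T₁ : V × V →ₗ[ℝ] V × V :=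
    (LinearMap.fst ℝ V V + C ∘ₗ LinearMap.snd ℝ V V).prod (LinearMap.snd ℝ V V)
  let T₂ : V × V →ₗ[ℝ] V × V :=
    (LinearMap.fst ℝ V V).prod (P ∘ₗ LinearMap.fst ℝ V V - N ∘ₗ LinearMap.snd ℝ V V)
  let S : V × V →ₗ[ℝ] V × V := (LinearMap.snd ℝ V V).prod (LinearMap.fst ℝ V V)
  have hfac : M = S ∘ₗ T₂ ∘ₗ T₁ := LinearMap.ext fun p => by rw [← Prod.mk.eta (p := p), hM]; rfl
  have h1 : LinearMap.det T₁ = 1 := by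
    rw [LinearMap.det_of_upper T₁ fun v => rfl]
    have e1 : LinearMap.fst ℝ V V ∘ₗ T₁ ∘ₗ LinearMap.inl ℝ V V = LinearMap.id := by
      ext; simp [T₁]
    have e2 : LinearMap.snd ℝ V V ∘ₗ T₁ ∘ₗ LinearMap.inr ℝ V V = LinearMap.id := by
      ext; simp [T₁]
    rw [e1, e2, LinearMap.det_id, one_mul]
  have h2 : LinearMap.det T₂ = LinearMap.det (-N) := by
    rw [LinearMap.det_of_lower T₂ fun v => rfl]
    have e1 : LinearMap.fst ℝ V V ∘ₗ T₂ ∘ₗ LinearMap.inl ℝ V V = LinearMap.id := by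
      ext; simp [T₂]
    have e2 : LinearMap.snd ℝ V V ∘ₗ T₂ ∘ₗ LinearMap.inr ℝ V V = -N := by
      ext; simp [T₂]
    rw [e1, e2, LinearMap.det_id, one_mul]
  have h3 : |LinearMap.det S| = 1 := LinearMap.abs_det_of_involutive S (by ext <;> simp [S])
  rw [hfac, LinearMap.det_comp, LinearMap.det_comp, abs_mul, abs_mul, h1, h2, h3,
    LinearMap.abs_det_neg, abs_one, one_mul, mul_one]

/-- The linear map underlying the transfer diffeomorphism of the comultiplication. -/
theorem LinearMap.abs_det_transfer₂ (C P P₁ Q N₁ N₂ : V →ₗ[ℝ] V)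
    (M : V × (V × V) →ₗ[ℝ] V × (V × V))
    (hM : ∀ X Y Z, M (X, (Y, Z)) = (P (P₁ (X + C Y) + Q (Z - N₁ Y)) - N₂ Z,
      (X + C Y, P₁ (X + C Y) + Q (Z - N₁ Y)))) :
    |LinearMap.det M| = |LinearMap.det N₁| * |LinearMap.det N₂| * |LinearMap.det Q| := by
  let F : V × (V × V) →ₗ[ℝ] V := LinearMap.fst ℝ V (V × V)
  let F₁ : V × (V × V) →ₗ[ℝ] V := LinearMap.fst ℝ V V ∘ₗ LinearMap.snd ℝ V (V × V)
  let F₂ : V × (V × V) →ₗ[ℝ] V := LinearMap.snd ℝ V V ∘ₗ LinearMap.snd ℝ V (V × V)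
  -- T₁ and T₂ are unipotent substitutions X ↦ X + CY and Z ↦ Z - N₁Y. In the new variables N₂Z
  -- becomes N₂(Z + N₁Y), so the lower block of T₃ is triangular with diagonal (-N₂N₁, Q); S only
  -- reorders components.
  let T₁ : V × (V × V) →ₗ[ℝ] V × (V × V) := (F + C ∘ₗ F₁).prod (F₁.prod F₂)
  let T₂ : V × (V × V) →ₗ[ℝ] V × (V × V) := F.prod (F₁.prod (F₂ - N₁ ∘ₗ F₁))
  let W₂ : V × (V × V) →ₗ[ℝ] V := P₁ ∘ₗ F + Q ∘ₗ F₂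
  let T₃ : V × (V × V) →ₗ[ℝ] V × (V × V) :=
    F.prod ((P ∘ₗ W₂ - N₂ ∘ₗ (F₂ + N₁ ∘ₗ F₁)).prod W₂)
  let S : V × (V × V) →ₗ[ℝ] V × (V × V) := F₁.prod (F.prod F₂)
  have hfac : M = S ∘ₗ T₃ ∘ₗ T₂ ∘ₗ T₁ := LinearMap.ext fun p => by
    obtain ⟨X, Y, Z⟩ := p
    rw [hM]
    simp [S, T₃, T₂, T₁, W₂, F, F₁, F₂]
  have h1 : LinearMap.det T₁ = 1 := by
    rw [LinearMap.det_of_upper T₁ fun v => rfl]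
    have e1 : LinearMap.fst ℝ V (V × V) ∘ₗ T₁ ∘ₗ LinearMap.inl ℝ V (V × V) = LinearMap.id := by
      ext; simp [T₁, F, F₁]
    have e2 : LinearMap.snd ℝ V (V × V) ∘ₗ T₁ ∘ₗ LinearMap.inr ℝ V (V × V) = LinearMap.id := by
      ext <;> simp [T₁, F₁, F₂]
    rw [e1, e2, LinearMap.det_id, LinearMap.det_id, one_mul]
  have h2 : LinearMap.det T₂ = 1 := by
    rw [LinearMap.det_of_lower T₂ fun v => rfl]
    have e1 : LinearMap.fst ℝ V (V × V) ∘ₗ T₂ ∘ₗ LinearMap.inl ℝ V (V × V) = LinearMap.id := by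
      ext; simp [T₂, F]
    rw [e1, LinearMap.det_id, one_mul, LinearMap.det_of_lower _ fun v => by simp [T₂, F₁]]
    have e2 : LinearMap.fst ℝ V V ∘ₗ (LinearMap.snd ℝ V (V × V) ∘ₗ T₂ ∘ₗ
        LinearMap.inr ℝ V (V × V)) ∘ₗ LinearMap.inl ℝ V V = LinearMap.id := by
      ext; simp [T₂, F₁]
    have e3 : LinearMap.snd ℝ V V ∘ₗ (LinearMap.snd ℝ V (V × V) ∘ₗ T₂ ∘ₗ
        LinearMap.inr ℝ V (V × V)) ∘ₗ LinearMap.inr ℝ V V = LinearMap.id := by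
      ext; simp [T₂, F₁, F₂]
    rw [e2, e3, LinearMap.det_id, one_mul]
  have h3 : LinearMap.det T₃ = LinearMap.det (-(N₂ ∘ₗ N₁)) * LinearMap.det Q := by
    rw [LinearMap.det_of_lower T₃ fun v => rfl]
    have e1 : LinearMap.fst ℝ V (V × V) ∘ₗ T₃ ∘ₗ LinearMap.inl ℝ V (V × V) = LinearMap.id := by
      ext; simp [T₃, F]
    rw [e1, LinearMap.det_id, one_mul,
      LinearMap.det_of_upper _ fun v => by simp [T₃, W₂, F, F₂]]
    have e2 : LinearMap.fst ℝ V V ∘ₗ (LinearMap.snd ℝ V (V × V) ∘ₗ T₃ ∘ₗ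
        LinearMap.inr ℝ V (V × V)) ∘ₗ LinearMap.inl ℝ V V = -(N₂ ∘ₗ N₁) := by
      ext; simp [T₃, W₂, F, F₁, F₂]
    have e3 : LinearMap.snd ℝ V V ∘ₗ (LinearMap.snd ℝ V (V × V) ∘ₗ T₃ ∘ₗ
        LinearMap.inr ℝ V (V × V)) ∘ₗ LinearMap.inr ℝ V V = Q := by
      ext; simp [T₃, W₂, F, F₂]
    rw [e2, e3]
  have h4 : |LinearMap.det S| = 1 :=
    LinearMap.abs_det_of_involutive S (by ext <;> simp [S, F, F₁, F₂])
  rw [hfac, LinearMap.det_comp, LinearMap.det_comp, LinearMap.det_comp, abs_mul, abs_mul, abs_mul,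
    h1, h2, h3, h4, abs_mul, LinearMap.abs_det_neg, LinearMap.det_comp, abs_mul, abs_one]
  ring

end BlockDeterminants

/-! ### Jacobians of t_id and t_δ. -/

noncomputable section

namespace DoubleLieGroup

section Jacobians

open scoped Manifold ContDiff Topology

variable {E : Type*} [NormedAddCommGroup E] [NormedSpace ℝ E] [FiniteDimensional ℝ E]
  {H : Type*} [TopologicalSpace H] {I : ModelWithCorners ℝ E H} [I.Boundaryless]
  {G : Type*} [TopologicalSpace G] [ChartedSpace H G] [Group G] [LieGroup I ∞ G]
  [T2Space G] [SecondCountableTopology G]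
  {EA : Type*} [NormedAddCommGroup EA] [NormedSpace ℝ EA] [FiniteDimensional ℝ EA]
  {HA : Type*} [TopologicalSpace HA] {IA : ModelWithCorners ℝ EA HA} [IA.Boundaryless]
  {A : Type*} [TopologicalSpace A] [ChartedSpace HA A] [Group A] [LieGroup IA ∞ A]
  {EB : Type*} [NormedAddCommGroup EB] [NormedSpace ℝ EB] [FiniteDimensional ℝ EB]
  {HB : Type*} [TopologicalSpace HB] {IB : ModelWithCorners ℝ EB HB} [IB.Boundaryless]
  {B : Type*} [TopologicalSpace B] [ChartedSpace HB B] [Group B] [LieGroup IB ∞ B]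
variable (D : DoubleLieGroup I G IA A IB B)

/-- The derivative at the identity of `β ↦ b_R(βa)`. -/
def derNu (D : DoubleLieGroup I G IA A IB B) (a : A) : EB →L[ℝ] EB :=
  mfderiv IB IB (fun β : B => D.bR (D.ιB β * D.ιA a)) 1

/-- The character `a ↦ |det Ad_A(a)| / |det Ad_G(a)|` of `A`. -/
def weight (D : DoubleLieGroup I G IA A IB B) (a : A) : ℝ := adDet IA a / adDet I (D.ιA a)

theorem contMDiff_bR_ιB_mul (g : G) : ContMDiff IB IB ∞ (fun β : B => D.bR (D.ιB β * g)) :=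
  D.contMDiff_bR.comp (D.contMDiff_ιB.mul contMDiff_const)

theorem hasDerAt_nu (a : A) :
    HasDerAt IB IB (fun β : B => D.bR (D.ιB β * D.ιA a)) 1 (D.derNu a) :=
  (D.contMDiff_bR_ιB_mul (D.ιA a)).hasDerAt 1

/-- The separated form `transfer_id` has the shape treated in `LinearMap.abs_det_transfer`, so only
the derivative of the β'-dependent factor survives. The derivative P of the γ-dependent factor
merely has to exist. -/
theorem jac_id {x y : G} (h : D.aR x = D.aL y) :
    |jac D D (fun x y => x = y) x y| = |(D.derNu (D.aL y)).det| := by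
  have hγ : HasDerAt (IB.prod IB) IB (fun p : B × B => p.1 * (D.bL x * p.2 * (D.bL x)⁻¹)) (1, 1)
      (ContinuousLinearMap.fst ℝ EB EB + (Ad IB (D.bL x)).comp (ContinuousLinearMap.snd ℝ EB EB)) :=
    (hasDerAt_fst _).mul ((hasDerAt_snd _).conj (D.bL x) rfl) rfl (by simp)
  obtain ⟨P, hp⟩ : ∃ P : EB →L[ℝ] EB,
      HasDerAt IB IB (fun β : B => (D.bR x)⁻¹ * D.bR (D.ιB β * x)) 1 P :=
    ⟨_, ((contMDiff_const (c := (D.bR x)⁻¹)).mul (D.contMDiff_bR_ιB_mul x)).hasDerAt 1⟩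
  have hT := ((hp.comp hγ (by simp)).mul (((D.hasDerAt_nu (D.aL y)).comp
    (hasDerAt_snd (I := IB) (J := IB) ((1 : B), (1 : B))) rfl).inv (by simp)) (by simp)
      (by simp)).prodMk hγ
  have hT' := (funext (D.transfer_id h)) ▸ hT
  have hjac : jac D D (fun x y => x = y) x y = ContinuousLinearMap.det _ :=
    congrArg ContinuousLinearMap.det hT'.mfderiv_eq
  rw [hjac]
  exact LinearMap.abs_det_transfer (Ad IB (D.bL x)).toLinearMap P.toLinearMap
    (D.derNu (D.aL y)).toLinearMap _ fun X Y => by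
      simp [sub_eq_add_neg]

/-- `transfer_δ` fits `LinearMap.abs_det_transfer₂`: the two legs contribute one derivative `derNu`
each, and the conjugation by q contributes Ad(q). -/
theorem jac_δ {x : G} {y : G × G} (h : D.aR x = D.aL y.1 * D.aL y.2) :
    |jac D D.square D.δ x y| = |(D.derNu (D.aL y.1)).det| * |(D.derNu (D.aL y.2)).det| *
      adDet IB (D.bR (D.ιB (D.bL x) * D.ιA (D.aL y.1))) := by
  set q := D.bR (D.ιB (D.bL x) * D.ιA (D.aL y.1)) with hq
  have h1 : HasDerAt (IB.prod (IB.prod IB)) IB (fun p : B × (B × B) => p.2.1) (1, (1, 1))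
      ((ContinuousLinearMap.fst ℝ EB EB).comp (ContinuousLinearMap.snd ℝ EB (EB × EB))) :=
    (hasDerAt_fst ((1 : B), (1 : B))).comp (hasDerAt_snd _) rfl
  have h2 : HasDerAt (IB.prod (IB.prod IB)) IB (fun p : B × (B × B) => p.2.2) (1, (1, 1))
      ((ContinuousLinearMap.snd ℝ EB EB).comp (ContinuousLinearMap.snd ℝ EB (EB × EB))) :=
    (hasDerAt_snd ((1 : B), (1 : B))).comp (hasDerAt_snd _) rfl
  have hγ := (hasDerAt_fst (I := IB) (J := IB.prod IB) ((1 : B), ((1 : B), (1 : B)))).mul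
    (h1.conj (D.bL x) rfl) rfl (by simp)
  obtain ⟨P₁, hp₁⟩ : ∃ P₁ : EB →L[ℝ] EB, HasDerAt IB IB
      (fun β : B => D.bR (D.ιB β * (D.ιB (D.bL x) * D.ιA (D.aL y.1))) * q⁻¹) 1 P₁ :=
    ⟨_, ((D.contMDiff_bR_ιB_mul (D.ιB (D.bL x) * D.ιA (D.aL y.1))).mul
      (contMDiff_const (c := q⁻¹))).hasDerAt 1⟩
  obtain ⟨P, hp⟩ : ∃ P : EB →L[ℝ] EB, HasDerAt IB IB
      (fun β : B => (D.bR x)⁻¹ * D.bR (D.ιB β * (D.ιB q * D.ιA (D.aL y.2)))) 1 P :=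
    ⟨_, ((contMDiff_const (c := (D.bR x)⁻¹)).mul
      (D.contMDiff_bR_ιB_mul (D.ιB q * D.ιA (D.aL y.2)))).hasDerAt 1⟩
  -- The product rule is available only for factors equal to 1 at the base point; here this holds
  -- because b_L(x)a_L(y₁)a_L(y₂) = x.
  have hx : (D.bR x)⁻¹ * D.bR (D.ιB q * D.ιA (D.aL y.2)) = 1 := by
    rw [inv_mul_eq_one, hq, ιB_bR, ← map_inv, mul_assoc, bR_ιA_mul, mul_assoc, ← map_mul, ← h,
      bL_mul_aR]
  have hγ₂ := (hp₁.comp hγ (by simp)).mul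
    (((((D.hasDerAt_nu (D.aL y.1)).comp h1 rfl).inv (by simp)).mul h2 (by simp) rfl).conj q
      (by simp)) (by simp [hq]) (by simp)
  have hT := ((hp.comp hγ₂ (by simp [hq])).mul (((D.hasDerAt_nu (D.aL y.2)).comp h2 rfl).inv
    (by simp)) (by
      simp only [mul_one, mul_inv_cancel, map_one, one_mul, ← hq, bR_ιA, inv_one, hx])
      (by simp)).prodMk (hγ.prodMk hγ₂)
  have hT' := (funext (D.transfer_δ h hq)) ▸ hT
  have hjac : jac D D.square D.δ x y = ContinuousLinearMap.det _ :=
    congrArg ContinuousLinearMap.det hT'.mfderiv_eq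
  rw [hjac]
  exact LinearMap.abs_det_transfer₂ (Ad IB (D.bL x)).toLinearMap P.toLinearMap P₁.toLinearMap
    (Ad IB q).toLinearMap (D.derNu (D.aL y.1)).toLinearMap
    (D.derNu (D.aL y.2)).toLinearMap _ fun X Y Z => by
      simp [sub_eq_add_neg, add_comm (Z)]

end Jacobians

end DoubleLieGroup

end

/-! ### Blocks of Ad, the weight on A, and |Q|. -/

noncomputable section

namespace DoubleLieGroup

section Weights

open scoped Manifold ContDiff Topology

variable {E : Type*} [NormedAddCommGroup E] [NormedSpace ℝ E] [FiniteDimensional ℝ E]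
  {H : Type*} [TopologicalSpace H] {I : ModelWithCorners ℝ E H} [I.Boundaryless]
  {G : Type*} [TopologicalSpace G] [ChartedSpace H G] [Group G] [LieGroup I ∞ G]
  [T2Space G] [SecondCountableTopology G]
  {EA : Type*} [NormedAddCommGroup EA] [NormedSpace ℝ EA] [FiniteDimensional ℝ EA]
  {HA : Type*} [TopologicalSpace HA] {IA : ModelWithCorners ℝ EA HA} [IA.Boundaryless]
  {A : Type*} [TopologicalSpace A] [ChartedSpace HA A] [Group A] [LieGroup IA ∞ A]
  {EB : Type*} [NormedAddCommGroup EB] [NormedSpace ℝ EB] [FiniteDimensional ℝ EB]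
  {HB : Type*} [TopologicalSpace HB] {IB : ModelWithCorners ℝ EB HB} [IB.Boundaryless]
  {B : Type*} [TopologicalSpace B] [ChartedSpace HB B] [Group B] [LieGroup IB ∞ B]
variable (D : DoubleLieGroup I G IA A IB B)

theorem inverse_sumMap_apply (p : EA × EB) : D.sumMap.inverse (D.sumMap p) = p := by
  rw [← coe_sumEquiv, ContinuousLinearMap.inverse_equiv]
  exact D.sumEquiv.symm_apply_apply p

/-- Differentiating g = a_L(g)b_R(g) at 1 shows that the pair of derivatives of a_L and b_R is
inverse to 𝔞 ⊕ 𝔟 → 𝔤. -/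
theorem hasDerAt_bR : HasDerAt I IB D.bR 1
    ((ContinuousLinearMap.snd ℝ EA EB).comp D.sumMap.inverse) := by
  obtain ⟨L, hL⟩ : ∃ L : E →L[ℝ] EA, HasDerAt I IA D.aL 1 L := ⟨_, D.contMDiff_aL.hasDerAt 1⟩
  obtain ⟨M, hM⟩ : ∃ M : E →L[ℝ] EB, HasDerAt I IB D.bR 1 M := ⟨_, D.contMDiff_bR.hasDerAt 1⟩
  have haL1 : D.aL 1 = 1 := by simpa using D.aL_ιA 1
  have hbR1 : D.bR 1 = 1 := by simpa using D.bR_ιA 1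
  have h := (D.hasDerAt_ιA.comp hL haL1).mul (D.hasDerAt_ιB.comp hM hbR1) (by simp [haL1])
    (by simp [hbR1])
  simp only [aL_mul_bR] at h
  have h1 := h.unique (hasDerAt_id 1)
  convert hM using 1
  ext X
  have h2 : X = D.sumMap (L X, M X) := (DFunLike.congr_fun h1 X).symm
  conv_lhs => rw [h2]
  exact congrArg Prod.snd (D.inverse_sumMap_apply (L X, M X))

/-- The block `𝔞 → 𝔞` of `Ad(g)`. -/
def block₁ (D : DoubleLieGroup I G IA A IB B) (g : G) : EA →L[ℝ] EA :=
  ContinuousLinearMap.fst ℝ EA EB ∘L D.AdMatrix g ∘L ContinuousLinearMap.inl ℝ EA EB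

/-- The block `𝔟 → 𝔟` of `Ad(g)`. -/
def block₄ (D : DoubleLieGroup I G IA A IB B) (g : G) : EB →L[ℝ] EB :=
  ContinuousLinearMap.snd ℝ EA EB ∘L D.AdMatrix g ∘L ContinuousLinearMap.inr ℝ EA EB

theorem block₄_apply (g : G) (Y : EB) :
    D.block₄ g Y = (D.sumMap.inverse (Ad I g (D.dB Y))).2 := by
  have : D.dB Y = D.sumMap (0, Y) := by rw [sumMap_apply, map_zero, zero_add]
  rw [this]; rfl

theorem block₁_apply (g : G) (X : EA) :
    D.block₁ g X = (D.sumMap.inverse (Ad I g (D.dA X))).1 := by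
  have : D.dA X = D.sumMap (X, 0) := by rw [sumMap_apply, map_zero, add_zero]
  rw [this]; rfl

/-- A left factor in A does not change b_R, so b_R(βa) = b_R(a⁻¹βa), and the derivative is the
𝔟-component of Ad(a⁻¹) on 𝔟. -/
theorem derNu_eq (a : A) : D.derNu a = D.block₄ (D.ιA a⁻¹) := by
  have h := D.hasDerAt_bR.comp (D.hasDerAt_ιB.conj (D.ιA a⁻¹) (map_one _)) (by simp)
  refine (D.hasDerAt_nu a).unique ?_
  have e : ∀ β : B, D.bR (D.ιA a⁻¹ * D.ιB β * (D.ιA a⁻¹)⁻¹) = D.bR (D.ιB β * D.ιA a) := fun β => by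
    rw [mul_assoc, bR_ιA_mul, map_inv, inv_inv]
  simp only [e] at h
  convert h using 1
  ext Y
  exact D.block₄_apply _ Y

theorem Ad_dA (a : A) (X : EA) : Ad I (D.ιA a) (D.dA X) = D.dA (Ad IA a X) := by
  have h1 := D.hasDerAt_ιA.conj (D.ιA a) (map_one _)
  have h2 := D.hasDerAt_ιA.comp (hasDerAt_conj (J := IA) a) (by simp)
  simp only [map_mul, map_inv] at h2
  exact DFunLike.congr_fun (h1.unique h2) X

theorem Ad_dB (b : B) (Y : EB) : Ad I (D.ιB b) (D.dB Y) = D.dB (Ad IB b Y) := by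
  have h1 := D.hasDerAt_ιB.conj (D.ιB b) (map_one _)
  have h2 := D.hasDerAt_ιB.comp (hasDerAt_conj (J := IB) b) (by simp)
  simp only [map_mul, map_inv] at h2
  exact DFunLike.congr_fun (h1.unique h2) Y

theorem abs_det_AdMatrix (g : G) : |(D.AdMatrix g).det| = adDet I g := by
  rw [adDet]
  have h : (D.AdMatrix g).toLinearMap = (D.sumEquiv.symm.toLinearEquiv : E →ₗ[ℝ] EA × EB) ∘ₗ
      (Ad I g).toLinearMap ∘ₗ (D.sumEquiv.symm.toLinearEquiv.symm : EA × EB →ₗ[ℝ] E) := by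
    refine LinearMap.ext fun x => ?_
    rw [AdMatrix, ← coe_sumEquiv, ContinuousLinearMap.inverse_equiv]
    rfl
  rw [ContinuousLinearMap.det, h, LinearMap.det_conj, ContinuousLinearMap.det]

theorem AdMatrix_ιA (a : A) (X : EA) : D.AdMatrix (D.ιA a) (X, 0) = (Ad IA a X, 0) := by
  have h : D.AdMatrix (D.ιA a) (X, 0) = D.sumMap.inverse (Ad I (D.ιA a) (D.sumMap (X, 0))) := rfl
  rw [h, sumMap_apply, map_zero, add_zero, Ad_dA,
    show D.dA (Ad IA a X) = D.sumMap (Ad IA a X, 0) by rw [sumMap_apply, map_zero, add_zero],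
    inverse_sumMap_apply]

theorem AdMatrix_ιB (b : B) (Y : EB) : D.AdMatrix (D.ιB b) (0, Y) = (0, Ad IB b Y) := by
  have h : D.AdMatrix (D.ιB b) (0, Y) = D.sumMap.inverse (Ad I (D.ιB b) (D.sumMap (0, Y))) := rfl
  rw [h, sumMap_apply, map_zero, zero_add, Ad_dB,
    show D.dB (Ad IB b Y) = D.sumMap (0, Ad IB b Y) by rw [sumMap_apply, map_zero, zero_add],
    inverse_sumMap_apply]

/-- Ad(a) preserves 𝔞 and acts there as Ad_A(a). Its matrix is therefore triangular, and the
determinant splits. -/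
theorem abs_det_block₄_ιA (a : A) :
    |(D.block₄ (D.ιA a)).det| = adDet I (D.ιA a) / adDet IA a := by
  rw [eq_div_iff (adDet_pos a).ne', ← D.abs_det_AdMatrix, mul_comm]
  have h := LinearMap.det_of_upper (D.AdMatrix (D.ιA a)).toLinearMap
    fun v => congrArg Prod.snd (D.AdMatrix_ιA a v)
  have h1 : LinearMap.fst ℝ EA EB ∘ₗ (D.AdMatrix (D.ιA a)).toLinearMap ∘ₗ
      LinearMap.inl ℝ EA EB = (Ad IA a).toLinearMap :=
    LinearMap.ext fun v => congrArg Prod.fst (D.AdMatrix_ιA a v)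
  rw [h1] at h
  rw [ContinuousLinearMap.det, ContinuousLinearMap.det, h, abs_mul]
  rfl

theorem abs_det_block₁_ιB (b : B) :
    |(D.block₁ (D.ιB b)).det| = adDet I (D.ιB b) / adDet IB b := by
  rw [eq_div_iff (adDet_pos b).ne', ← D.abs_det_AdMatrix]
  have h := LinearMap.det_of_lower (D.AdMatrix (D.ιB b)).toLinearMap
    fun v => congrArg Prod.fst (D.AdMatrix_ιB b v)
  have h1 : LinearMap.snd ℝ EA EB ∘ₗ (D.AdMatrix (D.ιB b)).toLinearMap ∘ₗ
      LinearMap.inr ℝ EA EB = (Ad IB b).toLinearMap :=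
    LinearMap.ext fun v => congrArg Prod.snd (D.AdMatrix_ιB b v)
  rw [h1] at h
  rw [ContinuousLinearMap.det, ContinuousLinearMap.det, h, abs_mul]
  rfl

theorem weight_pos (a : A) : 0 < D.weight a := div_pos (adDet_pos a) (adDet_pos _)

theorem weight_one : D.weight 1 = 1 := by
  rw [weight, map_one, adDet_one, adDet_one, div_one]

theorem weight_inv (a : A) : D.weight a⁻¹ = (D.weight a)⁻¹ := by
  rw [weight, map_inv, adDet_inv, adDet_inv, weight, inv_div, div_inv_eq_mul, div_eq_mul_inv,
    mul_comm]

theorem contMDiff_weight : ContMDiff IA 𝓘(ℝ, ℝ) ∞ D.weight :=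
  contMDiff_adDet.div₀ (contMDiff_adDet.comp D.contMDiff_ιA) fun _ => (adDet_pos _).ne'

theorem abs_det_derNu (a : A) : |(D.derNu a).det| = D.weight a := by
  rw [derNu_eq, abs_det_block₄_ιA, map_inv, adDet_inv, adDet_inv, weight, inv_div_inv]

/-- The derivative of `β ↦ b_L(aβ)`. -/
theorem hasDerAt_bL_ιA_mul (a : A) :
    HasDerAt IB IB (fun β : B => D.bL (D.ιA a * D.ιB β)) 1 (D.derNu a⁻¹) := by
  have h := ((D.hasDerAt_nu a⁻¹).comp (hasDerAt_inv_one (J := IB) (N := B)) inv_one).inv (by simp)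
  have e : ∀ β : B, (D.bR (D.ιB β⁻¹ * D.ιA a⁻¹))⁻¹ = D.bL (D.ιA a * D.ιB β) := fun β => by
    rw [← bL_inv, mul_inv_rev, map_inv, map_inv, inv_inv, inv_inv]
  simp only [e] at h
  convert h using 1
  ext X
  simp

/-- Since Ad(b) preserves 𝔟 and Ad(a) preserves 𝔞, the 𝔟-block factors along g = a_L b_R and the
𝔞-block along g = b_L a_R. Splitting det Ad(g) along b_L a_R cancels the contribution of b_L to the
determinant on 𝔤. -/
theorem abs_Q (g : G) : |D.Q g| =
    D.weight (D.aL g) * adDet IB (D.bL g) / (D.weight (D.aR g) * adDet IB (D.bR g)) := by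
  have h4 : |(D.block₄ g).det| =
      adDet I (D.ιA (D.aL g)) / adDet IA (D.aL g) * adDet IB (D.bR g) := by
    rw [← abs_det_block₄_ιA, adDet, ← abs_mul, ← ContinuousLinearMap.det_comp']
    congr 2
    ext Y
    conv_lhs => rw [← D.aL_mul_bR g, block₄_apply, Ad_mul]
    rw [ContinuousLinearMap.comp_apply, ContinuousLinearMap.comp_apply, Ad_dB, block₄_apply]
  have h1 : |(D.block₁ g).det| =
      adDet I (D.ιB (D.bL g)) / adDet IB (D.bL g) * adDet IA (D.aR g) := by
    rw [← abs_det_block₁_ιB, adDet, ← abs_mul, ← ContinuousLinearMap.det_comp']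
    congr 2
    ext X
    conv_lhs => rw [← D.bL_mul_aR g, block₁_apply, Ad_mul]
    rw [ContinuousLinearMap.comp_apply, ContinuousLinearMap.comp_apply, Ad_dA, block₁_apply]
  have h0 : |(Ad I g).det| = adDet I (D.ιB (D.bL g)) * adDet I (D.ιA (D.aR g)) := by
    rw [← adDet_mul, bL_mul_aR]; rfl
  change |(Ad I g).det / ((D.block₁ g).det * (D.block₄ g).det)| = _
  rw [abs_div, abs_mul, h0, h1, h4, weight, weight]
  have p1 := adDet_pos (J := I) (D.ιB (D.bL g))
  have p2 := adDet_pos (J := I) (D.ιA (D.aR g))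
  have p3 := adDet_pos (J := I) (D.ιA (D.aL g))
  have p4 := adDet_pos (J := IA) (D.aL g)
  have p5 := adDet_pos (J := IA) (D.aR g)
  have p6 := adDet_pos (J := IB) (D.bL g)
  have p7 := adDet_pos (J := IB) (D.bR g)
  field_simp

end Weights

end DoubleLieGroup

end

/-! ### A left Haar measure in the chart at the identity. -/

noncomputable section

section LocalHaar

open scoped Manifold ContDiff Topology

variable {F : Type*} [NormedAddCommGroup F] [NormedSpace ℝ F] [FiniteDimensional ℝ F]
  {HF : Type*} [TopologicalSpace HF] {J : ModelWithCorners ℝ F HF} [J.Boundaryless]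
  {N : Type*} [TopologicalSpace N] [ChartedSpace HF N] [Group N] [LieGroup J ∞ N]

/-- The derivative at `y` of the inverse of the chart at `1`, left translated to the identity. -/
def chartDer (J : ModelWithCorners ℝ F HF) (N : Type*) [TopologicalSpace N] [ChartedSpace HF N]
    [Group N] (y : F) : F →L[ℝ] F :=
  mfderiv 𝓘(ℝ, F) J
    (fun z : F => ((extChartAt J (1 : N)).symm y)⁻¹ * (extChartAt J (1 : N)).symm z) y

theorem contMDiffAt_extChartAt_symm_one {y : F} (hy : y ∈ (extChartAt J (1 : N)).target) :
    ContMDiffAt 𝓘(ℝ, F) J ∞ (extChartAt J (1 : N)).symm y :=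
  ((contMDiffOn_extChartAt_symm (1 : N)) y hy).contMDiffAt
    ((isOpen_extChartAt_target (1 : N)).mem_nhds hy)

theorem hasDerAt_chartDer {y : F} (hy : y ∈ (extChartAt J (1 : N)).target) :
    HasDerAt 𝓘(ℝ, F) J
      (fun z : F => ((extChartAt J (1 : N)).symm y)⁻¹ * (extChartAt J (1 : N)).symm z) y
      (chartDer J N y) :=
  ((contMDiffAt_const.mul (contMDiffAt_extChartAt_symm_one hy)).mdifferentiableAt
    (by simp)).hasDerAt

/-- The chain rule for the chart after its inverse, both read through left translation. It makes the
density nonzero and cancels the chart in changes of variable. -/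
theorem exists_hasDerAt_extChartAt_mul {x : N} (hx : x ∈ (extChartAt J (1 : N)).source) :
    ∃ L : F →L[ℝ] F, HasDerAt J 𝓘(ℝ, F) (fun γ : N => extChartAt J (1 : N) (x * γ)) 1 L ∧
      (chartDer J N (extChartAt J (1 : N) x)).comp L = ContinuousLinearMap.id ℝ F := by
  have h1 : ContMDiffAt J 𝓘(ℝ, F) ∞ (extChartAt J (1 : N)) (x * 1) := by
    rw [mul_one]
    exact contMDiffAt_extChartAt' (by rwa [extChartAt_source] at hx)
  have h2 : ContMDiffAt J 𝓘(ℝ, F) ∞ (fun γ : N => extChartAt J (1 : N) (x * γ)) 1 :=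
    h1.comp (1 : N) ((contMDiff_mul_left (I := J) (n := ∞) (a := x)) 1)
  have h3 : HasDerAt J 𝓘(ℝ, F) (fun γ : N => extChartAt J (1 : N) (x * γ)) 1 _ :=
    (h2.mdifferentiableAt (by simp)).hasDerAt
  refine ⟨_, h3, ?_⟩
  refine ((hasDerAt_chartDer ((extChartAt J (1 : N)).map_source hx)).comp h3
    (by rw [mul_one])).unique ((hasDerAt_id (1 : N)).congr_of_eventuallyEq ?_)
  have h4 : ∀ᶠ γ in 𝓝 (1 : N), x * γ ∈ (extChartAt J (1 : N)).source := by
    refine ((contMDiff_mul_left (I := J) (n := ∞) (a := x)).continuous.tendsto 1).eventually ?_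
    rw [mul_one]
    exact (isOpen_extChartAt_source (1 : N)).mem_nhds hx
  filter_upwards [h4] with γ hγ
  rw [(extChartAt J (1 : N)).left_inv hx, (extChartAt J (1 : N)).left_inv hγ, inv_mul_cancel_left]

theorem det_chartDer_ne_zero {y : F} (hy : y ∈ (extChartAt J (1 : N)).target) :
    (chartDer J N y).det ≠ 0 := by
  obtain ⟨L, -, hL⟩ := exists_hasDerAt_extChartAt_mul ((extChartAt J (1 : N)).map_target hy)
  rw [(extChartAt J (1 : N)).right_inv hy] at hL
  intro h0
  have h1 := congrArg ContinuousLinearMap.det hL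
  rw [ContinuousLinearMap.det_comp', h0, zero_mul, ContinuousLinearMap.det,
    ContinuousLinearMap.coe_id, LinearMap.det_id] at h1
  exact zero_ne_one h1

/-- For every y the translated map takes the value 1 at z = y, so one target chart suffices and the
derivative depends continuously on y with no coordinate change. -/
theorem continuousOn_chartDer :
    ContinuousOn (fun y => chartDer J N y) (extChartAt J (1 : N)).target := by
  intro y₀ hy₀
  refine ContinuousAt.continuousWithinAt ?_
  have h : ContMDiffAt (𝓘(ℝ, F).prod 𝓘(ℝ, F)) J ∞ (Function.uncurry fun y z : F =>
      ((extChartAt J (1 : N)).symm y)⁻¹ * (extChartAt J (1 : N)).symm z) (y₀, y₀) :=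
    ((contMDiffAt_extChartAt_symm_one hy₀).comp (y₀, y₀) contMDiffAt_fst).inv.mul
      ((contMDiffAt_extChartAt_symm_one hy₀).comp (y₀, y₀) contMDiffAt_snd)
  have h1 := ContMDiffAt.mfderiv (I := 𝓘(ℝ, F)) (I' := J) (x₀ := y₀) (fun y z : F =>
    ((extChartAt J (1 : N)).symm y)⁻¹ * (extChartAt J (1 : N)).symm z) (fun y => y) h
      contMDiffAt_id (m := 0) (by simp)
  refine h1.continuousAt.congr (Filter.Eventually.of_forall fun y => ?_)
  have e : ∀ y : F, ((extChartAt J (1 : N)).symm y)⁻¹ * (extChartAt J (1 : N)).symm y = 1 :=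
    fun y => inv_mul_cancel _
  refine (inTangentCoordinates_eq (I := 𝓘(ℝ, F)) (I' := J) (fun y : F => y)
    (fun y : F => ((extChartAt J (1 : N)).symm y)⁻¹ * (extChartAt J (1 : N)).symm y)
    (fun y => mfderiv 𝓘(ℝ, F) J (fun z : F =>
      ((extChartAt J (1 : N)).symm y)⁻¹ * (extChartAt J (1 : N)).symm z) y)
    (by rw [chartAt_self_eq]; exact Set.mem_univ _) (by rw [e, e]; exact mem_chart_source _ _)).trans ?_
  change (((tangentBundleCore J N).coordChange
    (achart HF (((extChartAt J (1 : N)).symm y)⁻¹ * (extChartAt J (1 : N)).symm y))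
    (achart HF (((extChartAt J (1 : N)).symm y₀)⁻¹ * (extChartAt J (1 : N)).symm y₀))
    (((extChartAt J (1 : N)).symm y)⁻¹ * (extChartAt J (1 : N)).symm y) : F →L[ℝ] F).comp
      ((chartDer J N y).comp
        ((tangentBundleCore 𝓘(ℝ, F) F).coordChange (achart F y₀) (achart F y) y : F →L[ℝ] F))) = _
  rw [e, e]
  ext v
  have h2 : ∀ w : F, (tangentBundleCore J N).coordChange (achart HF (1 : N)) (achart HF (1 : N)) 1 w
      = w := fun w => (tangentBundleCore J N).coordChange_self _ _ (mem_chart_source _ _) w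
  have h3 : ∀ w : F, (tangentBundleCore 𝓘(ℝ, F) F).coordChange (achart F y₀) (achart F y) y w
      = w := fun w => (tangentBundleCore 𝓘(ℝ, F) F).coordChange_self (achart F y) _
        (mem_chart_source _ _) w
  change (tangentBundleCore J N).coordChange (achart HF (1 : N)) (achart HF (1 : N)) 1
    (chartDer J N y
      ((tangentBundleCore 𝓘(ℝ, F) F).coordChange (achart F y₀) (achart F y) y v)) = _
  rw [h2, h3]

/-- The density of a left Haar measure in the chart at `1`. -/
def chartDensity (J : ModelWithCorners ℝ F HF) (N : Type*) [TopologicalSpace N]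
    [ChartedSpace HF N] [Group N] (y : F) : ENNReal :=
  ENNReal.ofReal |(chartDer J N y).det|

variable [MeasurableSpace F] [BorelSpace F] [MeasurableSpace N] [BorelSpace N]

theorem measurableSet_image_extChartAt {S : Set N} (hS : MeasurableSet S)
    (hsub : S ⊆ (extChartAt J (1 : N)).source) :
    MeasurableSet (extChartAt J (1 : N) '' S) := by
  have h1 : extChartAt J (1 : N) '' S = Subtype.val ''
      (((extChartAt J (1 : N)).target.domRestrict (extChartAt J (1 : N)).symm) ⁻¹' S) := by
    rw [(extChartAt J (1 : N)).image_eq_target_inter_inv_preimage hsub]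
    ext y
    constructor
    · rintro ⟨h1, h2⟩
      exact ⟨⟨y, h1⟩, h2, rfl⟩
    · rintro ⟨⟨z, h1⟩, h2, rfl⟩
      exact ⟨h1, h2⟩
  rw [h1]
  exact MeasurableSet.subtype_image (isOpen_extChartAt_target (1 : N)).measurableSet
    ((continuousOn_extChartAt_symm (1 : N)).domRestrict.measurable hS)

theorem aemeasurable_extChartAt_symm (ν : Measure F) :
    AEMeasurable (extChartAt J (1 : N)).symm (ν.restrict (extChartAt J (1 : N)).target) :=
  (continuousOn_extChartAt_symm (1 : N)).aemeasurable
    (isOpen_extChartAt_target (1 : N)).measurableSet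

theorem aemeasurable_chartDensity (ν : Measure F) :
    AEMeasurable (chartDensity J N) (ν.restrict (extChartAt J (1 : N)).target) :=
  (ENNReal.continuous_ofReal.comp_continuousOn (continuous_abs.comp_continuousOn
    (ContinuousLinearMap.continuous_det.comp_continuousOn continuousOn_chartDer))).aemeasurable
    (isOpen_extChartAt_target (1 : N)).measurableSet

/-- A left invariant measure on the domain of the chart at `1`. -/
def localHaar (J : ModelWithCorners ℝ F HF) (N : Type*) [TopologicalSpace N]
    [ChartedSpace HF N] [Group N] [MeasurableSpace N] (ν : Measure F) : Measure N :=
  ((ν.restrict (extChartAt J (1 : N)).target).withDensity (chartDensity J N)).map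
    (extChartAt J (1 : N)).symm

theorem setLIntegral_localHaar (ν : Measure F) [SFinite ν] {S : Set N} (hS : MeasurableSet S)
    (hsub : S ⊆ (extChartAt J (1 : N)).source) {f : N → ENNReal} (hf : Measurable f) :
    ∫⁻ x in S, f x ∂(localHaar J N ν) = ∫⁻ y in extChartAt J (1 : N) '' S,
      chartDensity J N y * f ((extChartAt J (1 : N)).symm y) ∂ν := by
  have hT := (isOpen_extChartAt_target (I := J) (1 : N)).measurableSet
  have hsub' : extChartAt J (1 : N) '' S ⊆ (extChartAt J (1 : N)).target := by
    rintro _ ⟨x, hx, rfl⟩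
    exact (extChartAt J (1 : N)).map_source (hsub hx)
  have hm := aemeasurable_extChartAt_symm (J := J) (N := N) ν
  have hm' := hm.mono_ac (withDensity_absolutelyContinuous _ (chartDensity J N))
  rw [localHaar, Measure.restrict_map_of_aemeasurable hm' hS,
    lintegral_map' hf.aemeasurable (hm'.mono_measure Measure.restrict_le_self),
    restrict_withDensity', Measure.restrict_restrict' hT, Set.inter_comm,
    ← (extChartAt J (1 : N)).image_eq_target_inter_inv_preimage hsub,
    lintegral_withDensity_eq_lintegral_mul₀']
  · rfl
  · exact (aemeasurable_chartDensity ν).mono_measure (Measure.restrict_mono hsub' le_rfl)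
  · exact hf.comp_aemeasurable ((hm.mono_measure (Measure.restrict_mono hsub' le_rfl)).mono_ac
      (withDensity_absolutelyContinuous _ _))

/-- This is the Euclidean change of variables for φ read in the chart. The densities at the two ends
turn the Jacobian in the chart into that of the left-trivialized derivative L. -/
theorem localHaar_image (ν : Measure F) [ν.IsAddHaarMeasure] {S : Set N} (hS : MeasurableSet S)
    (hsub : S ⊆ (extChartAt J (1 : N)).source) {φ : N → N} (hφS : MeasurableSet (φ '' S))
    (hφ : φ '' S ⊆ (extChartAt J (1 : N)).source) (hinj : Set.InjOn φ S) {L : N → F →L[ℝ] F}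
    (hL : ∀ x ∈ S, HasDerAt J J (fun γ => (φ x)⁻¹ * φ (x * γ)) 1 (L x))
    (hLm : Measurable fun x => |(L x).det|) :
    localHaar J N ν (φ '' S) = ∫⁻ x in S, ENNReal.ofReal |(L x).det| ∂(localHaar J N ν) := by
  set ψ := extChartAt J (1 : N) with hψ
  -- M is K ∘ L x ∘ `chartDer` at ψ x, where K is a right inverse of `chartDer` at ψ(φ x); taking
  -- determinants gives the identity of densities.
  have key : ∀ x ∈ S, ∃ M : F →L[ℝ] F, HasFDerivAt (fun z => ψ (φ (ψ.symm z))) M (ψ x) ∧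
      ENNReal.ofReal |M.det| * chartDensity J N (ψ (φ x)) =
        chartDensity J N (ψ x) * ENNReal.ofReal |(L x).det| := by
    intro x hx
    obtain ⟨K, hK, hK'⟩ := exists_hasDerAt_extChartAt_mul (hφ ⟨x, hx, rfl⟩)
    have h1 := hasDerAt_chartDer (ψ.map_source (hsub hx))
    rw [← hψ, ψ.left_inv (hsub hx)] at h1
    have h2 := hK.comp ((hL x hx).comp h1 (by rw [ψ.left_inv (hsub hx), inv_mul_cancel]))
      (by rw [ψ.left_inv (hsub hx), inv_mul_cancel, mul_one, inv_mul_cancel])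
    simp only [mul_inv_cancel_left] at h2
    refine ⟨_, HasMFDerivAt.hasFDerivAt h2, ?_⟩
    have h3 := congrArg ContinuousLinearMap.det hK'
    have hid : (ContinuousLinearMap.id ℝ F).det = 1 := LinearMap.det_id
    rw [ContinuousLinearMap.det_comp', hid] at h3
    rw [chartDensity, chartDensity, ← ENNReal.ofReal_mul (abs_nonneg _),
      ← ENNReal.ofReal_mul (abs_nonneg _), ← abs_mul, ← abs_mul, ContinuousLinearMap.det_comp',
      ContinuousLinearMap.det_comp']
    congr 2
    linear_combination ((L x).det * (chartDer J N (ψ x)).det) * h3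
  choose! M hM hM' using key
  have e1 : localHaar J N ν (φ '' S) = ∫⁻ y in ψ '' (φ '' S), chartDensity J N y ∂ν := by
    have := setLIntegral_localHaar (J := J) ν hφS hφ (f := fun _ => 1) measurable_const
    simpa only [lintegral_one, mul_one, Measure.restrict_apply_univ] using this
  have e2 : ψ '' (φ '' S) = (fun z => ψ (φ (ψ.symm z))) '' (ψ '' S) := by
    rw [Set.image_image, Set.image_image]
    refine Set.image_congr fun x hx => ?_
    rw [ψ.left_inv (hsub hx)]
  have hinv : ∀ y ∈ ψ '' S, ψ.symm y ∈ S ∧ ψ (ψ.symm y) = y := by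
    rintro _ ⟨x, hx, rfl⟩
    rw [ψ.left_inv (hsub hx)]
    exact ⟨hx, rfl⟩
  have hmeas := measurableSet_image_extChartAt (J := J) hS hsub
  rw [e1, e2, lintegral_image_eq_lintegral_abs_det_fderiv_mul ν hmeas
    (f' := fun y => M (ψ.symm y)), setLIntegral_localHaar ν hS hsub hLm.ennreal_ofReal]
  · refine setLIntegral_congr_fun hmeas fun y hy => ?_
    obtain ⟨h1, h2⟩ := hinv y hy
    have := hM' _ h1
    rw [h2] at this
    exact this
  · intro y hy
    obtain ⟨h1, h2⟩ := hinv y hy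
    have := hM _ h1
    rw [h2] at this
    exact this.hasFDerivWithinAt
  · intro y hy z hz hyz
    obtain ⟨h1, h2⟩ := hinv y hy
    obtain ⟨h3, h4⟩ := hinv z hz
    have := hinj h1 h3 (ψ.injOn (hφ ⟨_, h1, rfl⟩) (hφ ⟨_, h3, rfl⟩) hyz)
    rw [← h2, ← h4, this]

end LocalHaar

end

/-! ### Local uniqueness of Haar measure and the change of variables formula. -/

noncomputable section

section HaarChange

open scoped Manifold ContDiff Topology

variable {F : Type*} [NormedAddCommGroup F] [NormedSpace ℝ F] [FiniteDimensional ℝ F]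
  {HF : Type*} [TopologicalSpace HF] {J : ModelWithCorners ℝ F HF} [J.Boundaryless]
  {N : Type*} [TopologicalSpace N] [ChartedSpace HF N] [Group N] [LieGroup J ∞ N]
  [MeasurableSpace F] [BorelSpace F] [MeasurableSpace N] [BorelSpace N]

/-- The left-trivialized derivative of a left translation is the identity. -/
theorem localHaar_mul_left (ν : Measure F) [ν.IsAddHaarMeasure] {S : Set N} (hS : MeasurableSet S)
    (hsub : S ⊆ (extChartAt J (1 : N)).source) (g : N)
    (hg : (fun x => g * x) '' S ⊆ (extChartAt J (1 : N)).source) :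
    localHaar J N ν ((fun x => g * x) '' S) = localHaar J N ν S := by
  have := topologicalGroup_of_lieGroup J ∞ (G := N)
  have hm : MeasurableSet ((fun x => g * x) '' S) :=
    (Homeomorph.mulLeft g).measurableEmbedding.measurableSet_image' hS
  rw [localHaar_image ν hS hsub hm hg (mul_right_injective g).injOn (L := fun _ => ContinuousLinearMap.id ℝ F)]
  · have hid : (ContinuousLinearMap.id ℝ F).det = 1 := LinearMap.det_id
    simp only [hid, abs_one, ENNReal.ofReal_one, lintegral_one, Measure.restrict_apply_univ]
  · intro x _
    simp only [mul_inv_rev, mul_assoc, inv_mul_cancel_left]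
    exact hasDerAt_id 1
  · exact measurable_const

theorem exists_localHaar_pos_lt_top [T2Space N] (ν : Measure F) [ν.IsAddHaarMeasure] :
    ∃ U : Set N, IsOpen U ∧ 1 ∈ U ∧ U ⊆ (extChartAt J (1 : N)).source ∧
      (∃ K, IsCompact K ∧ U ⊆ K) ∧ localHaar J N ν U ≠ 0 ∧ localHaar J N ν U ≠ ⊤ := by
  have := Manifold.locallyCompact_of_finiteDimensional J (M := N)
  obtain ⟨K, hK, h1K, hKs⟩ := exists_compact_subset (isOpen_extChartAt_source (I := J) (1 : N))
    (mem_extChartAt_source (1 : N))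
  have hsub : interior K ⊆ (extChartAt J (1 : N)).source := interior_subset.trans hKs
  have hlin : localHaar J N ν (interior K) =
      ∫⁻ y in extChartAt J (1 : N) '' interior K, chartDensity J N y ∂ν := by
    have := setLIntegral_localHaar (J := J) ν isOpen_interior.measurableSet hsub
      (f := fun _ => 1) measurable_const
    simpa only [lintegral_one, mul_one, Measure.restrict_apply_univ] using this
  have himg : extChartAt J (1 : N) '' K ⊆ (extChartAt J (1 : N)).target := by
    rintro _ ⟨x, hx, rfl⟩
    exact (extChartAt J (1 : N)).map_source (hKs hx)
  have himg' := (Set.image_mono (f := extChartAt J (1 : N)) interior_subset).trans himg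
  have hKc : IsCompact (extChartAt J (1 : N) '' K) :=
    hK.image_of_continuousOn ((continuousOn_extChartAt (1 : N)).mono hKs)
  have hopen : IsOpen (extChartAt J (1 : N) '' interior K) := by
    rw [(extChartAt J (1 : N)).image_eq_target_inter_inv_preimage hsub]
    exact (continuousOn_extChartAt_symm (1 : N)).isOpen_inter_preimage
      (isOpen_extChartAt_target (1 : N)) isOpen_interior
  refine ⟨interior K, isOpen_interior, h1K, hsub, ⟨K, hK, interior_subset⟩, ?_, ?_⟩
  · intro h
    rw [hlin, lintegral_eq_zero_iff'
      ((aemeasurable_chartDensity ν).mono_measure (Measure.restrict_mono himg' le_rfl)),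
      Filter.EventuallyEq, ae_restrict_iff' hopen.measurableSet] at h
    refine (hopen.measure_pos ν ⟨_, 1, h1K, rfl⟩).ne' (measure_eq_zero_iff_ae_notMem.2 ?_)
    filter_upwards [h] with y hy hyK
    have h2 := hy hyK
    rw [chartDensity, Pi.zero_apply, ENNReal.ofReal_eq_zero] at h2
    exact (abs_pos.2 (det_chartDer_ne_zero (himg' hyK))).not_ge h2
  · rw [hlin]
    obtain ⟨C, hC⟩ := hKc.exists_bound_of_continuousOn (f := fun y => (chartDer J N y).det)
      (ContinuousLinearMap.continuous_det.comp_continuousOn (continuousOn_chartDer.mono himg))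
    refine ne_top_of_le_ne_top (b := ENNReal.ofReal C * ν (extChartAt J (1 : N) '' interior K))
      (ENNReal.mul_ne_top ENNReal.ofReal_ne_top (ne_top_of_le_ne_top hKc.measure_ne_top
        (measure_mono (Set.image_mono interior_subset)))) ?_
    rw [← setLIntegral_const]
    refine setLIntegral_mono' hopen.measurableSet fun y hy => ?_
    exact ENNReal.ofReal_le_ofReal (hC y (Set.image_mono interior_subset hy))

/-- Right translates of a left Haar measure are left invariant, so uniqueness applies. Only the
existence of the factor matters for the Fubini argument that uses it. -/
theorem map_mul_right_apply_eq (μ : Measure N) [μ.IsHaarMeasure] [T2Space N]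
    [SecondCountableTopology N] [IsTopologicalGroup N] [LocallyCompactSpace N] (x : N) :
    ∃ c : ENNReal, ∀ E : Set N, μ.map (fun g => g * x) E = c * μ E := by
  have h := Measure.isMulLeftInvariant_eq_smul (μ.map (fun g => g * x)) μ
  refine ⟨(μ.map (fun g => g * x)).haarScalarFactor μ, fun E => ?_⟩
  conv_lhs => rw [h, Measure.smul_apply]
  rfl

/-- The chart measure is left invariant only as long as sets stay in the chart, so global uniqueness
does not apply directly. Evaluating the double integral of 1_E(gx), with x in U, in two orders shows
that the two measures are proportional on subsets of U. -/
theorem exists_restrict_eq_smul_localHaar [T2Space N] [SecondCountableTopology N]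
    (μ : Measure N) [μ.IsHaarMeasure] (ν : Measure F) [ν.IsAddHaarMeasure] :
    ∃ U : Set N, IsOpen U ∧ 1 ∈ U ∧ U ⊆ (extChartAt J (1 : N)).source ∧ ∃ c : ENNReal,
      c ≠ ⊤ ∧ μ.restrict U = c • (localHaar J N ν).restrict U := by
  have := topologicalGroup_of_lieGroup J ∞ (G := N)
  have := Manifold.locallyCompact_of_finiteDimensional J (M := N)
  obtain ⟨U, hU, h1, hUs, ⟨K, hK, hUK⟩, hne0, hneT⟩ := exists_localHaar_pos_lt_top (J := J) (N := N) ν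
  set m := (localHaar J N ν).restrict U with hm
  have : IsFiniteMeasure m := ⟨by rw [hm, Measure.restrict_apply_univ]; exact hneT.lt_top⟩
  have hμU : μ U ≠ ⊤ := ne_top_of_le_ne_top hK.measure_ne_top (measure_mono hUK)
  have hμU' : μ U⁻¹ ≠ ⊤ := ne_top_of_le_ne_top hK.inv.measure_ne_top
    (measure_mono (Set.inv_subset_inv.2 hUK))
  have hμ0 : μ U ≠ 0 := (hU.measure_pos μ ⟨1, h1⟩).ne'
  have hμ0' : μ U⁻¹ ≠ 0 := (hU.inv.measure_pos μ ⟨1, by simpa using h1⟩).ne'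
  choose c hc using fun x : N => map_mul_right_apply_eq μ x
  have key : ∀ E : Set N, MeasurableSet E → E ⊆ U → μ U⁻¹ * m E = (∫⁻ x, c x ∂m) * μ E := by
    intro E hE hEU
    have hμE : μ E ≠ ⊤ := ne_top_of_le_ne_top hμU (measure_mono hEU)
    have s1 : ∀ g x : N, E.indicator (fun _ => (1 : ENNReal)) (g * x) =
      ((fun x => g * x) ⁻¹' E).indicator (fun _ => 1) x := fun g x => rfl
    have s2 : ∀ g x : N, E.indicator (fun _ => (1 : ENNReal)) (g * x) =
      ((fun g => g * x) ⁻¹' E).indicator (fun _ => 1) g := fun g x => rfl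
    -- Integrating over g with x fixed, right translation by x rescales μ by c x.
    have e1 : ∫⁻ g, ∫⁻ x, E.indicator (fun _ => 1) (g * x) ∂m ∂μ = (∫⁻ x, c x ∂m) * μ E := by
      rw [lintegral_lintegral_swap, ← lintegral_mul_const' _ _ hμE]
      · refine lintegral_congr fun x => ?_
        simp only [s2]
        rw [lintegral_indicator_const ((measurable_mul_const x) hE), one_mul, ← hc x E,
          Measure.map_apply (measurable_mul_const x) hE]
      · exact ((measurable_const.indicator hE).comp
          (measurable_fst.mul measurable_snd)).aemeasurable
    -- This substitutes g⁻¹x for x; the set involved and its translate both lie in the chart domain,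
    -- where `localHaar_mul_left` is available.
    have e2 : ∀ g : N, ∫⁻ x, E.indicator (fun _ => 1) (g * x) ∂m =
        ∫⁻ x, E.indicator (fun _ => 1) x * U.indicator (fun _ => 1) (g⁻¹ * x) ∂m := by
      intro g
      have hgU : MeasurableSet ((fun x => g⁻¹ * x) ⁻¹' U) := (measurable_const_mul g⁻¹) hU.measurableSet
      have t1 : ∀ x : N, E.indicator (fun _ => (1 : ENNReal)) x * U.indicator (fun _ => 1) (g⁻¹ * x)
          = (E ∩ (fun x => g⁻¹ * x) ⁻¹' U).indicator (fun _ => 1) x := by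
        intro x
        by_cases h1 : x ∈ E <;> by_cases h2 : g⁻¹ * x ∈ U <;> simp [Set.indicator, h1, h2]
      simp only [s1, t1]
      have t2 : (fun x => g * x) '' ((fun x => g * x) ⁻¹' E ∩ U) = E ∩ (fun x => g⁻¹ * x) ⁻¹' U := by
        ext y
        constructor
        · rintro ⟨x, ⟨h1, h2⟩, rfl⟩
          refine ⟨h1, ?_⟩
          change g⁻¹ * (g * x) ∈ U
          rwa [inv_mul_cancel_left]
        · rintro ⟨h1, h2⟩
          refine ⟨g⁻¹ * y, ⟨?_, h2⟩, mul_inv_cancel_left g y⟩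
          change g * (g⁻¹ * y) ∈ E
          rwa [mul_inv_cancel_left]
      rw [lintegral_indicator_const ((measurable_const_mul g) hE),
        lintegral_indicator_const (hE.inter hgU), hm,
        Measure.restrict_apply ((measurable_const_mul g) hE), Measure.restrict_apply (hE.inter hgU),
        Set.inter_eq_self_of_subset_left (Set.inter_subset_left.trans hEU), ← t2,
        localHaar_mul_left ν (((measurable_const_mul g) hE).inter hU.measurableSet)
          (Set.inter_subset_right.trans hUs)]
      rw [t2]
      exact Set.inter_subset_left.trans (hEU.trans hUs)
    rw [← e1, lintegral_congr e2, lintegral_lintegral_swap]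
    -- The set of g with g⁻¹x in U is xU⁻¹, whose μ-measure is independent of x.
    · have t3 : ∀ x : N, ∫⁻ g, E.indicator (fun _ => 1) x * U.indicator (fun _ => 1) (g⁻¹ * x) ∂μ =
          E.indicator (fun _ => μ U⁻¹) x := by
        intro x
        rw [lintegral_const_mul' _ _ (by by_cases h : x ∈ E <;> simp [h])]
        have t4 : ∀ g : N, U.indicator (fun _ => (1 : ENNReal)) (g⁻¹ * x) =
            ((fun g => x⁻¹ * g) ⁻¹' U⁻¹).indicator (fun _ => 1) g := by
          intro g
          have : g⁻¹ * x ∈ U ↔ x⁻¹ * g ∈ U⁻¹ := by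
            rw [Set.mem_inv, mul_inv_rev, inv_inv]
          simp only [Set.indicator]
          by_cases h : g⁻¹ * x ∈ U
          · rw [if_pos h]
            exact (if_pos (this.1 h)).symm
          · rw [if_neg h]
            exact (if_neg fun h' => h (this.2 h')).symm
        simp only [t4]
        rw [lintegral_indicator_const ((measurable_const_mul x⁻¹) hU.inv.measurableSet), one_mul,
          measure_preimage_mul]
        by_cases h : x ∈ E <;> simp [h]
      simp only [t3]
      rw [lintegral_indicator_const hE]
    · exact (((measurable_const.indicator hE).comp measurable_snd).mul
        ((measurable_const.indicator hU.measurableSet).comp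
          (measurable_fst.inv.mul measurable_snd))).aemeasurable
  have hmU : m U = localHaar J N ν U := by rw [hm, Measure.restrict_apply_self]
  -- Taking E = U shows that the proportionality constant is neither 0 nor infinite.
  have kU := key U hU.measurableSet subset_rfl
  rw [hmU] at kU
  have hC0 : (∫⁻ x, c x ∂m) ≠ 0 := by
    intro h
    rw [h, zero_mul] at kU
    exact mul_ne_zero hμ0' hne0 kU
  have hCT : (∫⁻ x, c x ∂m) ≠ ⊤ := by
    intro h
    rw [h, ENNReal.top_mul hμ0] at kU
    exact ENNReal.mul_ne_top hμU' hneT kU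
  refine ⟨U, hU, h1, hUs, (∫⁻ x, c x ∂m)⁻¹ * μ U⁻¹, ENNReal.mul_ne_top (ENNReal.inv_ne_top.2 hC0)
    hμU', Measure.ext fun E hE => ?_⟩
  have k := key (E ∩ U) (hE.inter hU.measurableSet) Set.inter_subset_right
  rw [Measure.restrict_apply hE, Measure.smul_apply, smul_eq_mul, mul_assoc, Measure.restrict_apply hE]
  rw [hm, Measure.restrict_apply (hE.inter hU.measurableSet), Set.inter_assoc, Set.inter_self] at k
  rw [k, ← mul_assoc, ENNReal.inv_mul_cancel hC0 hCT, one_mul]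

/-- The change of variables formula for a left Haar measure. -/
theorem map_symm_eq_withDensity [T2Space N] [SecondCountableTopology N]
    (μ : Measure N) [μ.IsHaarMeasure] (φ : N ≃ₜ N) {L : N → F →L[ℝ] F}
    (hL : ∀ x, HasDerAt J J (fun γ => (φ x)⁻¹ * φ (x * γ)) 1 (L x))
    (hLm : Measurable fun x => |(L x).det|) :
    μ.map φ.symm = μ.withDensity fun x => ENNReal.ofReal |(L x).det| := by
  have := topologicalGroup_of_lieGroup J ∞ (G := N)
  obtain ⟨U, hU, h1, hUs, c, hc, hUc⟩ := exists_restrict_eq_smul_localHaar (J := J) μ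
    (Measure.addHaar : Measure F)
  -- On this neighbourhood of x, left translation by x⁻¹ moves points into U and left translation by
  -- φ(x)⁻¹ moves their images into U. Countably many such sets cover N, so equality may be checked
  -- on each.
  have hW : ∀ x : N, IsOpen ((fun y => x⁻¹ * y) ⁻¹' U ∩ (fun y => (φ x)⁻¹ * φ y) ⁻¹' U) := fun x =>
    (hU.preimage (continuous_const_mul x⁻¹)).inter
      (hU.preimage ((continuous_const_mul _).comp φ.continuous))
  obtain ⟨s, hs, hsU⟩ := TopologicalSpace.countable_cover_nhds (f := fun x =>
      (fun y => x⁻¹ * y) ⁻¹' U ∩ (fun y => (φ x)⁻¹ * φ y) ⁻¹' U) (fun x => (hW x).mem_nhds (by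
        constructor
        · change x⁻¹ * x ∈ U
          rwa [inv_mul_cancel]
        · change (φ x)⁻¹ * φ x ∈ U
          rwa [inv_mul_cancel]))
  rw [Measure.ext_iff_of_biUnion_eq_univ hs hsU]
  intro x _
  ext E hE
  rw [Measure.restrict_apply hE, Measure.restrict_apply hE]
  have hES := hE.inter (hW x).measurableSet
  set S := E ∩ ((fun y => x⁻¹ * y) ⁻¹' U ∩ (fun y => (φ x)⁻¹ * φ y) ⁻¹' U) with hSdef
  rw [Measure.map_apply φ.symm.continuous.measurable hES, withDensity_apply _ hES]
  -- ξ is φ recentred to fix 1. It maps T ⊆ U into U, where μ is a multiple of the chart measure and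
  -- `localHaar_image` applies; left invariance of μ undoes the recentring.
  set ξ : N ≃ₜ N := ((Homeomorph.mulLeft x).trans φ).trans (Homeomorph.mulLeft (φ x)⁻¹) with hξ
  have hξa : ∀ y, ξ y = (φ x)⁻¹ * φ (x * y) := fun y => rfl
  set T : Set N := (fun y => x * y) ⁻¹' S with hT
  have hTm : MeasurableSet T := (measurable_const_mul x) hES
  have hTU : T ⊆ U := by
    intro y hy
    have : x⁻¹ * (x * y) ∈ U := hy.2.1
    rwa [inv_mul_cancel_left] at this
  have hTU' : ξ '' T ⊆ U := by
    rintro _ ⟨y, hy, rfl⟩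
    exact hy.2.2
  have hξT : MeasurableSet (ξ '' T) := ξ.measurableEmbedding.measurableSet_image' hTm
  have f1 : φ.symm ⁻¹' S = (fun y => (φ x)⁻¹ * y) ⁻¹' (ξ '' T) := by
    ext y
    constructor
    · intro hy
      refine ⟨x⁻¹ * φ.symm y, ?_, ?_⟩
      · change x * (x⁻¹ * φ.symm y) ∈ S
        rwa [mul_inv_cancel_left]
      · rw [hξa, mul_inv_cancel_left, φ.apply_symm_apply]
    · rintro ⟨z, hz, h⟩
      rw [hξa] at h
      have : φ.symm y = x * z := by
        rw [← mul_left_cancel h, φ.symm_apply_apply]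
      change φ.symm y ∈ S
      rw [this]
      exact hz
  have f2 : ∀ {V : Set N}, MeasurableSet V → V ⊆ U → μ V = c * localHaar J N Measure.addHaar V := by
    intro V hV hVU
    rw [← Measure.restrict_eq_self μ hVU, hUc, Measure.smul_apply, Measure.restrict_eq_self _ hVU,
      smul_eq_mul]
  have f3 : μ.restrict T = c • (localHaar J N Measure.addHaar).restrict T := by
    rw [← Measure.restrict_restrict_of_subset hTU, hUc, Measure.restrict_smul,
      Measure.restrict_restrict_of_subset hTU]
  have hLm' : Measurable fun y => |(L (x * y)).det| := hLm.comp (measurable_const_mul x)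
  rw [f1, measure_preimage_mul, f2 hξT hTU', localHaar_image (J := J) Measure.addHaar hTm
    (hTU.trans hUs) hξT (hTU'.trans hUs) ξ.injective.injOn (L := fun y => L (x * y)) _ hLm']
  · have f4 : ∫⁻ y in T, ENNReal.ofReal |(L (x * y)).det| ∂μ =
        c * ∫⁻ y in T, ENNReal.ofReal |(L (x * y)).det| ∂(localHaar J N Measure.addHaar) := by
      rw [f3, lintegral_smul_measure, smul_eq_mul]
    rw [← f4]
    have hmp := measurePreserving_mul_left μ x
    exact hmp.setLIntegral_comp_preimage hES hLm.ennreal_ofReal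
  · intro y _
    have : (fun γ => (ξ y)⁻¹ * ξ (y * γ)) = fun γ => (φ (x * y))⁻¹ * φ (x * y * γ) := by
      funext γ
      simp only [hξa, mul_inv_rev, inv_inv, mul_assoc, mul_inv_cancel_left]
    rw [this]
    exact hL (x * y)

theorem integral_abs_det_smul_comp [T2Space N] [SecondCountableTopology N]
    (μ : Measure N) [μ.IsHaarMeasure] (φ : N ≃ₜ N) {L : N → F →L[ℝ] F}
    (hL : ∀ x, HasDerAt J J (fun γ => (φ x)⁻¹ * φ (x * γ)) 1 (L x))
    (hLm : Measurable fun x => |(L x).det|) (f : N → ℂ) :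
    ∫ x, ((|(L x).det| : ℝ) : ℂ) * f (φ x) ∂μ = ∫ x, f x ∂μ := by
  have h := integral_withDensity_eq_integral_smul (μ := μ) (f := fun x => Real.toNNReal |(L x).det|)
    hLm.real_toNNReal (fun x => f (φ x))
  have h' : (μ.withDensity fun x => ((Real.toNNReal |(L x).det| : NNReal) : ENNReal)) =
    μ.map φ.symm := (map_symm_eq_withDensity μ φ hL hLm).symm
  rw [h', φ.symm.measurableEmbedding.integral_map] at h
  simp only [φ.apply_symm_apply] at h
  rw [h]
  refine integral_congr_ae (Filter.Eventually.of_forall fun x => ?_)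
  simp only [NNReal.smul_def, Real.coe_toNNReal _ (abs_nonneg _), Complex.real_smul]

end HaarChange

end

/-! ### Integral formulas on B: right translation, inversion, and the action of A. -/

noncomputable section

section HaarFormulas

open scoped Manifold ContDiff Topology

variable {F : Type*} [NormedAddCommGroup F] [NormedSpace ℝ F] [FiniteDimensional ℝ F]
  {HF : Type*} [TopologicalSpace HF] {J : ModelWithCorners ℝ F HF} [J.Boundaryless]
  {N : Type*} [TopologicalSpace N] [ChartedSpace HF N] [Group N] [LieGroup J ∞ N]
  [T2Space N] [SecondCountableTopology N] [MeasurableSpace N] [BorelSpace N]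
  (μ : Measure N) [μ.IsHaarMeasure]

variable (J) in
-- Right translation by c has left-trivialized derivative Ad(c⁻¹), constant in x.
theorem integral_mul_right_eq_adDet_mul (c : N) (f : N → ℂ) :
    ∫ x, f (x * c) ∂μ = (adDet J c : ℂ) * ∫ x, f x ∂μ := by
  have := topologicalGroup_of_lieGroup J ∞ (G := N)
  let _ : MeasurableSpace F := borel F
  have : BorelSpace F := ⟨rfl⟩
  have h := integral_abs_det_smul_comp (J := J) μ (Homeomorph.mulRight c)
    (L := fun _ => DoubleLieGroup.Ad J c⁻¹) (fun x => by
      have e : (fun γ => (Homeomorph.mulRight c x)⁻¹ * Homeomorph.mulRight c (x * γ)) =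
          fun γ => c⁻¹ * γ * (c⁻¹)⁻¹ := by
        funext γ
        simp [mul_assoc]
      rw [e]
      exact hasDerAt_conj c⁻¹) measurable_const f
  simp only [Homeomorph.coe_mulRight] at h
  rw [integral_const_mul] at h
  change (adDet J c⁻¹ : ℂ) * _ = _ at h
  rw [adDet_inv] at h
  rw [← h, ← mul_assoc, ← Complex.ofReal_mul, mul_inv_cancel₀ (adDet_pos c).ne', Complex.ofReal_one,
    one_mul]

variable (J) in
-- For inversion the left-trivialized map is γ ↦ xγ⁻¹x⁻¹, with derivative -Ad(x).
theorem integral_adDet_mul_comp_inv (f : N → ℂ) :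
    ∫ x, (adDet J x : ℂ) * f x⁻¹ ∂μ = ∫ x, f x ∂μ := by
  have := topologicalGroup_of_lieGroup J ∞ (G := N)
  let _ : MeasurableSpace F := borel F
  have : BorelSpace F := ⟨rfl⟩
  have hdet : ∀ x : N, |((DoubleLieGroup.Ad J x).comp (-ContinuousLinearMap.id ℝ F)).det| =
      adDet J x := by
    intro x
    have h1 : (-ContinuousLinearMap.id ℝ F).det = (-1) ^ Module.finrank ℝ F := by
      have : (-ContinuousLinearMap.id ℝ F).det = LinearMap.det (-LinearMap.id : F →ₗ[ℝ] F) := rfl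
      rw [this, ← neg_one_smul ℝ (LinearMap.id : F →ₗ[ℝ] F), LinearMap.det_smul, LinearMap.det_id,
        mul_one]
    rw [ContinuousLinearMap.det_comp', h1, abs_mul, abs_neg_one_pow, mul_one]
    rfl
  have h := integral_abs_det_smul_comp (J := J) μ (Homeomorph.inv N)
    (L := fun x => (DoubleLieGroup.Ad J x).comp (-ContinuousLinearMap.id ℝ F)) (fun x => by
      have e : (fun γ => (Homeomorph.inv N x)⁻¹ * Homeomorph.inv N (x * γ)) =
          fun γ => x * γ⁻¹ * x⁻¹ := by
        funext γ
        simp [mul_assoc]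
      rw [e]
      exact hasDerAt_inv_one.conj x inv_one) (by
        simp only [hdet]
        exact contMDiff_adDet.continuous.measurable) f
  simp only [hdet] at h
  exact h

end HaarFormulas

namespace DoubleLieGroup

section Weights

open scoped Manifold ContDiff Topology

variable {E : Type*} [NormedAddCommGroup E] [NormedSpace ℝ E] [FiniteDimensional ℝ E]
  {H : Type*} [TopologicalSpace H] {I : ModelWithCorners ℝ E H} [I.Boundaryless]
  {G : Type*} [TopologicalSpace G] [ChartedSpace H G] [Group G] [LieGroup I ∞ G]
  [T2Space G] [SecondCountableTopology G]
  {EA : Type*} [NormedAddCommGroup EA] [NormedSpace ℝ EA] [FiniteDimensional ℝ EA]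
  {HA : Type*} [TopologicalSpace HA] {IA : ModelWithCorners ℝ EA HA} [IA.Boundaryless]
  {A : Type*} [TopologicalSpace A] [ChartedSpace HA A] [Group A] [LieGroup IA ∞ A]
  {EB : Type*} [NormedAddCommGroup EB] [NormedSpace ℝ EB] [FiniteDimensional ℝ EB]
  {HB : Type*} [TopologicalSpace HB] {IB : ModelWithCorners ℝ EB HB} [IB.Boundaryless]
  {B : Type*} [TopologicalSpace B] [ChartedSpace HB B] [Group B] [LieGroup IB ∞ B]
variable (D : DoubleLieGroup I G IA A IB B)

/-- The square root of `weight`. -/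
def rootWeight (D : DoubleLieGroup I G IA A IB B) (a : A) : ℝ := √(D.weight a)

theorem rootWeight_pos (a : A) : 0 < D.rootWeight a := Real.sqrt_pos.2 (D.weight_pos a)

theorem rootWeight_sq (a : A) : D.rootWeight a * D.rootWeight a = D.weight a :=
  Real.mul_self_sqrt (D.weight_pos a).le

theorem rootWeight_one : D.rootWeight 1 = 1 := by rw [rootWeight, weight_one, Real.sqrt_one]

theorem rootWeight_inv (a : A) : D.rootWeight a⁻¹ = (D.rootWeight a)⁻¹ := by
  rw [rootWeight, weight_inv, Real.sqrt_inv, rootWeight]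

theorem contMDiff_rootWeight : ContMDiff IA 𝓘(ℝ, ℝ) ∞ D.rootWeight := fun a =>
  (Real.contDiffAt_sqrt (D.weight_pos a).ne').contMDiffAt.comp a (D.contMDiff_weight a)

/-- The square root of the modulus `|det Ad(b)|`. -/
def rootMod (_ : DoubleLieGroup I G IA A IB B) (b : B) : ℝ := √(adDet IB b)

theorem rootMod_pos (b : B) : 0 < D.rootMod b := Real.sqrt_pos.2 (adDet_pos b)

theorem rootMod_sq (b : B) : D.rootMod b * D.rootMod b = adDet IB b :=
  Real.mul_self_sqrt (adDet_pos b).le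

theorem rootMod_mul (b c : B) : D.rootMod (b * c) = D.rootMod b * D.rootMod c := by
  rw [rootMod, adDet_mul, Real.sqrt_mul (adDet_pos b).le, rootMod, rootMod]

theorem rootMod_inv (b : B) : D.rootMod b⁻¹ = (D.rootMod b)⁻¹ := by
  rw [rootMod, adDet_inv, Real.sqrt_inv, rootMod]

theorem contMDiff_rootMod : ContMDiff IB 𝓘(ℝ, ℝ) ∞ D.rootMod := fun b =>
  (Real.contDiffAt_sqrt (adDet_pos b).ne').contMDiffAt.comp b (contMDiff_adDet b)

theorem rpow_neg_half {t : ℝ} (ht : 0 ≤ t) : t ^ (-(1 / 2) : ℝ) = (√t)⁻¹ := by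
  rw [Real.rpow_neg ht, Real.sqrt_eq_rpow]

theorem rpow_abs_jac_id {x y : G} (h : D.aR x = D.aL y) :
    |jac D D (fun x y => x = y) x y| ^ (-(1 / 2) : ℝ) = (D.rootWeight (D.aL y))⁻¹ := by
  rw [jac_id D h, abs_det_derNu, rpow_neg_half (D.weight_pos _).le, rootWeight]

theorem rpow_abs_jac_δ {x : G} {y : G × G} (h : D.aR x = D.aL y.1 * D.aL y.2) :
    |jac D D.square D.δ x y| ^ (-(1 / 2) : ℝ) = (D.rootWeight (D.aL y.1) *
      D.rootWeight (D.aL y.2) * D.rootMod (D.bR (D.ιB (D.bL x) * D.ιA (D.aL y.1))))⁻¹ := by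
  rw [jac_δ D h, abs_det_derNu, abs_det_derNu, rpow_neg_half (mul_nonneg (mul_nonneg
    (D.weight_pos _).le (D.weight_pos _).le) (adDet_pos _).le), Real.sqrt_mul (mul_nonneg
    (D.weight_pos _).le (D.weight_pos _).le), Real.sqrt_mul (D.weight_pos _).le]
  rfl

/-- This is the scalar in the coinverse: its exponent i·(i/2) is -1/2, and passing to g⁻¹
interchanges left and right factors. -/
theorem rpow_abs_Q_inv (g : G) : |D.Q g⁻¹| ^ (-(1 / 2) : ℝ) =
    D.rootWeight (D.aR g) * D.rootMod (D.bR g) / (D.rootWeight (D.aL g) * D.rootMod (D.bL g)) := by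
  rw [abs_Q, rpow_neg_half (div_nonneg (mul_nonneg (D.weight_pos _).le (adDet_pos _).le)
    (mul_nonneg (D.weight_pos _).le (adDet_pos _).le)), Real.sqrt_div (mul_nonneg
    (D.weight_pos _).le (adDet_pos _).le), Real.sqrt_mul (D.weight_pos _).le,
    Real.sqrt_mul (D.weight_pos _).le]
  change (D.rootWeight _ * D.rootMod _ / (D.rootWeight _ * D.rootMod _))⁻¹ = _
  rw [aL_inv, aR_inv, bL_inv, bR_inv, rootWeight_inv, rootWeight_inv, rootMod_inv, rootMod_inv]
  have h1 := (D.rootWeight_pos (D.aR g)).ne'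
  have h2 := (D.rootWeight_pos (D.aL g)).ne'
  have h3 := (D.rootMod_pos (D.bR g)).ne'
  have h4 := (D.rootMod_pos (D.bL g)).ne'
  field_simp

/-- The action of `A` on `B`, given by `ab ∈ a(b) A`. -/
def dressing (D : DoubleLieGroup I G IA A IB B) (a : A) : B ≃ₜ B where
  toFun b := D.bL (D.ιA a * D.ιB b)
  invFun b := D.bL (D.ιA a⁻¹ * D.ιB b)
  left_inv b := by
    have h := D.bL_mul_aR (D.ιA a * D.ιB b)
    refine D.bL_eq (a := (D.aR (D.ιA a * D.ιB b))⁻¹) ?_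
    rw [eq_mul_inv_of_mul_eq h, map_inv, map_inv]
    group
  right_inv b := by
    have h := D.bL_mul_aR (D.ιA a⁻¹ * D.ιB b)
    refine D.bL_eq (a := (D.aR (D.ιA a⁻¹ * D.ιB b))⁻¹) ?_
    rw [eq_mul_inv_of_mul_eq h, map_inv, map_inv]
    group
  continuous_toFun := by
    have := topologicalGroup_of_lieGroup I ∞ (G := G)
    exact D.contMDiff_bL.continuous.comp (continuous_const.mul D.contMDiff_ιB.continuous)
  continuous_invFun := by
    have := topologicalGroup_of_lieGroup I ∞ (G := G)
    exact D.contMDiff_bL.continuous.comp (continuous_const.mul D.contMDiff_ιB.continuous)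

theorem dressing_apply (a : A) (b : B) : D.dressing a b = D.bL (D.ιA a * D.ιB b) := rfl

/-- At b the left-trivialized map is γ ↦ b_L(a'γ) with a' = a_R(ab). Its derivative is `derNu` at
a'⁻¹, of absolute determinant w(a')⁻¹. -/
theorem integral_weight_inv_mul_comp_dressing [MeasurableSpace B] [BorelSpace B] (μ : Measure B)
    [μ.IsHaarMeasure] (a : A) (f : B → ℂ) :
    ∫ b, ((D.weight (D.aR (D.ιA a * D.ιB b)) : ℝ) : ℂ)⁻¹ * f (D.bL (D.ιA a * D.ιB b)) ∂μ =
      ∫ b, f b ∂μ := by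
  have := topologicalGroup_of_lieGroup I ∞ (G := G)
  have := D.t2Space_B
  have := D.secondCountable_B
  let _ : MeasurableSpace EB := borel EB
  have : BorelSpace EB := ⟨rfl⟩
  have hdet : ∀ b : B, |(D.derNu (D.aR (D.ιA a * D.ιB b))⁻¹).det| =
      (D.weight (D.aR (D.ιA a * D.ιB b)))⁻¹ := fun b => by
    rw [abs_det_derNu, weight_inv]
  have h := integral_abs_det_smul_comp (J := IB) μ (D.dressing a)
    (L := fun b => D.derNu (D.aR (D.ιA a * D.ιB b))⁻¹) (fun b => by
      have e : (fun γ => (D.dressing a b)⁻¹ * D.dressing a (b * γ)) =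
          fun γ => D.bL (D.ιA (D.aR (D.ιA a * D.ιB b)) * D.ιB γ) := by
        funext γ
        rw [dressing_apply, dressing_apply, map_mul, ← mul_assoc,
          ← D.bL_mul_aR (D.ιA a * D.ιB b), mul_assoc, bL_ιB_mul, bL_ιB_mul, bL_ιA, mul_one,
          inv_mul_cancel_left, aR_ιB_mul, aR_ιA]
      rw [e]
      exact D.hasDerAt_bL_ιA_mul _) (by
        simp only [hdet]
        exact (D.contMDiff_weight.continuous.comp (D.contMDiff_aR.continuous.comp
          (continuous_const.mul D.contMDiff_ιB.continuous))).measurable.inv) f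
  simp only [hdet, Complex.ofReal_inv] at h
  exact h

end Weights

/-! ### The product and δ̂ as explicit integrals over B. -/

section ExplicitFormulas

open scoped Manifold Topology

variable {E : Type*} [NormedAddCommGroup E] [NormedSpace ℝ E] [FiniteDimensional ℝ E]
  {H : Type*} [TopologicalSpace H] {I : ModelWithCorners ℝ E H} [I.Boundaryless]
  {G : Type*} [TopologicalSpace G] [ChartedSpace H G] [Group G] [LieGroup I (⊤ : ℕ∞) G]
  [T2Space G] [SecondCountableTopology G]
  {EA : Type*} [NormedAddCommGroup EA] [NormedSpace ℝ EA] [FiniteDimensional ℝ EA]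
  {HA : Type*} [TopologicalSpace HA] {IA : ModelWithCorners ℝ EA HA} [IA.Boundaryless]
  {A : Type*} [TopologicalSpace A] [ChartedSpace HA A] [Group A] [LieGroup IA (⊤ : ℕ∞) A]
  {EB : Type*} [NormedAddCommGroup EB] [NormedSpace ℝ EB] [FiniteDimensional ℝ EB]
  {HB : Type*} [TopologicalSpace HB] {IB : ModelWithCorners ℝ EB HB} [IB.Boundaryless]
  {B : Type*} [TopologicalSpace B] [ChartedSpace HB B] [Group B] [LieGroup IB (⊤ : ℕ∞) B]
variable (D : DoubleLieGroup I G IA A IB B) [MeasurableSpace B] {κ : Type*}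
  (e : Module.Basis κ ℝ EB) (μ : Measure B)

/-- With x = a_L(z)b the composable partner is y = b_L(x)⁻¹z, and its left unit a_R(x) is where
`jac_id` evaluates the weight. -/
theorem fibreIntegral_id (Φ : G → (κ → EB) → (κ → EB) → G → ℂ) (z : G) :
    fibreIntegral D D e μ (fun x y => x = y) Φ z =
      ∫ b, ((D.rootWeight (D.aR (D.ιA (D.aL z) * D.ιB b)) : ℝ) : ℂ)⁻¹ *
        Φ (D.ιA (D.aL z) * D.ιB b) e e ((D.ιB (D.bL (D.ιA (D.aL z) * D.ιB b)))⁻¹ * z) ∂μ := by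
  rw [fibreIntegral]
  refine integral_congr_ae (Filter.Eventually.of_forall fun b => ?_)
  set x := D.ιA (D.aL z) * D.ιB b with hx
  have hx1 : D.aL x = D.aL z := by simp [hx]
  have e1 : D.baseMap (fun x y => x = y) (D.eL z) * D.ιB b = x := by
    rw [eL, baseMap_id]
  have e2 : D.hL (fun x y => x = y) x (D.eL z) = x := by
    have : D.eL z = D.eL x := by rw [eL, eL, hx1]
    rw [this, hL_id]
  have e3 : D.mA (D.sA x) z = (D.ιB (D.bL x))⁻¹ * z := by
    rw [mA_eq, D.sA_mul_ιB_bR _ _ hx1]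
  have e4 : D.aL ((D.ιB (D.bL x))⁻¹ * z) = D.aR x := D.aL_inv_bL_mul' hx1
  simp only [e1, e2, e3]
  rw [rpow_abs_jac_id D e4.symm, e4, Complex.ofReal_inv]

/-- Put x = a₁a₂b and q = b_L(a₂b). The legs of δ at x are a₁q and a₂b, so the two variables of η
are translated by b_L(a₁q)⁻¹ and q⁻¹. -/
theorem δhat_apply (ω : Sec G EB κ) (η : Sec (G × G) (EB × EB) (κ ⊕ κ)) (z : G × G)
    (v w : κ ⊕ κ → EB × EB) :
    D.δhat e μ ω η z v w = ∫ b, ((D.rootWeight (D.aR (D.ιA (D.aL z.1) *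
          D.ιB (D.bL (D.ιA (D.aL z.2) * D.ιB b)))) *
        D.rootWeight (D.aR (D.ιA (D.aL z.2) * D.ιB b)) *
        D.rootMod (D.bL (D.ιA (D.aL z.2) * D.ιB b)) : ℝ) : ℂ)⁻¹ *
      (ω (D.ιA (D.aL z.1) * D.ιA (D.aL z.2) * D.ιB b) e e *
        η ((D.ιB (D.bL (D.ιA (D.aL z.1) * D.ιB (D.bL (D.ιA (D.aL z.2) * D.ιB b)))))⁻¹ * z.1,
          (D.ιB (D.bL (D.ιA (D.aL z.2) * D.ιB b)))⁻¹ * z.2) v w) ∂μ := by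
  rw [δhat, hat, fibreIntegral]
  refine integral_congr_ae (Filter.Eventually.of_forall fun b => ?_)
  set q := D.bL (D.ιA (D.aL z.2) * D.ιB b) with hq
  set x := D.ιA (D.aL z.1) * D.ιA (D.aL z.2) * D.ιB b with hx
  have hx' : x = D.ιA (D.aL z.1) * D.ιB q * D.ιA (D.aR (D.ιA (D.aL z.2) * D.ιB b)) := by
    rw [mul_assoc, hq, bL_mul_aR, hx, mul_assoc]
  have e1 : D.baseMap D.δ (D.square.eL z) * D.ιB b = x := by
    rw [square_eL, eL, eL, baseMap_δ, map_mul]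
  have e2 : D.square.hL D.δ x (D.square.eL z) =
      (D.ιA (D.aL z.1) * D.ιB q, D.ιA (D.aL z.2) * D.ιB b) := by
    have : (D.ιA (D.aL z.1))⁻¹ * x = D.ιA (D.aL z.2) * D.ιB b := by
      rw [hx, mul_assoc, inv_mul_cancel_left]
    rw [square_eL, eL, eL, hL_δ D (by simp [hx, mul_assoc]), this]
  have e3 : D.square.mA (D.square.sA (D.ιA (D.aL z.1) * D.ιB q, D.ιA (D.aL z.2) * D.ιB b)) z =
      ((D.ιB (D.bL (D.ιA (D.aL z.1) * D.ιB q)))⁻¹ * z.1, (D.ιB q)⁻¹ * z.2) := by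
    rw [mA_eq, D.square.sA_mul_ιB_bR _ _ (by simp)]
    simp [hq]
    rfl
  simp only [e1, e2, e3]
  have e4 : D.aL ((D.ιB (D.bL (D.ιA (D.aL z.1) * D.ιB q)))⁻¹ * z.1) =
      D.aR (D.ιA (D.aL z.1) * D.ιB q) := D.aL_inv_bL_mul' (by simp)
  have e5 : D.aL ((D.ιB q)⁻¹ * z.2) = D.aR (D.ιA (D.aL z.2) * D.ιB b) :=
    D.aL_inv_bL_mul' (by simp)
  -- The element of B whose modulus appears in `jac_δ` is again q.
  have e6 : D.bR (D.ιB (D.bL x) * D.ιA (D.aR (D.ιA (D.aL z.1) * D.ιB q))) = q := by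
    rw [hx', bL_mul_ιA, bL_mul_aR]
    simp
  rw [rpow_abs_jac_δ D (by rw [e4, e5, hx', aR_mul_ιA]), e4, e5, e6, Complex.ofReal_inv]

end ExplicitFormulas

end DoubleLieGroup

end

/-! ### Bidensities as scalar functions in a fixed frame. -/

noncomputable section

namespace DoubleLieGroup

section HalfDensity

variable {V : Type*} [NormedAddCommGroup V] [NormedSpace ℝ V] [FiniteDimensional ℝ V] {κ : Type*}
  (e : Module.Basis κ ℝ V)

/-- The half-density with value `1` on the frame `e`. -/
def halfDensity (v : κ → V) : ℂ := ((|LinearMap.det (e.constr ℝ v)| ^ (1 / 2 : ℝ) : ℝ) : ℂ)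

theorem halfDensity_map (L : V →ₗ[ℝ] V) (v : κ → V) :
    halfDensity e (fun i => L (v i)) =
      ((|LinearMap.det L| ^ (1 / 2 : ℝ) : ℝ) : ℂ) * halfDensity e v := by
  have h : e.constr ℝ (fun i => L (v i)) = L ∘ₗ e.constr ℝ v :=
    e.ext fun i => by rw [e.constr_basis, LinearMap.comp_apply, e.constr_basis]
  rw [halfDensity, h, LinearMap.det_comp, abs_mul, Real.mul_rpow (abs_nonneg _) (abs_nonneg _),
    Complex.ofReal_mul, halfDensity]

theorem halfDensity_self : halfDensity e e = 1 := by
  have h : e.constr ℝ e = LinearMap.id := e.ext fun i => by rw [e.constr_basis, LinearMap.id_apply]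
  rw [halfDensity, h, LinearMap.det_id, abs_one, Real.one_rpow, Complex.ofReal_one]

theorem halfDensity_neg (v : κ → V) : halfDensity e (fun i => -v i) = halfDensity e v := by
  have h := halfDensity_map e (-LinearMap.id) v
  rw [LinearMap.abs_det_neg, LinearMap.det_id, abs_one, Real.one_rpow, Complex.ofReal_one,
    one_mul] at h
  exact h

theorem halfDensity_block (v w : κ → V) :
    halfDensity (e.prod e) (block v w) = halfDensity e v * halfDensity e w := by
  have h : (e.prod e).constr ℝ (block v w) = (e.constr ℝ v).prodMap (e.constr ℝ w) := by
    refine (e.prod e).ext fun i => ?_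
    rw [Module.Basis.constr_basis]
    cases i <;> simp [block]
  rw [halfDensity, h, LinearMap.det_prodMap, abs_mul, Real.mul_rpow (abs_nonneg _) (abs_nonneg _),
    Complex.ofReal_mul, halfDensity, halfDensity]

/-- The bidensity with coefficient `f` in the frames `ge`, `eg`. -/
def ofFun {G : Type*} (f : G → ℂ) : Sec G V κ := fun g v w => halfDensity e v * halfDensity e w * f g

theorem ofFun_self {G : Type*} (f : G → ℂ) (g : G) : ofFun e f g e e = f g := by
  rw [ofFun, halfDensity_self, one_mul, one_mul]

end HalfDensity

section Bidensities

variable {E : Type*} [NormedAddCommGroup E] [NormedSpace ℝ E] {H : Type*} [TopologicalSpace H]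
  {I : ModelWithCorners ℝ E H} {G : Type*} [TopologicalSpace G] [ChartedSpace H G] [Group G]
  {EA : Type*} [NormedAddCommGroup EA] [NormedSpace ℝ EA] {HA : Type*} [TopologicalSpace HA]
  {IA : ModelWithCorners ℝ EA HA} {A : Type*} [TopologicalSpace A] [ChartedSpace HA A] [Group A]
  {EB : Type*} [NormedAddCommGroup EB] [NormedSpace ℝ EB] {HB : Type*} [TopologicalSpace HB]
  {IB : ModelWithCorners ℝ EB HB} {B : Type*} [TopologicalSpace B] [ChartedSpace HB B] [Group B]
variable [FiniteDimensional ℝ EB] {D : DoubleLieGroup I G IA A IB B} {κ : Type*} (e : Module.Basis κ ℝ EB)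

theorem ofFun_mem {f : G → ℂ} (hf : ContMDiff I (modelWithCornersSelf ℝ ℂ) (⊤ : ℕ∞) f)
    (hc : HasCompactSupport f) : ofFun e f ∈ D.𝒜 κ := by
  refine ⟨fun g L v w => ?_, fun g L v w => ?_, fun v w => ?_, fun v w => ?_⟩
  · rw [ofFun, ofFun, halfDensity_map]
    ring
  · rw [ofFun, ofFun, halfDensity_map]
    ring
  · exact (contDiff_const_smul (𝕜 := ℝ) (halfDensity e v * halfDensity e w)).contMDiff.comp hf
  · exact hc.smul_left (f := fun _ => halfDensity e v * halfDensity e w)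

/-- Any family v, degenerate or not, is the image of `e` under the map `e.constr ℝ v`, so
homogeneity under all endomorphisms determines ω from its value on (e, e). -/
theorem eq_ofFun {ω : Sec G EB κ} (h : ω ∈ D.𝒜 κ) : ω = ofFun e fun g => ω g e e := by
  funext g v w
  have h1 := h.1 g (e.constr ℝ v) e w
  have h2 := h.2.1 g (e.constr ℝ w) e e
  simp only [e.constr_basis] at h1 h2
  rw [h1, h2, ofFun, halfDensity, halfDensity]
  ring

end Bidensities

section ComplexValued

variable {F : Type*} [NormedAddCommGroup F] [NormedSpace ℝ F] {HF : Type*} [TopologicalSpace HF]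
  {J : ModelWithCorners ℝ F HF} {N : Type*} [TopologicalSpace N] [ChartedSpace HF N]

theorem contMDiff_mul_complex {f g : N → ℂ}
    (hf : ContMDiff J (modelWithCornersSelf ℝ ℂ) (⊤ : ℕ∞) f)
    (hg : ContMDiff J (modelWithCornersSelf ℝ ℂ) (⊤ : ℕ∞) g) :
    ContMDiff J (modelWithCornersSelf ℝ ℂ) (⊤ : ℕ∞) fun x => f x * g x :=
  (contDiff_mul (𝕜 := ℝ) (𝔸 := ℂ)).contMDiff.comp (hf.prodMk_space hg)

theorem contMDiff_ofReal {f : N → ℝ} (hf : ContMDiff J (modelWithCornersSelf ℝ ℝ) (⊤ : ℕ∞) f) :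
    ContMDiff J (modelWithCornersSelf ℝ ℂ) (⊤ : ℕ∞) fun x => (f x : ℂ) :=
  Complex.ofRealCLM.contDiff.contMDiff.comp hf

end ComplexValued

section SquareWeight

open scoped Manifold ContDiff Topology

variable {E : Type*} [NormedAddCommGroup E] [NormedSpace ℝ E] [FiniteDimensional ℝ E]
  {H : Type*} [TopologicalSpace H] {I : ModelWithCorners ℝ E H} [I.Boundaryless]
  {G : Type*} [TopologicalSpace G] [ChartedSpace H G] [Group G] [LieGroup I ∞ G]
  [T2Space G] [SecondCountableTopology G]
  {EA : Type*} [NormedAddCommGroup EA] [NormedSpace ℝ EA] [FiniteDimensional ℝ EA]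
  {HA : Type*} [TopologicalSpace HA] {IA : ModelWithCorners ℝ EA HA} [IA.Boundaryless]
  {A : Type*} [TopologicalSpace A] [ChartedSpace HA A] [Group A] [LieGroup IA ∞ A]
  {EB : Type*} [NormedAddCommGroup EB] [NormedSpace ℝ EB] [FiniteDimensional ℝ EB]
  {HB : Type*} [TopologicalSpace HB] {IB : ModelWithCorners ℝ EB HB} [IB.Boundaryless]
  {B : Type*} [TopologicalSpace B] [ChartedSpace HB B] [Group B] [LieGroup IB ∞ B]
variable (D : DoubleLieGroup I G IA A IB B)

theorem adDet_prod {F : Type*} [NormedAddCommGroup F] [NormedSpace ℝ F] [FiniteDimensional ℝ F]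
    {HF : Type*} [TopologicalSpace HF] {J : ModelWithCorners ℝ F HF} [J.Boundaryless]
    {N : Type*} [TopologicalSpace N] [ChartedSpace HF N] [Group N] [LieGroup J ∞ N] (c : N × N) :
    adDet (J.prod J) c = adDet J c.1 * adDet J c.2 := by
  have h : Ad (J.prod J) c = (Ad J c.1).prodMap (Ad J c.2) :=
    (hasDerAt_conj (J := J.prod J) c).unique (((hasDerAt_conj (J := J) c.1).comp
      (hasDerAt_fst ((1 : N), (1 : N))) rfl).prodMk ((hasDerAt_conj (J := J) c.2).comp
      (hasDerAt_snd ((1 : N), (1 : N))) rfl))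
  rw [adDet, h, adDet, adDet, ← abs_mul]
  exact congrArg abs (LinearMap.det_prodMap _ _)

theorem square_rootWeight (a : A × A) :
    D.square.rootWeight a = D.rootWeight a.1 * D.rootWeight a.2 := by
  rw [rootWeight, rootWeight, rootWeight, ← Real.sqrt_mul (D.weight_pos _).le, weight, weight, weight,
    square_ιA, adDet_prod, adDet_prod, div_mul_div_comm]

/-- On B the frame be equals (Ad(b)e)b as a right frame; this is how the root of the modulus enters
the counit. -/
theorem halfDensity_Ad {κ : Type*} (e : Module.Basis κ ℝ EB) (b : B) :
    halfDensity e (fun i => Ad IB b (e i)) = ((D.rootMod b : ℝ) : ℂ) := by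
  have h := halfDensity_map e (Ad IB b).toLinearMap e
  rw [halfDensity_self, mul_one, ← Real.sqrt_eq_rpow] at h
  exact h

theorem continuous_aL : Continuous D.aL := D.contMDiff_aL.continuous
theorem continuous_aR : Continuous D.aR := D.contMDiff_aR.continuous
theorem continuous_bL : Continuous D.bL := D.contMDiff_bL.continuous
theorem continuous_bR : Continuous D.bR := D.contMDiff_bR.continuous
theorem continuous_rootWeight : Continuous D.rootWeight := D.contMDiff_rootWeight.continuous
theorem continuous_rootMod : Continuous D.rootMod := D.contMDiff_rootMod.continuous
theorem continuous_ιA : Continuous D.ιA := D.contMDiff_ιA.continuous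
theorem continuous_ιB : Continuous D.ιB := D.contMDiff_ιB.continuous

attribute [fun_prop] continuous_aL continuous_aR continuous_bL continuous_bR continuous_rootWeight
  continuous_rootMod continuous_ιA continuous_ιB

end SquareWeight

end DoubleLieGroup

end

/-! ### Kernels of δ̂(ω)(I ⊗ ω₁) and (ω₁ ⊗ I)δ̂(ω). -/

noncomputable section

theorem HasCompactSupport.prod_mul {X Y : Type*} [TopologicalSpace X] [TopologicalSpace Y]
    [R1Space X] [R1Space Y] {f : X → ℂ} {g : Y → ℂ} (hf : HasCompactSupport f)
    (hg : HasCompactSupport g) : HasCompactSupport fun p : X × Y => f p.1 * g p.2 :=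
  HasCompactSupport.intro (hf.isCompact.prod hg.isCompact) fun p hp => by
    by_contra h
    exact hp ⟨subset_tsupport f (left_ne_zero_of_mul h), subset_tsupport g (right_ne_zero_of_mul h)⟩

namespace DoubleLieGroup

section Kernels

open scoped Manifold ContDiff Topology

variable {E : Type*} [NormedAddCommGroup E] [NormedSpace ℝ E] [FiniteDimensional ℝ E]
  {H : Type*} [TopologicalSpace H] {I : ModelWithCorners ℝ E H} [I.Boundaryless]
  {G : Type*} [TopologicalSpace G] [ChartedSpace H G] [Group G] [LieGroup I ∞ G]
  [T2Space G] [SecondCountableTopology G]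
  {EA : Type*} [NormedAddCommGroup EA] [NormedSpace ℝ EA] [FiniteDimensional ℝ EA]
  {HA : Type*} [TopologicalSpace HA] {IA : ModelWithCorners ℝ EA HA} [IA.Boundaryless]
  {A : Type*} [TopologicalSpace A] [ChartedSpace HA A] [Group A] [LieGroup IA ∞ A]
  {EB : Type*} [NormedAddCommGroup EB] [NormedSpace ℝ EB] [FiniteDimensional ℝ EB]
  {HB : Type*} [TopologicalSpace HB] {IB : ModelWithCorners ℝ EB HB} [IB.Boundaryless]
  {B : Type*} [TopologicalSpace B] [ChartedSpace HB B] [Group B] [LieGroup IB ∞ B]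
variable (D : DoubleLieGroup I G IA A IB B)

/-- The homeomorphism `(g₁, g₂) ↦ (g₁a, b⁻¹g₂)`, where `b = b_R(g₁)`, `a = a_L(b⁻¹g₂)`. -/
def shearR (D : DoubleLieGroup I G IA A IB B) : G × G ≃ₜ G × G where
  toFun p := (p.1 * D.ιA (D.aL ((D.ιB (D.bR p.1))⁻¹ * p.2)), (D.ιB (D.bR p.1))⁻¹ * p.2)
  invFun p := (p.1 * (D.ιA (D.aL p.2))⁻¹, D.ιB (D.bR (p.1 * (D.ιA (D.aL p.2))⁻¹)) * p.2)
  left_inv p := by simp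
  right_inv p := by simp
  continuous_toFun := by
    have := topologicalGroup_of_lieGroup I ∞ (G := G)
    fun_prop
  continuous_invFun := by
    have := topologicalGroup_of_lieGroup I ∞ (G := G)
    fun_prop

/-- The homeomorphism `(g₁, g₂) ↦ (g₁b⁻¹, ag₂)`, where `b = b_L(g₂)`, `a = a_R(g₁b⁻¹)`. -/
def shearL (D : DoubleLieGroup I G IA A IB B) : G × G ≃ₜ G × G where
  toFun p := (p.1 * (D.ιB (D.bL p.2))⁻¹, D.ιA (D.aR (p.1 * (D.ιB (D.bL p.2))⁻¹)) * p.2)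
  invFun p := (p.1 * D.ιB (D.bL ((D.ιA (D.aR p.1))⁻¹ * p.2)), (D.ιA (D.aR p.1))⁻¹ * p.2)
  left_inv p := by simp
  right_inv p := by simp
  continuous_toFun := by
    have := topologicalGroup_of_lieGroup I ∞ (G := G)
    fun_prop
  continuous_invFun := by
    have := topologicalGroup_of_lieGroup I ∞ (G := G)
    fun_prop

theorem shearR_apply (p : G × G) : D.shearR p =
    (p.1 * D.ιA (D.aL ((D.ιB (D.bR p.1))⁻¹ * p.2)), (D.ιB (D.bR p.1))⁻¹ * p.2) := rfl

theorem shearL_apply (p : G × G) : D.shearL p =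
    (p.1 * (D.ιB (D.bL p.2))⁻¹, D.ιA (D.aR (p.1 * (D.ιB (D.bL p.2))⁻¹)) * p.2) := rfl

theorem contMDiff_shearR_snd : ContMDiff (I.prod I) I ∞ fun p : G × G => (D.shearR p).2 :=
  (D.contMDiff_ιB.comp (D.contMDiff_bR.comp contMDiff_fst)).inv.mul contMDiff_snd

theorem contMDiff_shearR_fst : ContMDiff (I.prod I) I ∞ fun p : G × G => (D.shearR p).1 :=
  contMDiff_fst.mul (D.contMDiff_ιA.comp (D.contMDiff_aL.comp D.contMDiff_shearR_snd))

theorem contMDiff_shearL_fst : ContMDiff (I.prod I) I ∞ fun p : G × G => (D.shearL p).1 :=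
  contMDiff_fst.mul (D.contMDiff_ιB.comp (D.contMDiff_bL.comp contMDiff_snd)).inv

theorem contMDiff_shearL_snd : ContMDiff (I.prod I) I ∞ fun p : G × G => (D.shearL p).2 :=
  (D.contMDiff_ιA.comp (D.contMDiff_aR.comp D.contMDiff_shearL_fst)).mul contMDiff_snd

/-- The coefficient of `δ̂(ω)(I ⊗ ω₁)`, where `f`, `f₁` are the coefficients of `ω`, `ω₁`. -/
def kernelR (D : DoubleLieGroup I G IA A IB B) (f f₁ : G → ℂ) (p : G × G) : ℂ :=
  ((D.rootWeight (D.aL (D.shearR p).2) / D.rootMod (D.bR p.1) : ℝ) : ℂ) *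
    (f (D.shearR p).1 * f₁ (D.shearR p).2)

/-- The coefficient of `(ω₁ ⊗ I)δ̂(ω)`, where `f₁`, `f` are the coefficients of `ω₁`, `ω`. -/
def kernelL (D : DoubleLieGroup I G IA A IB B) (f₁ f : G → ℂ) (p : G × G) : ℂ :=
  ((D.rootMod (D.bL p.2) / D.rootWeight (D.aR (D.shearL p).1) : ℝ) : ℂ) *
    (f₁ (D.shearL p).1 * f (D.shearL p).2)

variable {f f₁ : G → ℂ}

theorem contMDiff_kernelR (hf : ContMDiff I 𝓘(ℝ, ℂ) ∞ f) (hf₁ : ContMDiff I 𝓘(ℝ, ℂ) ∞ f₁) :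
    ContMDiff (I.prod I) 𝓘(ℝ, ℂ) ∞ (D.kernelR f f₁) :=
  contMDiff_mul_complex (contMDiff_ofReal
    ((D.contMDiff_rootWeight.comp (D.contMDiff_aL.comp D.contMDiff_shearR_snd)).div₀
      (D.contMDiff_rootMod.comp (D.contMDiff_bR.comp contMDiff_fst))
      fun _ => (D.rootMod_pos _).ne'))
    (contMDiff_mul_complex (hf.comp D.contMDiff_shearR_fst) (hf₁.comp D.contMDiff_shearR_snd))

theorem contMDiff_kernelL (hf₁ : ContMDiff I 𝓘(ℝ, ℂ) ∞ f₁) (hf : ContMDiff I 𝓘(ℝ, ℂ) ∞ f) :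
    ContMDiff (I.prod I) 𝓘(ℝ, ℂ) ∞ (D.kernelL f₁ f) :=
  contMDiff_mul_complex (contMDiff_ofReal
    ((D.contMDiff_rootMod.comp (D.contMDiff_bL.comp contMDiff_snd)).div₀
      (D.contMDiff_rootWeight.comp (D.contMDiff_aR.comp D.contMDiff_shearL_fst))
      fun _ => (D.rootWeight_pos _).ne'))
    (contMDiff_mul_complex (hf₁.comp D.contMDiff_shearL_fst) (hf.comp D.contMDiff_shearL_snd))

/-- The kernel is a scalar factor times f ⊗ f₁ composed with a homeomorphism of G × G. -/
theorem hasCompactSupport_kernelR (hf : HasCompactSupport f) (hf₁ : HasCompactSupport f₁) :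
    HasCompactSupport (D.kernelR f f₁) :=
  ((hf.prod_mul hf₁).comp_homeomorph D.shearR).mul_left

theorem hasCompactSupport_kernelL (hf₁ : HasCompactSupport f₁) (hf : HasCompactSupport f) :
    HasCompactSupport (D.kernelL f₁ f) :=
  ((hf₁.prod_mul hf).comp_homeomorph D.shearL).mul_left

variable [MeasurableSpace B] {κ : Type*} (e : Module.Basis κ ℝ EB) (μ : Measure B)

theorem mulSquare_apply (K η : Sec (G × G) (EB × EB) (κ ⊕ κ)) (z : G × G) (v w : κ ⊕ κ → EB × EB) :
    D.mulSquare e μ K η z v w = ∫ p : B × B,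
      ((D.rootWeight (D.aR (D.ιA (D.aL z.1) * D.ιB p.1)) *
        D.rootWeight (D.aR (D.ιA (D.aL z.2) * D.ιB p.2)) : ℝ) : ℂ)⁻¹ *
      (K (D.ιA (D.aL z.1) * D.ιB p.1, D.ιA (D.aL z.2) * D.ιB p.2) (e.prod e) (e.prod e) *
        η ((D.ιB (D.bL (D.ιA (D.aL z.1) * D.ιB p.1)))⁻¹ * z.1,
          (D.ιB (D.bL (D.ιA (D.aL z.2) * D.ιB p.2)))⁻¹ * z.2) v w) ∂(μ.prod μ) := by
  rw [mulSquare, mul, hat, fibreIntegral_id]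
  refine integral_congr_ae (Filter.Eventually.of_forall fun p => ?_)
  simp only [square_rootWeight, square_ιA, square_ιB, square_aL, square_aR, square_bL,
    Prod.mk_mul_mk]
  rfl

theorem continuous_fibreIntegrand {k h : G × G → ℂ} (hk : Continuous k) (hh : Continuous h)
    (a₁ a₂ : A) (z : G × G) : Continuous fun p : B × B =>
      ((D.rootWeight (D.aR (D.ιA a₁ * D.ιB p.1)) *
        D.rootWeight (D.aR (D.ιA a₂ * D.ιB p.2)) : ℝ) : ℂ)⁻¹ *
      (k (D.ιA a₁ * D.ιB p.1, D.ιA a₂ * D.ιB p.2) *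
        h ((D.ιB (D.bL (D.ιA a₁ * D.ιB p.1)))⁻¹ * z.1,
          (D.ιB (D.bL (D.ιA a₂ * D.ιB p.2)))⁻¹ * z.2)) := by
  have := topologicalGroup_of_lieGroup I ∞ (G := G)
  have h0 : ∀ p : B × B, ((D.rootWeight (D.aR (D.ιA a₁ * D.ιB p.1)) *
        D.rootWeight (D.aR (D.ιA a₂ * D.ιB p.2)) : ℝ) : ℂ) ≠ 0 := fun p =>
    Complex.ofReal_ne_zero.2 (mul_pos (D.rootWeight_pos _) (D.rootWeight_pos _)).ne'
  fun_prop (disch := exact h0)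

theorem hasCompactSupport_fibreIntegrand {k : G × G → ℂ} (hk : HasCompactSupport k)
    (s h : B × B → ℂ) (a₁ a₂ : A) : HasCompactSupport fun p : B × B =>
      s p * (k (D.ιA a₁ * D.ιB p.1, D.ιA a₂ * D.ιB p.2) * h p) := by
  have := topologicalGroup_of_lieGroup I ∞ (G := G)
  have he : Topology.IsClosedEmbedding fun p : B × B =>
      (D.ιA a₁ * D.ιB p.1, D.ιA a₂ * D.ιB p.2) :=
    ((Homeomorph.mulLeft (D.ιA a₁)).isClosedEmbedding.comp D.isClosedEmbedding_ιB).prodMap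
      ((Homeomorph.mulLeft (D.ιA a₂)).isClosedEmbedding.comp D.isClosedEmbedding_ιB)
  exact (hk.comp_isClosedEmbedding he).mul_right.mul_left

variable [BorelSpace B] [μ.IsHaarMeasure]

/-- Substitute q = b_L(a₂b) for the outer variable, which brings in w(a)⁻¹ with a = a_R(a₂b), and
translate the inner variable by b. The kernel's arguments become those of the iterated integral. -/
theorem integral_kernelR (hf : ContMDiff I 𝓘(ℝ, ℂ) ∞ f) (hf₁ : ContMDiff I 𝓘(ℝ, ℂ) ∞ f₁)
    (hc : HasCompactSupport f) (hc₁ : HasCompactSupport f₁) {h : G × G → ℂ} (hh : Continuous h)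
    (z : G × G) (a₁ a₂ : A) :
    ∫ p : B × B, ((D.rootWeight (D.aR (D.ιA a₁ * D.ιB p.1)) *
        D.rootWeight (D.aR (D.ιA a₂ * D.ιB p.2)) : ℝ) : ℂ)⁻¹ *
      (D.kernelR f f₁ (D.ιA a₁ * D.ιB p.1, D.ιA a₂ * D.ιB p.2) *
        h ((D.ιB (D.bL (D.ιA a₁ * D.ιB p.1)))⁻¹ * z.1,
          (D.ιB (D.bL (D.ιA a₂ * D.ιB p.2)))⁻¹ * z.2)) ∂(μ.prod μ) =
    ∫ b, ((D.rootWeight (D.aR (D.ιA a₁ * D.ιB (D.bL (D.ιA a₂ * D.ιB b)))) *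
        D.rootWeight (D.aR (D.ιA a₂ * D.ιB b)) * D.rootMod (D.bL (D.ιA a₂ * D.ιB b)) : ℝ) : ℂ)⁻¹ *
      (f (D.ιA a₁ * D.ιA a₂ * D.ιB b) *
        ∫ c, ((D.rootWeight (D.aR (D.ιA (D.aR (D.ιA a₂ * D.ιB b)) * D.ιB c)) : ℝ) : ℂ)⁻¹ *
          (f₁ (D.ιA (D.aR (D.ιA a₂ * D.ιB b)) * D.ιB c) *
            h ((D.ιB (D.bL (D.ιA a₁ * D.ιB (D.bL (D.ιA a₂ * D.ιB b)))))⁻¹ * z.1,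
              (D.ιB (D.bL (D.ιA (D.aR (D.ιA a₂ * D.ιB b)) * D.ιB c)))⁻¹ *
                ((D.ιB (D.bL (D.ιA a₂ * D.ιB b)))⁻¹ * z.2))) ∂μ) ∂μ := by
  have := topologicalGroup_of_lieGroup I ∞ (G := G)
  have := topologicalGroup_of_lieGroup IB ∞ (G := B)
  have := Manifold.locallyCompact_of_finiteDimensional IB (M := B)
  have := D.t2Space_B
  have := D.secondCountable_B
  rw [integral_prod _ ((D.continuous_fibreIntegrand (D.contMDiff_kernelR hf hf₁).continuous hh a₁ a₂
    z).integrable_of_hasCompactSupport (D.hasCompactSupport_fibreIntegrand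
      (D.hasCompactSupport_kernelR hc hc₁) _ _ a₁ a₂)), ← D.integral_weight_inv_mul_comp_dressing μ a₂]
  refine integral_congr_ae (Filter.Eventually.of_forall fun b => ?_)
  simp only
  set q := D.bL (D.ιA a₂ * D.ιB b) with hq
  set a := D.aR (D.ιA a₂ * D.ιB b) with ha
  have hqa : D.ιB q * D.ιA a = D.ιA a₂ * D.ιB b := D.bL_mul_aR _
  rw [← integral_mul_left_eq_self (μ := μ) (fun c => ((D.rootWeight (D.aR (D.ιA a * D.ιB c)) : ℝ) : ℂ)⁻¹ *
    (f₁ (D.ιA a * D.ιB c) * h ((D.ιB (D.bL (D.ιA a₁ * D.ιB q)))⁻¹ * z.1,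
      (D.ιB (D.bL (D.ιA a * D.ιB c)))⁻¹ * ((D.ιB q)⁻¹ * z.2)))) b⁻¹, ← integral_const_mul,
    ← integral_const_mul, ← integral_const_mul]
  refine integral_congr_ae (Filter.Eventually.of_forall fun c => ?_)
  -- The right side is the second component of `shearR` at (a₁q, a₂c); after the translation it is
  -- the fibre point at which f₁ is evaluated.
  have h1 : D.ιA a * D.ιB (b⁻¹ * c) = D.ιB q⁻¹ * (D.ιA a₂ * D.ιB c) := by
    rw [eq_inv_mul_of_mul_eq hqa, map_mul, map_inv, map_inv]
    group
  have h2 : D.aL ((D.ιB q)⁻¹ * (D.ιA a₂ * D.ιB c)) = a := by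
    rw [← map_inv, ← h1]
    simp
  have h3 : D.ιA a₁ * D.ιB q * D.ιA a = D.ιA a₁ * D.ιA a₂ * D.ιB b := by
    rw [mul_assoc, hqa, mul_assoc]
  simp only [h1, kernelR, shearR_apply, bR_ιA_mul, bR_ιB, h2, h3, aR_ιB_mul, bL_ιB_mul]
  -- The substitution contributes w(a)⁻¹ and the kernel w(a)^{1/2}, leaving the w(a)^{-1/2} required
  -- by δ̂.
  rw [← D.rootWeight_sq a]
  have e1 : (D.ιB (q⁻¹ * D.bL (D.ιA a₂ * D.ιB c)))⁻¹ * ((D.ιB q)⁻¹ * z.2) =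
      (D.ιB (D.bL (D.ιA a₂ * D.ιB c)))⁻¹ * z.2 := by
    rw [map_mul, map_inv]
    group
  rw [e1, ← map_inv]
  have n1 : ((D.rootWeight a : ℝ) : ℂ) ≠ 0 := Complex.ofReal_ne_zero.2 (D.rootWeight_pos _).ne'
  push_cast
  field_simp

/-- For fixed b, right translation of the first variable by q = b_L(a₂b) costs |det Ad(q)|⁻¹ and
makes the first argument of f₁ ⊗ f independent of b. Exchanging the integrals then gives the
iterated form. -/
theorem integral_kernelL (hf₁ : ContMDiff I 𝓘(ℝ, ℂ) ∞ f₁) (hf : ContMDiff I 𝓘(ℝ, ℂ) ∞ f)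
    (hc₁ : HasCompactSupport f₁) (hc : HasCompactSupport f) {h : G × G → ℂ} (hh : Continuous h)
    (z : G × G) (a₁ a₂ : A) :
    ∫ p : B × B, ((D.rootWeight (D.aR (D.ιA a₁ * D.ιB p.1)) *
        D.rootWeight (D.aR (D.ιA a₂ * D.ιB p.2)) : ℝ) : ℂ)⁻¹ *
      (D.kernelL f₁ f (D.ιA a₁ * D.ιB p.1, D.ιA a₂ * D.ιB p.2) *
        h ((D.ιB (D.bL (D.ιA a₁ * D.ιB p.1)))⁻¹ * z.1,
          (D.ιB (D.bL (D.ιA a₂ * D.ιB p.2)))⁻¹ * z.2)) ∂(μ.prod μ) =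
    ∫ c, ((D.rootWeight (D.aR (D.ιA a₁ * D.ιB c)) : ℝ) : ℂ)⁻¹ * (f₁ (D.ιA a₁ * D.ιB c) *
      ∫ b, ((D.rootWeight (D.aR (D.ιA (D.aR (D.ιA a₁ * D.ιB c)) *
            D.ιB (D.bL (D.ιA a₂ * D.ιB b)))) *
          D.rootWeight (D.aR (D.ιA a₂ * D.ιB b)) *
          D.rootMod (D.bL (D.ιA a₂ * D.ιB b)) : ℝ) : ℂ)⁻¹ *
        (f (D.ιA (D.aR (D.ιA a₁ * D.ιB c)) * D.ιA a₂ * D.ιB b) *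
          h ((D.ιB (D.bL (D.ιA (D.aR (D.ιA a₁ * D.ιB c)) *
              D.ιB (D.bL (D.ιA a₂ * D.ιB b)))))⁻¹ * ((D.ιB (D.bL (D.ιA a₁ * D.ιB c)))⁻¹ * z.1),
            (D.ιB (D.bL (D.ιA a₂ * D.ιB b)))⁻¹ * z.2)) ∂μ) ∂μ := by
  have := topologicalGroup_of_lieGroup I ∞ (G := G)
  have := topologicalGroup_of_lieGroup IB ∞ (G := B)
  have := Manifold.locallyCompact_of_finiteDimensional IB (M := B)
  have := D.t2Space_B
  have := D.secondCountable_B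
  have hcont := D.continuous_fibreIntegrand (D.contMDiff_kernelL hf₁ hf).continuous hh a₁ a₂ z
  have hsupp := D.hasCompactSupport_fibreIntegrand (D.hasCompactSupport_kernelL hc₁ hc)
    (fun p => ((D.rootWeight (D.aR (D.ιA a₁ * D.ιB p.1)) *
        D.rootWeight (D.aR (D.ιA a₂ * D.ιB p.2)) : ℝ) : ℂ)⁻¹)
    (fun p => h ((D.ιB (D.bL (D.ιA a₁ * D.ιB p.1)))⁻¹ * z.1,
          (D.ιB (D.bL (D.ιA a₂ * D.ιB p.2)))⁻¹ * z.2)) a₁ a₂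
  rw [integral_prod_symm _ (hcont.integrable_of_hasCompactSupport hsupp)]
  set S : B × B → ℂ := fun p => ((D.rootWeight (D.aR (D.ιA a₁ * D.ιB p.1)) *
        D.rootWeight (D.aR (D.ιA a₂ * D.ιB p.2)) : ℝ) : ℂ)⁻¹ *
      (D.kernelL f₁ f (D.ιA a₁ * D.ιB p.1, D.ιA a₂ * D.ιB p.2) *
        h ((D.ιB (D.bL (D.ιA a₁ * D.ιB p.1)))⁻¹ * z.1,
          (D.ιB (D.bL (D.ιA a₂ * D.ιB p.2)))⁻¹ * z.2)) with hS
  have e1 : ∀ b : B, ∫ c, S (c, b) ∂μ =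
      ∫ c, ((adDet IB (D.bL (D.ιA a₂ * D.ιB b)) : ℝ) : ℂ)⁻¹ *
        S (c * D.bL (D.ιA a₂ * D.ιB b), b) ∂μ := by
    intro b
    have n1 : ((adDet IB (D.bL (D.ιA a₂ * D.ιB b)) : ℝ) : ℂ) ≠ 0 :=
      Complex.ofReal_ne_zero.2 (adDet_pos _).ne'
    rw [integral_const_mul, integral_mul_right_eq_adDet_mul IB μ _ (fun c => S (c, b)),
      inv_mul_cancel_left₀ n1]
  -- The translation depends on b, so integrability of the new integrand is obtained from compact
  -- support pulled back along this homeomorphism.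
  let Ψ : B × B ≃ₜ B × B :=
    { toFun := fun p => (p.1, p.2 * D.bL (D.ιA a₂ * D.ιB p.1))
      invFun := fun p => (p.1, p.2 * (D.bL (D.ιA a₂ * D.ιB p.1))⁻¹)
      left_inv := fun p => by simp
      right_inv := fun p => by simp
      continuous_toFun := by fun_prop
      continuous_invFun := by fun_prop }
  have hint : Integrable (Function.uncurry fun b c : B =>
      ((adDet IB (D.bL (D.ιA a₂ * D.ιB b)) : ℝ) : ℂ)⁻¹ * S (c * D.bL (D.ιA a₂ * D.ιB b), b))
      (μ.prod μ) := by
    refine Continuous.integrable_of_hasCompactSupport ?_ ?_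
    · have n1 : ∀ b : B × B, ((adDet IB (D.bL (D.ιA a₂ * D.ιB b.1)) : ℝ) : ℂ) ≠ 0 := fun b =>
        Complex.ofReal_ne_zero.2 (adDet_pos _).ne'
      have n2 : Continuous (adDet IB : B → ℝ) := contMDiff_adDet.continuous
      change Continuous fun p : B × B => ((adDet IB (D.bL (D.ιA a₂ * D.ιB p.1)) : ℝ) : ℂ)⁻¹ *
        S (p.2 * D.bL (D.ιA a₂ * D.ιB p.1), p.1)
      fun_prop (disch := exact n1)
    · exact (((hsupp.comp_homeomorph (Homeomorph.prodComm B B)).comp_homeomorph Ψ).mul_left (f :=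
        fun p : B × B => ((adDet IB (D.bL (D.ιA a₂ * D.ιB p.1)) : ℝ) : ℂ)⁻¹))
  rw [integral_congr_ae (Filter.Eventually.of_forall e1), integral_integral_swap hint]
  refine integral_congr_ae (Filter.Eventually.of_forall fun c => ?_)
  simp only
  rw [← integral_const_mul, ← integral_const_mul]
  refine integral_congr_ae (Filter.Eventually.of_forall fun b => ?_)
  simp only [hS]
  set q := D.bL (D.ιA a₂ * D.ιB b) with hq
  set a := D.aR (D.ιA a₁ * D.ιB c) with ha
  have h1 : D.ιA a₁ * D.ιB (c * q) = D.ιB (D.bL (D.ιA a₁ * D.ιB c)) * (D.ιA a * D.ιB q) := by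
    rw [map_mul, ← mul_assoc, ← mul_assoc, bL_mul_aR]
  have h2 : D.ιB (D.bL (D.ιA a₁ * D.ιB c)) * (D.ιA a * D.ιB q) * (D.ιB q)⁻¹ =
      D.ιA a₁ * D.ιB c := by
    rw [← mul_assoc, mul_inv_cancel_right, bL_mul_aR]
  simp only [h1, kernelL, shearL_apply, ← hq, h2, ← ha, aR_ιB_mul, bL_ιB_mul]
  -- The translation gives |det Ad(q)|⁻¹ and the kernel |det Ad(q)|^{1/2}; the product is the factor
  -- in δ̂.
  rw [← D.rootMod_sq q, map_mul, mul_inv_rev, mul_assoc (D.ιB _)⁻¹, mul_assoc (D.ιA a)]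
  have n1 : ((D.rootMod q : ℝ) : ℂ) ≠ 0 := Complex.ofReal_ne_zero.2 (D.rootMod_pos _).ne'
  push_cast
  field_simp

end Kernels

end DoubleLieGroup

end

/-! ### Uniqueness of kernels and existence of the products. -/

noncomputable section

namespace DoubleLieGroup

section Multipliers

open scoped Manifold Topology

variable {E : Type*} [NormedAddCommGroup E] [NormedSpace ℝ E] [FiniteDimensional ℝ E]
  {H : Type*} [TopologicalSpace H] {I : ModelWithCorners ℝ E H} [I.Boundaryless]
  {G : Type*} [TopologicalSpace G] [ChartedSpace H G] [Group G] [LieGroup I (⊤ : ℕ∞) G]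
  [T2Space G] [SecondCountableTopology G]
  {EA : Type*} [NormedAddCommGroup EA] [NormedSpace ℝ EA] [FiniteDimensional ℝ EA]
  {HA : Type*} [TopologicalSpace HA] {IA : ModelWithCorners ℝ EA HA} [IA.Boundaryless]
  {A : Type*} [TopologicalSpace A] [ChartedSpace HA A] [Group A] [LieGroup IA (⊤ : ℕ∞) A]
  {EB : Type*} [NormedAddCommGroup EB] [NormedSpace ℝ EB] [FiniteDimensional ℝ EB]
  {HB : Type*} [TopologicalSpace HB] {IB : ModelWithCorners ℝ EB HB} [IB.Boundaryless]
  {B : Type*} [TopologicalSpace B] [ChartedSpace HB B] [Group B] [LieGroup IB (⊤ : ℕ∞) B]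
variable (D : DoubleLieGroup I G IA A IB B) {κ : Type*} (e : Module.Basis κ ℝ EB)

theorem hasCompactSupport_comp_ιA_mul_ιB {f : G → ℂ} (hf : HasCompactSupport f) (a : A) :
    HasCompactSupport fun b : B => f (D.ιA a * D.ιB b) := by
  have := topologicalGroup_of_lieGroup I (⊤ : ℕ∞) (G := G)
  exact hf.comp_isClosedEmbedding
    ((Homeomorph.mulLeft (D.ιA a)).isClosedEmbedding.comp D.isClosedEmbedding_ιB)

variable [MeasurableSpace B] [BorelSpace B] (μ : Measure B) [μ.IsHaarMeasure]

/-- An element of `𝒜(G_A)` is determined by the left multiplication by it. -/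
theorem eq_of_mul_eq {K K' : Sec G EB κ} (hK : K ∈ D.𝒜 κ) (hK' : K' ∈ D.𝒜 κ)
    (h : ∀ η ∈ D.𝒜 κ, D.mul e μ K η = D.mul e μ K' η) : K = K' := by
  have := topologicalGroup_of_lieGroup I (⊤ : ℕ∞) (G := G)
  have := D.t2Space_B
  have := D.secondCountable_B
  rw [eq_ofFun e hK, eq_ofFun e hK']
  congr 1
  funext g₀
  by_contra hne
  set f : G → ℂ := fun g => K g e e with hf
  set f' : G → ℂ := fun g => K' g e e with hf'
  have hfc : Continuous f := (hK.2.2.1 e e).continuous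
  have hfc' : Continuous f' := (hK'.2.2.1 e e).continuous
  set a₀ := D.aL g₀ with ha₀
  set d : ℂ := f g₀ - f' g₀ with hd
  have hd0 : d ≠ 0 := sub_ne_zero.2 hne
  -- Pairing the difference with the conjugate of d makes its real part positive at g₀, which allows
  -- a positivity argument for complex functions.
  set k : B → ℝ := fun b =>
    (starRingEnd ℂ d * (f (D.ιA a₀ * D.ιB b) - f' (D.ιA a₀ * D.ιB b))).re with hk
  have hkc : Continuous k := by
    refine Complex.continuous_re.comp (continuous_const.mul ?_)
    fun_prop
  have hk0 : 0 < k (D.bR g₀) := by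
    rw [hk]
    simp only [ha₀, aL_mul_bR]
    rw [← hd, ← Complex.normSq_eq_conj_mul_self, Complex.ofReal_re]
    exact Complex.normSq_pos.2 hd0
  set O : Set G := {x | 0 < k (D.bR x)⁻¹} with hO
  -- At the unit z = a₀ the argument of η has b_R equal to b⁻¹, so b can be read off from it. A bump
  -- at p supported in O therefore restricts the integral to the set where k is positive.
  have key : ∀ b : B, (D.ιB (D.bL (D.ιA a₀ * D.ιB b)))⁻¹ * D.ιA a₀ =
      D.ιA (D.aR (D.ιA a₀ * D.ιB b)) * D.ιB b⁻¹ := by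
    intro b
    rw [inv_mul_eq_iff_eq_mul, ← mul_assoc, bL_mul_aR, mul_assoc, ← map_mul, mul_inv_cancel,
      map_one, mul_one]
  set p : G := (D.ιB (D.bL (D.ιA a₀ * D.ιB (D.bR g₀))))⁻¹ * D.ιA a₀ with hp
  have := topologicalGroup_of_lieGroup IB (⊤ : ℕ∞) (G := B)
  have hOo : IsOpen O := isOpen_lt continuous_const (hkc.comp D.continuous_bR.inv)
  have hpO : p ∈ O := by
    change 0 < k (D.bR p)⁻¹
    rw [hp, key, bR_ιA_mul, bR_ιB, inv_inv]
    exact hk0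
  obtain ⟨ρ, hρ, -⟩ := (SmoothBumpFunction.nhds_basis_support (I := I)
    (hOo.mem_nhds hpO)).mem_iff.1 (hOo.mem_nhds hpO)
  have hρc : Continuous ρ := ρ.continuous
  have hη : ofFun e (fun x => ((ρ x : ℝ) : ℂ)) ∈ D.𝒜 κ :=
    ofFun_mem e (contMDiff_ofReal ρ.contMDiff)
      (ρ.hasCompactSupport.comp_left (g := fun t : ℝ => (t : ℂ)) Complex.ofReal_zero)
  have h1 := congrFun (congrFun (congrFun (h _ hη) (D.ιA a₀)) e) e
  simp only [mul, hat, fibreIntegral_id, ofFun_self, aL_ιA] at h1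
  set s : B → ℝ := fun b => (D.rootWeight (D.aR (D.ιA a₀ * D.ιB b)))⁻¹ *
    ρ ((D.ιB (D.bL (D.ιA a₀ * D.ιB b)))⁻¹ * D.ιA a₀) with hs
  have n1 : ∀ b : B, D.rootWeight (D.aR (D.ιA a₀ * D.ιB b)) ≠ 0 := fun b => (D.rootWeight_pos _).ne'
  have hsc : Continuous s := by fun_prop (disch := exact n1)
  have hint : ∀ F ∈ D.𝒜 κ, Integrable (fun b : B => (s b : ℂ) * F (D.ιA a₀ * D.ιB b) e e) μ := by
    intro F hF
    have hFc : Continuous fun g => F g e e := (hF.2.2.1 e e).continuous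
    refine Continuous.integrable_of_hasCompactSupport ?_
      (D.hasCompactSupport_comp_ιA_mul_ιB (hF.2.2.2 e e) a₀).mul_left
    exact (Complex.continuous_ofReal.comp hsc).mul (hFc.comp (by fun_prop))
  have h2 : ∫ b, starRingEnd ℂ d * ((s b : ℂ) * f (D.ιA a₀ * D.ιB b) -
      (s b : ℂ) * f' (D.ιA a₀ * D.ιB b)) ∂μ = 0 := by
    rw [integral_const_mul, integral_sub (hint K hK) (hint K' hK'), sub_eq_zero.2, mul_zero]
    convert h1 using 1
    all_goals
      refine integral_congr_ae (Filter.Eventually.of_forall fun b => ?_)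
      simp only [hs]
      push_cast
      ring
  have h3 : ∫ b, s b * k b ∂μ = 0 := by
    have h4 := integral_re (𝕜 := ℂ) (((hint K hK).sub (hint K' hK')).const_mul (starRingEnd ℂ d))
    have h5 : (∫ b, starRingEnd ℂ d * ((s b : ℂ) * f (D.ιA a₀ * D.ιB b) -
      (s b : ℂ) * f' (D.ιA a₀ * D.ιB b)) ∂μ).re = 0 := by rw [h2, Complex.zero_re]
    refine Eq.trans (integral_congr_ae (Filter.Eventually.of_forall fun b => ?_)) (h4.trans h5)
    change _ = (starRingEnd ℂ d * ((s b : ℂ) * f (D.ιA a₀ * D.ιB b) -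
      (s b : ℂ) * f' (D.ιA a₀ * D.ιB b))).re
    rw [← mul_sub, mul_left_comm, Complex.re_ofReal_mul]
  have hkS : HasCompactSupport k :=
    ((D.hasCompactSupport_comp_ιA_mul_ιB (hK.2.2.2 e e) a₀).sub
      (D.hasCompactSupport_comp_ιA_mul_ιB (hK'.2.2.2 e e) a₀)).comp_left
      (g := fun t : ℂ => (starRingEnd ℂ d * t).re) (by simp)
  refine ((hsc.mul hkc).integral_pos_of_hasCompactSupport_nonneg_nonzero hkS.mul_left
    (fun b => ?_) (x := D.bR g₀) ?_).ne' h3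
  · change 0 ≤ s b * k b
    by_cases hb : ρ ((D.ιB (D.bL (D.ιA a₀ * D.ιB b)))⁻¹ * D.ιA a₀) = 0
    · simp [hs, hb]
    · have h6 : 0 < k (D.bR ((D.ιB (D.bL (D.ιA a₀ * D.ιB b)))⁻¹ * D.ιA a₀))⁻¹ :=
        hρ (subset_tsupport _ hb)
      rw [key, bR_ιA_mul, bR_ιB, inv_inv] at h6
      exact mul_nonneg (mul_nonneg (inv_nonneg.2 (D.rootWeight_pos _).le) ρ.nonneg) h6.le
  · have h7 : s (D.bR g₀) = (D.rootWeight (D.aR (D.ιA a₀ * D.ιB (D.bR g₀))))⁻¹ := by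
      simp only [hs]
      rw [← hp, ρ.eq_one, mul_one]
    change s (D.bR g₀) * k (D.bR g₀) ≠ 0
    rw [h7]
    exact mul_ne_zero (inv_ne_zero (D.rootWeight_pos _).ne') hk0.ne'

theorem eq_of_mulSquare_eq {K K' : Sec (G × G) (EB × EB) (κ ⊕ κ)} (hK : K ∈ D.square.𝒜 (κ ⊕ κ))
    (hK' : K' ∈ D.square.𝒜 (κ ⊕ κ))
    (h : ∀ η ∈ D.square.𝒜 (κ ⊕ κ), D.mulSquare e μ K η = D.mulSquare e μ K' η) : K = K' := by
  have := topologicalGroup_of_lieGroup IB (⊤ : ℕ∞) (G := B)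
  have := Manifold.locallyCompact_of_finiteDimensional IB (M := B)
  have := D.t2Space_B
  have := D.secondCountable_B
  exact D.square.eq_of_mul_eq (e.prod e) (μ.prod μ) hK hK' h

/-- Both sides evaluated on fixed frames are the two sides of `integral_kernelR`, with h the
coefficient of η in those frames. -/
theorem isDeltaMulRight_kernelR {ω ω₁ : Sec G EB κ} (hω : ω ∈ D.𝒜 κ) (hω₁ : ω₁ ∈ D.𝒜 κ) :
    D.IsDeltaMulRight e μ ω ω₁
      (ofFun (e.prod e) (D.kernelR (fun g => ω g e e) fun g => ω₁ g e e)) := by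
  refine ⟨ofFun_mem (e.prod e) (D.contMDiff_kernelR (hω.2.2.1 e e) (hω₁.2.2.1 e e))
    (D.hasCompactSupport_kernelR (hω.2.2.2 e e) (hω₁.2.2.2 e e)), fun η hη => ?_⟩
  funext z v w
  simp only [mulSquare_apply, δhat_apply, leftSnd, fibreIntegral_id, ofFun_self]
  rw [D.integral_kernelR μ (hω.2.2.1 e e) (hω₁.2.2.1 e e) (hω.2.2.2 e e) (hω₁.2.2.2 e e)
    (hη.2.2.1 v w).continuous z]
  refine integral_congr_ae (Filter.Eventually.of_forall fun b => ?_)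
  have h1 : D.aL ((D.ιB (D.bL (D.ιA (D.aL z.2) * D.ιB b)))⁻¹ * z.2) =
      D.aR (D.ιA (D.aL z.2) * D.ιB b) := D.aL_inv_bL_mul' (by simp)
  simp only [h1]

theorem isMulDeltaLeft_kernelL {ω₁ ω : Sec G EB κ} (hω₁ : ω₁ ∈ D.𝒜 κ) (hω : ω ∈ D.𝒜 κ) :
    D.IsMulDeltaLeft e μ ω₁ ω
      (ofFun (e.prod e) (D.kernelL (fun g => ω₁ g e e) fun g => ω g e e)) := by
  refine ⟨ofFun_mem (e.prod e) (D.contMDiff_kernelL (hω₁.2.2.1 e e) (hω.2.2.1 e e))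
    (D.hasCompactSupport_kernelL (hω₁.2.2.2 e e) (hω.2.2.2 e e)), fun η hη => ?_⟩
  funext z v w
  simp only [mulSquare_apply, δhat_apply, leftFst, fibreIntegral_id, ofFun_self]
  rw [D.integral_kernelL μ (hω₁.2.2.1 e e) (hω.2.2.1 e e) (hω₁.2.2.2 e e) (hω.2.2.2 e e)
    (hη.2.2.1 v w).continuous z]
  refine integral_congr_ae (Filter.Eventually.of_forall fun c => ?_)
  have h1 : D.aL ((D.ιB (D.bL (D.ιA (D.aL z.1) * D.ιB c)))⁻¹ * z.1) =
      D.aR (D.ιA (D.aL z.1) * D.ιB c) := D.aL_inv_bL_mul' (by simp)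
  simp only [h1]

theorem isDeltaMulRight_iff {ω ω₁ : Sec G EB κ} (hω : ω ∈ D.𝒜 κ) (hω₁ : ω₁ ∈ D.𝒜 κ)
    (K : Sec (G × G) (EB × EB) (κ ⊕ κ)) : D.IsDeltaMulRight e μ ω ω₁ K ↔
      K = ofFun (e.prod e) (D.kernelR (fun g => ω g e e) fun g => ω₁ g e e) := by
  have h := D.isDeltaMulRight_kernelR e μ hω hω₁
  refine ⟨fun hK => D.eq_of_mulSquare_eq e μ hK.1 h.1 fun η hη => ?_, fun hK => hK ▸ h⟩
  rw [hK.2 η hη, h.2 η hη]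

theorem isMulDeltaLeft_iff {ω₁ ω : Sec G EB κ} (hω₁ : ω₁ ∈ D.𝒜 κ) (hω : ω ∈ D.𝒜 κ)
    (K : Sec (G × G) (EB × EB) (κ ⊕ κ)) : D.IsMulDeltaLeft e μ ω₁ ω K ↔
      K = ofFun (e.prod e) (D.kernelL (fun g => ω₁ g e e) fun g => ω g e e) := by
  have h := D.isMulDeltaLeft_kernelL e μ hω₁ hω
  refine ⟨fun hK => D.eq_of_mulSquare_eq e μ hK.1 h.1 fun η hη => ?_, fun hK => hK ▸ h⟩
  rw [hK.2 η hη, h.2 η hη]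

end Multipliers

end DoubleLieGroup

end

/-! ### The counit as a character. -/

noncomputable section

namespace DoubleLieGroup

section Counit

open scoped Manifold Topology

variable {E : Type*} [NormedAddCommGroup E] [NormedSpace ℝ E] [FiniteDimensional ℝ E]
  {H : Type*} [TopologicalSpace H] {I : ModelWithCorners ℝ E H} [I.Boundaryless]
  {G : Type*} [TopologicalSpace G] [ChartedSpace H G] [Group G] [LieGroup I (⊤ : ℕ∞) G]
  [T2Space G] [SecondCountableTopology G]
  {EA : Type*} [NormedAddCommGroup EA] [NormedSpace ℝ EA] [FiniteDimensional ℝ EA]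
  {HA : Type*} [TopologicalSpace HA] {IA : ModelWithCorners ℝ EA HA} [IA.Boundaryless]
  {A : Type*} [TopologicalSpace A] [ChartedSpace HA A] [Group A] [LieGroup IA (⊤ : ℕ∞) A]
  {EB : Type*} [NormedAddCommGroup EB] [NormedSpace ℝ EB] [FiniteDimensional ℝ EB]
  {HB : Type*} [TopologicalSpace HB] {IB : ModelWithCorners ℝ EB HB} [IB.Boundaryless]
  {B : Type*} [TopologicalSpace B] [ChartedSpace HB B] [Group B] [LieGroup IB (⊤ : ℕ∞) B]
variable (D : DoubleLieGroup I G IA A IB B) {κ : Type*} (e : Module.Basis κ ℝ EB)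
  [MeasurableSpace B] (μ : Measure B)

theorem counit_ofFun (f : G → ℂ) :
    D.counit e μ (ofFun e f) = ∫ b, ((D.rootMod b : ℝ) : ℂ) * f (D.ιB b) ∂μ := by
  refine integral_congr_ae (Filter.Eventually.of_forall fun b => ?_)
  simp only [ofFun, halfDensity_self, halfDensity_Ad D, one_mul]

theorem counit_eq {ω : Sec G EB κ} (hω : ω ∈ D.𝒜 κ) :
    D.counit e μ ω = ∫ b, ((D.rootMod b : ℝ) : ℂ) * ω (D.ιB b) e e ∂μ := by
  conv_lhs => rw [eq_ofFun e hω, counit_ofFun]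

theorem mul_apply_basis (ω ω₁ : Sec G EB κ) (z : G) :
    D.mul e μ ω ω₁ z e e = ∫ b, ((D.rootWeight (D.aR (D.ιA (D.aL z) * D.ιB b)) : ℝ) : ℂ)⁻¹ *
      (ω (D.ιA (D.aL z) * D.ιB b) e e *
        ω₁ ((D.ιB (D.bL (D.ιA (D.aL z) * D.ιB b)))⁻¹ * z) e e) ∂μ := by
  simp only [mul, hat, fibreIntegral_id]

/-- The frame dependence of a product comes from its right factor; ω enters only through its value
on (e, e). -/
theorem mul_eq_ofFun (ω : Sec G EB κ) {ω₁ : Sec G EB κ} (hω₁ : ω₁ ∈ D.𝒜 κ) :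
    D.mul e μ ω ω₁ = ofFun e fun z => D.mul e μ ω ω₁ z e e := by
  funext z v w
  rw [ofFun, mul_apply_basis, ← integral_const_mul, mul, hat, fibreIntegral_id]
  refine integral_congr_ae (Filter.Eventually.of_forall fun b => ?_)
  conv_lhs => rw [eq_ofFun e hω₁]
  simp only [ofFun]
  ring

theorem counit_smul (c : ℂ) (ω : Sec G EB κ) : D.counit e μ (c • ω) = c * D.counit e μ ω :=
  integral_const_mul c _

/-- On B the groupoid inverse is the group inverse, and the trivializations reduce its tangent map
to that of inversion at 1. -/
theorem tangentLR_ιB (b : B) : D.tangentLR (D.ιB b) = -ContinuousLinearMap.id ℝ EB := by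
  refine HasDerAt.mfderiv_eq (hasDerAt_inv_one.congr_of_eventuallyEq
    (Filter.Eventually.of_forall fun β => ?_))
  simp [sA, ← map_mul, ← map_inv]

theorem tangentRL_ιB (b : B) : D.tangentRL (D.ιB b) = -ContinuousLinearMap.id ℝ EB := by
  refine HasDerAt.mfderiv_eq (hasDerAt_inv_one.congr_of_eventuallyEq
    (Filter.Eventually.of_forall fun β => ?_))
  simp [sA, ← map_mul, ← map_inv]

variable [BorelSpace B] [μ.IsHaarMeasure]

/-- Inversion costs the full modulus, while its square root at b⁻¹ is the reciprocal of that at b.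
The half power is exactly what makes the measure symmetric. -/
theorem integral_rootMod_mul_comp_inv (f : B → ℂ) :
    ∫ b, ((D.rootMod b : ℝ) : ℂ) * f b⁻¹ ∂μ = ∫ b, ((D.rootMod b : ℝ) : ℂ) * f b ∂μ := by
  have := D.t2Space_B
  have := D.secondCountable_B
  rw [← integral_adDet_mul_comp_inv IB μ fun b => ((D.rootMod b : ℝ) : ℂ) * f b]
  refine integral_congr_ae (Filter.Eventually.of_forall fun b => ?_)
  have n1 : ((D.rootMod b : ℝ) : ℂ) ≠ 0 := Complex.ofReal_ne_zero.2 (D.rootMod_pos _).ne'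
  simp only [rootMod_inv, ← rootMod_sq D]
  push_cast
  field_simp

theorem counit_add {ω ω₁ : Sec G EB κ} (hω : ω ∈ D.𝒜 κ) (hω₁ : ω₁ ∈ D.𝒜 κ) :
    D.counit e μ (ω + ω₁) = D.counit e μ ω + D.counit e μ ω₁ := by
  have := D.t2Space_B
  have := D.secondCountable_B
  have hint : ∀ η ∈ D.𝒜 κ, Integrable (fun b => ((D.rootMod b : ℝ) : ℂ) * η (D.ιB b) e e) μ := by
    intro η hη
    have hc : Continuous fun g => η g e e := (hη.2.2.1 e e).continuous
    exact Continuous.integrable_of_hasCompactSupport (by fun_prop)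
      ((hη.2.2.2 e e).comp_isClosedEmbedding D.isClosedEmbedding_ιB).mul_left
  rw [D.counit_eq e μ (add_mem hω hω₁), D.counit_eq e μ hω, D.counit_eq e μ hω₁,
    ← integral_add (hint ω hω) (hint ω₁ hω₁)]
  simp only [Pi.add_apply, mul_add]

/-- For z in B every weight is 1 and the product is ordinary convolution on B. Fubini and left
invariance separate the integrals because `rootMod` is multiplicative. -/
theorem counit_mul {ω ω₁ : Sec G EB κ} (hω : ω ∈ D.𝒜 κ) (hω₁ : ω₁ ∈ D.𝒜 κ) :
    D.counit e μ (D.mul e μ ω ω₁) = D.counit e μ ω * D.counit e μ ω₁ := by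
  have := topologicalGroup_of_lieGroup IB (⊤ : ℕ∞) (G := B)
  have := Manifold.locallyCompact_of_finiteDimensional IB (M := B)
  have := D.t2Space_B
  have := D.secondCountable_B
  set f : B → ℂ := fun b => ω (D.ιB b) e e with hf
  set f₁ : B → ℂ := fun b => ω₁ (D.ιB b) e e with hf₁
  have hfc : Continuous f := (hω.2.2.1 e e).continuous.comp D.continuous_ιB
  have hfc₁ : Continuous f₁ := (hω₁.2.2.1 e e).continuous.comp D.continuous_ιB
  have hfs : HasCompactSupport f :=
    (hω.2.2.2 e e).comp_isClosedEmbedding D.isClosedEmbedding_ιB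
  have hfs₁ : HasCompactSupport f₁ :=
    (hω₁.2.2.2 e e).comp_isClosedEmbedding D.isClosedEmbedding_ιB
  have e1 : ∀ c : B, ((D.rootMod c : ℝ) : ℂ) * D.mul e μ ω ω₁ (D.ιB c) e e =
      ∫ b, ((D.rootMod c : ℝ) : ℂ) * (f b * f₁ (b⁻¹ * c)) ∂μ := by
    intro c
    rw [mul_apply_basis, ← integral_const_mul]
    simp only [aL_ιB, map_one, one_mul, aR_ιB, rootWeight_one, Complex.ofReal_one, inv_one, bL_ιB,
      hf, hf₁, map_mul, map_inv]
  have hint : Integrable (Function.uncurry fun c b : B =>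
      ((D.rootMod c : ℝ) : ℂ) * (f b * f₁ (b⁻¹ * c))) (μ.prod μ) := by
    let Ψ : B × B ≃ₜ B × B :=
      { toFun := fun p => (p.2, p.2⁻¹ * p.1)
        invFun := fun p => (p.1 * p.2, p.1)
        left_inv := fun p => by simp
        right_inv := fun p => by simp
        continuous_toFun := by fun_prop
        continuous_invFun := by fun_prop }
    refine Continuous.integrable_of_hasCompactSupport ?_
      ((hfs.prod_mul hfs₁).comp_homeomorph Ψ).mul_left
    change Continuous fun p : B × B => ((D.rootMod p.1 : ℝ) : ℂ) * (f p.2 * f₁ (p.2⁻¹ * p.1))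
    fun_prop
  rw [D.mul_eq_ofFun e μ ω hω₁, counit_ofFun, integral_congr_ae (Filter.Eventually.of_forall e1),
    integral_integral_swap hint, D.counit_eq e μ hω, D.counit_eq e μ hω₁, ← integral_mul_const]
  refine integral_congr_ae (Filter.Eventually.of_forall fun b => ?_)
  simp only
  rw [← integral_mul_left_eq_self (μ := μ)
    (fun c => ((D.rootMod c : ℝ) : ℂ) * (f b * f₁ (b⁻¹ * c))) b, ← integral_const_mul]
  refine integral_congr_ae (Filter.Eventually.of_forall fun c => ?_)
  simp only [rootMod_mul, inv_mul_cancel_left, hf, hf₁]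
  push_cast
  ring

theorem counit_star {ω : Sec G EB κ} (hω : ω ∈ D.𝒜 κ) :
    D.counit e μ (D.star ω) = starRingEnd ℂ (D.counit e μ ω) := by
  rw [D.counit_eq e μ hω, ← integral_conj]
  simp only [map_mul, Complex.conj_ofReal]
  rw [← D.integral_rootMod_mul_comp_inv μ fun b => starRingEnd ℂ (ω (D.ιB b) e e)]
  refine integral_congr_ae (Filter.Eventually.of_forall fun b => ?_)
  have h1 : D.sA (D.ιB b) = D.ιB b⁻¹ := by simp [sA]
  simp only [star, h1, tangentLR_ιB, tangentRL_ιB]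
  conv_lhs => rw [eq_ofFun e hω]
  change starRingEnd ℂ (halfDensity e (fun i => -(Ad IB b (e i))) * halfDensity e (fun i => -(e i)) *
    ω (D.ιB b⁻¹) e e) = _
  rw [halfDensity_neg, halfDensity_neg, halfDensity_Ad D, halfDensity_self, mul_one, map_mul,
    Complex.conj_ofReal]

theorem exists_counit_ne_zero : ∃ ω ∈ D.𝒜 κ, D.counit e μ ω ≠ 0 := by
  have := topologicalGroup_of_lieGroup I (⊤ : ℕ∞) (G := G)
  have := D.t2Space_B
  have := D.secondCountable_B
  obtain ⟨ρ, -⟩ := (SmoothBumpFunction.nhds_basis_tsupport (I := I) (1 : G)).ex_mem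
  have hρc : Continuous ρ := ρ.continuous
  refine ⟨ofFun e (fun x => ((ρ x : ℝ) : ℂ)), ofFun_mem e (contMDiff_ofReal ρ.contMDiff)
    (ρ.hasCompactSupport.comp_left (g := fun t : ℝ => (t : ℂ)) Complex.ofReal_zero), ?_⟩
  have h1 : ∫ b, ((D.rootMod b : ℝ) : ℂ) * ((ρ (D.ιB b) : ℝ) : ℂ) ∂μ =
      ((∫ b, D.rootMod b * ρ (D.ιB b) ∂μ : ℝ) : ℂ) := by
    rw [← integral_complex_ofReal]
    simp only [Complex.ofReal_mul]
  rw [counit_ofFun, h1, Complex.ofReal_ne_zero]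
  refine (Continuous.integral_pos_of_hasCompactSupport_nonneg_nonzero (x := 1) (by fun_prop)
    (ρ.hasCompactSupport.comp_isClosedEmbedding D.isClosedEmbedding_ιB).mul_left
    (fun b => mul_nonneg (D.rootMod_pos b).le ρ.nonneg) ?_).ne'
  change D.rootMod 1 * ρ (D.ιB 1) ≠ 0
  rw [map_one, ρ.eq_one, mul_one]
  exact (D.rootMod_pos 1).ne'

end Counit

/-! ### Counit and antipode identities from the kernels. -/

section Antipode

open scoped Manifold Topology

variable {E : Type*} [NormedAddCommGroup E] [NormedSpace ℝ E] [FiniteDimensional ℝ E]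
  {H : Type*} [TopologicalSpace H] {I : ModelWithCorners ℝ E H} [I.Boundaryless]
  {G : Type*} [TopologicalSpace G] [ChartedSpace H G] [Group G] [LieGroup I (⊤ : ℕ∞) G]
  [T2Space G] [SecondCountableTopology G]
  {EA : Type*} [NormedAddCommGroup EA] [NormedSpace ℝ EA] [FiniteDimensional ℝ EA]
  {HA : Type*} [TopologicalSpace HA] {IA : ModelWithCorners ℝ EA HA} [IA.Boundaryless]
  {A : Type*} [TopologicalSpace A] [ChartedSpace HA A] [Group A] [LieGroup IA (⊤ : ℕ∞) A]
  {EB : Type*} [NormedAddCommGroup EB] [NormedSpace ℝ EB] [FiniteDimensional ℝ EB]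
  {HB : Type*} [TopologicalSpace HB] {IB : ModelWithCorners ℝ EB HB} [IB.Boundaryless]
  {B : Type*} [TopologicalSpace B] [ChartedSpace HB B] [Group B] [LieGroup IB (⊤ : ℕ∞) B]
variable (D : DoubleLieGroup I G IA A IB B) {κ : Type*} (e : Module.Basis κ ℝ EB)

theorem split_ofFun (k : G × G → ℂ) (g₁ g₂ : G) (v₁ w₁ v₂ w₂ : κ → EB) :
    split (ofFun (e.prod e) k) g₁ g₂ v₁ w₁ v₂ w₂ =
      halfDensity e v₁ * halfDensity e w₁ * (halfDensity e v₂ * halfDensity e w₂ * k (g₁, g₂)) := by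
  rw [split, ofFun, halfDensity_block, halfDensity_block]
  ring

theorem coinv_apply (ω : Sec G EB κ) (g : G) (v w : κ → EB) :
    D.coinv ω g v w = ((D.rootWeight (D.aR g) * D.rootMod (D.bR g) /
      (D.rootWeight (D.aL g) * D.rootMod (D.bL g)) : ℝ) : ℂ) *
        ω g⁻¹ (fun i => -w i) (fun i => -v i) := by
  have h : Complex.I * (Complex.I / 2) = ((-(1 / 2) : ℝ) : ℂ) := by
    rw [← mul_div_assoc, Complex.I_mul_I]
    push_cast
    ring
  rw [coinv, R, τ, h, ← Complex.ofReal_cpow (abs_nonneg _), rpow_abs_Q_inv]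

variable [MeasurableSpace B] [BorelSpace B] (μ : Measure B) [μ.IsHaarMeasure]

/-- Putting g₁ = q = b_L(a_L(g)b), the shear sends (q, g) to the two points at which the product
integrand is evaluated. The modulus of q in the counit cancels the one in the kernel. -/
theorem counitTensorId_kernelR {ω ω₁ : Sec G EB κ} (hω₁ : ω₁ ∈ D.𝒜 κ) :
    D.counitTensorId e μ (split (ofFun (e.prod e)
      (D.kernelR (fun g => ω g e e) fun g => ω₁ g e e))) = D.mul e μ ω ω₁ := by
  rw [D.mul_eq_ofFun e μ ω hω₁]
  funext g v w
  simp only [counitTensorId, counit, split_ofFun, halfDensity_self, halfDensity_Ad D, one_mul]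
  rw [ofFun, mul_apply_basis, ← integral_const_mul,
    ← D.integral_weight_inv_mul_comp_dressing μ (D.aL g)]
  refine integral_congr_ae (Filter.Eventually.of_forall fun b => ?_)
  simp only
  set a := D.aR (D.ιA (D.aL g) * D.ιB b) with ha
  set q := D.bL (D.ιA (D.aL g) * D.ιB b) with hq
  have h1 : D.aL ((D.ιB q)⁻¹ * g) = a := D.aL_inv_bL_mul' (by simp)
  have h2 : D.ιB q * D.ιA a = D.ιA (D.aL g) * D.ιB b := D.bL_mul_aR _
  simp only [kernelR, shearR_apply, bR_ιB, h1, h2]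
  rw [← D.rootWeight_sq a]
  have n1 : ((D.rootWeight a : ℝ) : ℂ) ≠ 0 := Complex.ofReal_ne_zero.2 (D.rootWeight_pos _).ne'
  have n2 : ((D.rootMod q : ℝ) : ℂ) ≠ 0 := Complex.ofReal_ne_zero.2 (D.rootMod_pos _).ne'
  push_cast
  field_simp

theorem idTensorCounit_kernelL {ω₁ ω : Sec G EB κ} (hω : ω ∈ D.𝒜 κ) :
    D.idTensorCounit e μ (split (ofFun (e.prod e)
      (D.kernelL (fun g => ω₁ g e e) fun g => ω g e e))) = D.mul e μ ω₁ ω := by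
  have := D.t2Space_B
  have := D.secondCountable_B
  have := topologicalGroup_of_lieGroup IB (⊤ : ℕ∞) (G := B)
  rw [D.mul_eq_ofFun e μ ω₁ hω]
  funext g v w
  simp only [idTensorCounit, counit, split_ofFun, halfDensity_self, halfDensity_Ad D, one_mul]
  rw [ofFun, mul_apply_basis, ← integral_const_mul]
  -- Together with the next line this substitutes b_R(g)b⁻¹ for the fibre variable; the modulus of
  -- inversion splits into a square root from the counit and one from the kernel.
  refine Eq.trans ?_ (integral_mul_left_eq_self (μ := μ) _ (D.bR g))
  refine Eq.trans ?_ (integral_adDet_mul_comp_inv IB μ _)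
  refine integral_congr_ae (Filter.Eventually.of_forall fun b => ?_)
  simp only
  have h1 : D.ιA (D.aL g) * D.ιB (D.bR g * b⁻¹) = g * (D.ιB b)⁻¹ := by
    rw [map_mul, ← mul_assoc, aL_mul_bR, map_inv]
  have h2 : (D.ιB (D.bL (g * (D.ιB b)⁻¹)))⁻¹ * g = D.ιA (D.aR (g * (D.ιB b)⁻¹)) * D.ιB b := by
    rw [inv_mul_eq_iff_eq_mul, ← mul_assoc, bL_mul_aR, inv_mul_cancel_right]
  simp only [h1, h2, kernelL, shearL_apply, bL_ιB]
  rw [← D.rootMod_sq b]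
  push_cast
  field_simp

/-- The kernel is evaluated at (x⁻¹, b_L(x)⁻¹z), which `shearR` sends to (b⁻¹, z). So ω₁(z) leaves
the integral, all weights cancel except `rootMod` at b, and what remains is the counit after
inversion. -/
theorem mulExt_coinvTensorId_kernelR {ω ω₁ : Sec G EB κ} (hω : ω ∈ D.𝒜 κ) (hω₁ : ω₁ ∈ D.𝒜 κ) :
    D.mulExt e μ (D.coinvTensorId (split (ofFun (e.prod e)
      (D.kernelR (fun g => ω g e e) fun g => ω₁ g e e)))) = D.counit e μ ω • ω₁ := by
  funext z v w
  simp only [mulExt, fibreIntegral_id, coinvTensorId, coinv_apply, split_ofFun, halfDensity_neg,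
    halfDensity_self, one_mul, Pi.smul_apply, smul_eq_mul]
  rw [D.counit_eq e μ hω, ← D.integral_rootMod_mul_comp_inv μ (fun b => ω (D.ιB b) e e),
    ← integral_mul_const]
  refine integral_congr_ae (Filter.Eventually.of_forall fun b => ?_)
  simp only
  conv_rhs => rw [eq_ofFun e hω₁, ofFun]
  set x := D.ιA (D.aL z) * D.ιB b with hx
  have h1 : D.aL x = D.aL z := by simp [hx]
  have h2 : D.bR x = b := by simp [hx]
  have h3 : x⁻¹ * D.ιA (D.aL z) = D.ιB b⁻¹ := by
    rw [hx, mul_inv_rev, inv_mul_cancel_right, map_inv]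
  have h4 : (D.ιB (D.bL x)⁻¹)⁻¹ * ((D.ιB (D.bL x))⁻¹ * z) = z := by
    rw [map_inv, inv_inv, mul_inv_cancel_left]
  simp only [h1, h2, kernelR, shearR_apply, bR_inv, h4, h3, rootMod_inv]
  have n1 : ((D.rootWeight (D.aR x) : ℝ) : ℂ) ≠ 0 :=
    Complex.ofReal_ne_zero.2 (D.rootWeight_pos _).ne'
  have n2 : ((D.rootMod (D.bL x) : ℝ) : ℂ) ≠ 0 := Complex.ofReal_ne_zero.2 (D.rootMod_pos _).ne'
  have n3 : ((D.rootWeight (D.aL z) : ℝ) : ℂ) ≠ 0 :=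
    Complex.ofReal_ne_zero.2 (D.rootWeight_pos _).ne'
  push_cast
  field_simp

/-- With y = b_L(x)⁻¹z the kernel is evaluated at (x, y⁻¹), which `shearL` sends to (z,
b_L(z)⁻¹b_L(x)). Again ω₁(z) factors out. -/
theorem mulExt_idTensorCoinv_kernelL {ω₁ ω : Sec G EB κ} (hω₁ : ω₁ ∈ D.𝒜 κ) (hω : ω ∈ D.𝒜 κ) :
    D.mulExt e μ (D.idTensorCoinv (split (ofFun (e.prod e)
      (D.kernelL (fun g => ω₁ g e e) fun g => ω g e e)))) = D.counit e μ ω • ω₁ := by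
  have := D.t2Space_B
  have := D.secondCountable_B
  have := topologicalGroup_of_lieGroup IB (⊤ : ℕ∞) (G := B)
  funext z v w
  simp only [mulExt, fibreIntegral_id, idTensorCoinv, coinv_apply, split_ofFun, halfDensity_neg,
    halfDensity_self, one_mul, Pi.smul_apply, smul_eq_mul]
  rw [D.counit_eq e μ hω, ← integral_mul_const]
  -- The counit variable is replaced by b_L(z)⁻¹b_L(a_L(z)b), the action of a_L(z) followed by a
  -- translation; its density w(a_R(x))⁻¹ is what the weights combine to.
  refine Eq.trans ?_ (integral_mul_left_eq_self (μ := μ) _ (D.bL z)⁻¹)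
  refine Eq.trans ?_ (D.integral_weight_inv_mul_comp_dressing μ (D.aL z) _)
  refine integral_congr_ae (Filter.Eventually.of_forall fun b => ?_)
  simp only
  conv_rhs => rw [eq_ofFun e hω₁, ofFun]
  set x := D.ιA (D.aL z) * D.ιB b with hx
  have hxz : D.aL x = D.aL z := by simp [hx]
  have h1 : D.aL ((D.ιB (D.bL x))⁻¹ * z) = D.aR x := D.aL_inv_bL_mul' hxz
  have h2 : (D.ιB (D.bL x))⁻¹ * z = D.ιA (D.aR x) * D.ιB (b⁻¹ * D.bR z) := by
    rw [inv_mul_eq_iff_eq_mul, ← mul_assoc, bL_mul_aR, hx, mul_assoc, ← map_mul,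
      mul_inv_cancel_left, aL_mul_bR]
  have h3 : D.bR ((D.ιB (D.bL x))⁻¹ * z) = b⁻¹ * D.bR z := by rw [h2, bR_ιA_mul, bR_ιB]
  have h4 : D.aR ((D.ιB (D.bL x))⁻¹ * z) = D.aR z := by rw [← map_inv, aR_ιB_mul]
  have h5 : D.bL ((D.ιB (D.bL x))⁻¹ * z) = (D.bL x)⁻¹ * D.bL z := by rw [← map_inv, bL_ιB_mul]
  have h6 : x * (D.ιB (b⁻¹ * D.bR z)⁻¹)⁻¹ = z := by
    rw [← map_inv, inv_inv, hx, mul_assoc, ← map_mul, mul_inv_cancel_left, aL_mul_bR]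
  have h7 : D.ιA (D.aR z) * ((D.ιB (D.bL x))⁻¹ * z)⁻¹ = D.ιB ((D.bL z)⁻¹ * D.bL x) := by
    rw [mul_inv_rev, inv_inv, ← mul_assoc, map_mul, map_inv]
    congr 1
    rw [mul_inv_eq_iff_eq_mul, eq_inv_mul_iff_mul_eq, bL_mul_aR]
  simp only [kernelL, shearL_apply, bL_inv, h1, h3, h4, h5, h6, h7, rootMod_inv, rootMod_mul]
  rw [← D.rootWeight_sq (D.aR x)]
  have n1 : ((D.rootWeight (D.aR x) : ℝ) : ℂ) ≠ 0 :=
    Complex.ofReal_ne_zero.2 (D.rootWeight_pos _).ne'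
  have n2 : ((D.rootMod (D.bL x) : ℝ) : ℂ) ≠ 0 := Complex.ofReal_ne_zero.2 (D.rootMod_pos _).ne'
  have n3 : ((D.rootWeight (D.aR z) : ℝ) : ℂ) ≠ 0 :=
    Complex.ofReal_ne_zero.2 (D.rootWeight_pos _).ne'
  have n4 : ((D.rootMod (D.bL z) : ℝ) : ℂ) ≠ 0 := Complex.ofReal_ne_zero.2 (D.rootMod_pos _).ne'
  have n5 : ((D.rootMod b : ℝ) : ℂ) ≠ 0 := Complex.ofReal_ne_zero.2 (D.rootMod_pos _).ne'
  have n6 : ((D.rootMod (D.bR z) : ℝ) : ℂ) ≠ 0 := Complex.ofReal_ne_zero.2 (D.rootMod_pos _).ne'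
  push_cast
  field_simp

end Antipode

end DoubleLieGroup

end

/-! ### Assembly of the proposition. -/

theorem proposition5p2
    {E : Type*} [NormedAddCommGroup E] [NormedSpace ℝ E] [FiniteDimensional ℝ E]
    {H : Type*} [TopologicalSpace H] {I : ModelWithCorners ℝ E H} [I.Boundaryless]
    {G : Type*} [TopologicalSpace G] [ChartedSpace H G] [Group G] [LieGroup I (⊤ : ℕ∞) G]
    [T2Space G] [SecondCountableTopology G]
    {EA : Type*} [NormedAddCommGroup EA] [NormedSpace ℝ EA] [FiniteDimensional ℝ EA]
    {HA : Type*} [TopologicalSpace HA] {IA : ModelWithCorners ℝ EA HA} [IA.Boundaryless]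
    {A : Type*} [TopologicalSpace A] [ChartedSpace HA A] [Group A] [LieGroup IA (⊤ : ℕ∞) A]
    {EB : Type*} [NormedAddCommGroup EB] [NormedSpace ℝ EB] [FiniteDimensional ℝ EB]
    {HB : Type*} [TopologicalSpace HB] {IB : ModelWithCorners ℝ EB HB} [IB.Boundaryless]
    {B : Type*} [TopologicalSpace B] [ChartedSpace HB B] [Group B] [LieGroup IB (⊤ : ℕ∞) B]
    [MeasurableSpace B] [BorelSpace B]
    (D : DoubleLieGroup I G IA A IB B)
    {κ : Type*} [Fintype κ] (e : Module.Basis κ ℝ EB)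
    (μ : Measure B) [μ.IsHaarMeasure] :
    -- `ε` is a character of the star algebra `𝒜(G_A)`
    ((∀ ω ∈ D.𝒜 κ, ∀ ω₁ ∈ D.𝒜 κ,
        D.counit e μ (ω + ω₁) = D.counit e μ ω + D.counit e μ ω₁) ∧
      (∀ c : ℂ, ∀ ω ∈ D.𝒜 κ, D.counit e μ (c • ω) = c * D.counit e μ ω) ∧
      (∀ ω ∈ D.𝒜 κ, ∀ ω₁ ∈ D.𝒜 κ,
        D.counit e μ (D.mul e μ ω ω₁) = D.counit e μ ω * D.counit e μ ω₁) ∧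
      (∀ ω ∈ D.𝒜 κ, D.counit e μ (D.star ω) = starRingEnd ℂ (D.counit e μ ω)) ∧
      (∃ ω ∈ D.𝒜 κ, D.counit e μ ω ≠ 0)) ∧
    -- the counit and antipode identities
    (∀ ω ∈ D.𝒜 κ, ∀ ω₁ ∈ D.𝒜 κ,
      (∃! K, D.IsDeltaMulRight e μ ω ω₁ K) ∧
      (∃! K, D.IsMulDeltaLeft e μ ω₁ ω K) ∧
      (∀ K, D.IsDeltaMulRight e μ ω ω₁ K →
        D.counitTensorId e μ (DoubleLieGroup.split K) = D.mul e μ ω ω₁ ∧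
        D.mulExt e μ (D.coinvTensorId (DoubleLieGroup.split K)) = D.counit e μ ω • ω₁) ∧
      (∀ K, D.IsMulDeltaLeft e μ ω₁ ω K →
        D.idTensorCounit e μ (DoubleLieGroup.split K) = D.mul e μ ω₁ ω ∧
        D.mulExt e μ (D.idTensorCoinv (DoubleLieGroup.split K)) = D.counit e μ ω • ω₁)) := by
  refine ⟨⟨fun ω hω ω₁ hω₁ => D.counit_add e μ hω hω₁, fun c ω _ => D.counit_smul e μ c ω,
    fun ω hω ω₁ hω₁ => D.counit_mul e μ hω hω₁, fun ω hω => D.counit_star e μ hω,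
    D.exists_counit_ne_zero e μ⟩, fun ω hω ω₁ hω₁ => ⟨⟨_, D.isDeltaMulRight_kernelR e μ hω hω₁,
      fun K hK => (D.isDeltaMulRight_iff e μ hω hω₁ K).1 hK⟩,
    ⟨_, D.isMulDeltaLeft_kernelL e μ hω₁ hω, fun K hK => (D.isMulDeltaLeft_iff e μ hω₁ hω K).1 hK⟩,
    fun K hK => ?_, fun K hK => ?_⟩⟩
  -- By uniqueness any admissible K is the explicit kernel, for which the identities were computed.
  · rw [(D.isDeltaMulRight_iff e μ hω hω₁ K).1 hK]
    exact ⟨D.counitTensorId_kernelR e μ hω₁, D.mulExt_coinvTensorId_kernelR e μ hω hω₁⟩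
  · rw [(D.isMulDeltaLeft_iff e μ hω₁ hω K).1 hK]
    exact ⟨D.idTensorCounit_kernelL e μ hω, D.mulExt_idTensorCoinv_kernelL e μ hω₁ hω⟩
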